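/- **Conventions.** Let $u(x)$ range over smooth functions $\mathbb R\to\mathbb C$, $S(x)$ over smooth maps from $\mathbb R$ to unit vectors of $\mathbb R^3$, and $\gamma(x)$ over smooth maps $\mathbb R\to S^2\subset\mathbb R^3$; $\wedge$ is the cross product. Differential polynomials are real polynomials in the components of $u,u_x,u_{xx},\dots$ (respectively of $S,S_x,\dots$ modulo all consequences of $S\cdot S=1$, or of $\gamma,\gamma_x,\dots$). For a differential polynomial $F$, $D_x^{-1}F$ is the differential polynomial $G$ with $D_xG=F$ that vanishes for $u=0$ (respectively for constant $S$, $\gamma$). On $S^2$, $g$ is the metric induced from $\mathbb R^3$, $J=\gamma\wedge$ the complex structure, and $\nabla_x$ the Levi-Civita derivative along $\gamma$, i.e. the orthogonal projection of the $x$-derivative to $\gamma^\perp$. Put $$\mathcal H(\varpi)=D_x\varpi-iu\,D_x^{-1}\mathrm{Im}(u\bar\varpi),\qquad \mathcal I(\varpi)=-i\varpi,\qquad H^{(n)}=\tfrac{2}{1+n}D_x^{-1}\mathrm{Im}\big(\bar u\,(i\mathcal H)^{n+1}u\big),\qquad \mathfrak H^{(n)}=\int H^{(n)}dx ,$$ and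 let $\delta\mathfrak H/\delta\bar u$ be determined by $\delta\mathfrak H=\int 2\,\mathrm{Re}\big(\overline{(\delta\mathfrak H/\delta\bar u)}\,\delta u\big)dx$ for smooth compactly supported $\delta u$. A positively oriented orthonormal frame $(S,e_2,e_3)$ along $S(x)$ is parallel with covariant $u$ if, with $E^\perp=e_2+ie_3$, one has $S_x=\mathrm{Re}(\bar uE^\perp)$ and $E^\perp_x=-uS$. **Theorem.** For $n=0,1,2,\dots$ all the inverses $D_x^{-1}$ and variational derivatives below exist and are unique, and the following holds. 1. $\varpi^{(n)}:=\delta\mathfrak H^{(n)}/\delta\bar u=(i\mathcal H)^nu$, and the $+n$ flow on $u(t,x)$ is bi-Hamiltonian: $u_t=\mathcal H(\delta\mathfrak H^{(n)}/\delta\bar u)=\mathcal I(\delta\mathfrak H^{(n+1)}/\delta\bar u)$. 2. These flows correspond to the hierarchy of vector models $$S_t=\big(S\wedge D_x-S_xD_x^{-1}(S\wedge S_x)\cdot\big)^nS_x=f^{(n)},\qquad |S|=1,$$ whose right-hand sides are $SO(3)$-equivariant differential polynomials with $f^{(n)}\perp S$, and which commute pairwise. Precisely: in every parallel frame with covariant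 $u$, $f^{(n)}=\mathrm{Re}(\overline{\varpi^{(n)}}E^\perp)$. Moreover, for every open interval $I$ of times, every smooth solution $S(t,x)$ on $I\times\mathbb R$ of the $n$-th model has, for a suitable choice of the parallel frames, a covariant $u(t,x)$ that is a smooth solution of the $+n$ flow, and every smooth solution $u(t,x)$ of the $+n$ flow is the covariant of a smooth solution $S(t,x)$ of the $n$-th model. The hierarchy contains the Heisenberg model $S_t=S\wedge S_{xx}$ ($n=1$) and the mKdV model $-S_t=S_{xxx}+\frac32(|S_x|^2S)_x$ ($n=2$). 3. Under the identification of $S$ with a map $\gamma$ into $S^2$, the vector models are equivalent to $$\gamma_t=\big(J\nabla_x-\gamma_xD_x^{-1}g(J\gamma_x,\cdot)\big)^n\gamma_x=F^{(n)},$$ where $F^{(n)}=f^{(n)}$. In particular, $n=1$ is the Schrödinger map equation $\gamma_t=J\nabla_x\gamma_x$ and $n=2$ is $-\gamma_t=\nabla_x^2\gamma_x+\frac12|\gamma_x|_g^2\gamma_x$. 4. The Hamiltonian densities are $H^{(n)}=2h^{(n)}$, where $$(1+n)h^{(n)}=D_x^{-1}(S_x\cdot D_xf^{(n)})=D_x^{-1}g(\gamma_x,\nabla_xF^{(n)})$$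 ($u$ being a covariant of $S$). Each $h^{(n)}$ is a polynomial in the dot products $a\cdot b$ and triple products $a\cdot(b\wedge c)$ of vectors $a,b,c$ among $S,S_x,S_{xx},\dots$, equivalently a polynomial in inner products of $\gamma_x,J\gamma_x,\nabla_x\gamma_x,J\nabla_x\gamma_x,\dots$. 5. For all $m,n\ge0$, $\int_Ch^{(m)}dx$ is a constant of motion of the $n$-th vector model and of the $n$-th map equation: there is a differential polynomial $\Phi$, vanishing on constant curves, with $D_th^{(m)}=D_x\Phi$ on all smooth solutions; and on an open time interval $\int_Ch^{(m)}dx$ is independent of $t$, both for $C=S^1$ (solutions periodic in $x$, integral over a period) and for $C=\mathbb R$ (solutions with $\partial_x^kS=O((1+x^2)^{-1})$ for every $k\ge1$, locally uniformly in $t$; then $h^{(m)}$ is integrable). -/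

import Mathlib

open scoped ContDiff Manifold ComplexConjugate

namespace SpinHierarchy

noncomputable section

/-! ### Functionals of curves, total derivative and its inverse -/

section General

variable {X V : Type*} [NormedAddCommGroup V] [NormedSpace ℝ V]

/-- The total `x`-derivative of a functional `F`, where `F c x` is the value at the point `x`
of an expression built from the curve `c`. -/
def Dx (F : X → ℝ → V) : X → ℝ → V :=
  fun c x => deriv (F c) x

/-- `G = D_x⁻¹ F` inside the ring `P` of differential polynomials, the constant of integration
being fixed by the requirement that `G` vanishes on the trivial curves `Z`. -/
def IsDxInv (P : Subalgebra ℝ (X → ℝ → ℝ)) (Z : Set X) (F G : X → ℝ → ℝ) : Prop :=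
  G ∈ P ∧ Dx G = F ∧ ∀ c ∈ Z, G c = 0

/-- `D_x⁻¹ F` exists as a uniquely determined differential polynomial. -/
def HasDxInv (P : Subalgebra ℝ (X → ℝ → ℝ)) (Z : Set X) (F : X → ℝ → ℝ) : Prop :=
  ∃! G, IsDxInv P Z F G

open Classical in
/-- The formal inverse `D_x⁻¹` of the total derivative on differential polynomials
(with the value `0` when `HasDxInv` fails). -/
def DxInv (P : Subalgebra ℝ (X → ℝ → ℝ)) (Z : Set X) (F : X → ℝ → ℝ) : X → ℝ → ℝ :=
  if h : HasDxInv P Z F then h.exists.choose else 0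

/-- `c(t,x)` is a smooth solution of the evolution equation `c_t = f[c]` for `t ∈ I`, `x ∈ ℝ`.
Here `val` reads off the underlying vector function of a curve. -/
def IsSolution (val : X → ℝ → V) (f : X → ℝ → V) (I : Set ℝ) (c : ℝ → X) : Prop :=
  ContDiffOn ℝ ∞ (fun p : ℝ × ℝ => val (c p.1) p.2) (I ×ˢ Set.univ) ∧
    ∀ t ∈ I, ∀ x, HasDerivAt (fun τ => val (c τ) x) (f (c t) x) t

/-- The evolutionary vector fields `f` and `g` commute: the linearisation of `g` along `f`
equals the linearisation of `f` along `g`. The families `a`, `b` are arbitrary variations of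
the same curve with initial velocities `f` and `g`. -/
def FlowsCommute (val : X → ℝ → V) (f g : X → ℝ → V) : Prop :=
  ∀ a b : ℝ → X,
    ContDiff ℝ ∞ (fun p : ℝ × ℝ => val (a p.1) p.2) →
    ContDiff ℝ ∞ (fun p : ℝ × ℝ => val (b p.1) p.2) →
    a 0 = b 0 →
    (∀ x, HasDerivAt (fun ε => val (a ε) x) (f (a 0) x) 0) →
    (∀ x, HasDerivAt (fun ε => val (b ε) x) (g (b 0) x) 0) →
    ∀ x, ∃ w, HasDerivAt (fun ε => g (a ε) x) w 0 ∧ HasDerivAt (fun ε => f (b ε) x) w 0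

/-- Local conservation law: on solutions of `c_t = f[c]` the density `h` satisfies
`D_t h = D_x Φ` for a differential polynomial `Φ` (vanishing on trivial curves). -/
def HasLocalConservationLaw (P : Subalgebra ℝ (X → ℝ → ℝ)) (Z : Set X)
    (val : X → ℝ → V) (f : X → ℝ → V) (h : X → ℝ → ℝ) : Prop :=
  ∃ Φ ∈ P, (∀ c ∈ Z, Φ c = 0) ∧
    ∀ (I : Set ℝ) (c : ℝ → X), IsOpen I → IsSolution val f I c →
      ∀ t ∈ I, ∀ x, HasDerivAt (fun τ => h (c τ) x) (Dx Φ (c t) x) t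

/-- `∫_C h dx` is a constant of motion for `C = S¹`: solutions of period `L` in `x`. -/
def IsConservedOnCircle (val : X → ℝ → V) (f : X → ℝ → V) (h : X → ℝ → ℝ) : Prop :=
  ∀ (I : Set ℝ) (c : ℝ → X) (L : ℝ), IsOpen I → I.OrdConnected → 0 < L →
    IsSolution val f I c → (∀ t ∈ I, ∀ x, val (c t) (x + L) = val (c t) x) →
    ∀ s ∈ I, ∀ t ∈ I, ∫ x in (0 : ℝ)..L, h (c s) x = ∫ x in (0 : ℝ)..L, h (c t) x

/-- `∫_C h dx` is a constant of motion for `C = ℝ`: solutions all of whose `x`-derivatives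
of positive order decay at least like `1 / (1 + x²)`, locally uniformly in `t`. -/
def IsConservedOnLine (val : X → ℝ → V) (f : X → ℝ → V) (h : X → ℝ → ℝ) : Prop :=
  ∀ (I : Set ℝ) (c : ℝ → X), IsOpen I → I.OrdConnected → IsSolution val f I c →
    (∀ K ⊆ I, IsCompact K → ∀ k : ℕ, 1 ≤ k → ∃ B : ℝ, ∀ t ∈ K, ∀ x,
      ‖iteratedDeriv k (val (c t)) x‖ ≤ B / (1 + x ^ 2)) →
    (∀ t ∈ I, MeasureTheory.Integrable (h (c t))) ∧
      ∀ s ∈ I, ∀ t ∈ I, ∫ x, h (c s) x = ∫ x, h (c t) x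

/-- The density `h` gives a constant of motion of the evolution equation `c_t = f[c]`. -/
def IsConstantOfMotion (P : Subalgebra ℝ (X → ℝ → ℝ)) (Z : Set X)
    (val : X → ℝ → V) (f : X → ℝ → V) (h : X → ℝ → ℝ) : Prop :=
  HasLocalConservationLaw P Z val f h ∧ IsConservedOnCircle val f h ∧ IsConservedOnLine val f h

end General

/-! ### The bi-Hamiltonian flows on `u` -/

/-- Smooth complex functions `u(x)`. -/
def Wave : Type := {u : ℝ → ℂ // ContDiff ℝ ∞ u}

/-- The underlying function. -/
def Wave.val (u : Wave) : ℝ → ℂ := u.1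

/-- Real differential polynomials in `u`, `ū` and their `x`-derivatives. -/
def wavePoly : Subalgebra ℝ (Wave → ℝ → ℝ) :=
  Algebra.adjoin ℝ
    ({F | ∃ k : ℕ, F = fun u x => (iteratedDeriv k u.val x).re} ∪
     {F | ∃ k : ℕ, F = fun u x => (iteratedDeriv k u.val x).im})

/-- The trivial curve `u = 0`. -/
def waveZero : Set Wave := {u | ∀ x, u.val x = 0}

/-- `D_x⁻¹` on differential polynomials in `u`, `ū`, without constant term. -/
def waveInv (F : Wave → ℝ → ℝ) : Wave → ℝ → ℝ := DxInv wavePoly waveZero F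

/-- The density `Im(u ϖ̄)` to which `D_x⁻¹` is applied in `𝓗(ϖ)`. -/
def imPairing (ϖ : Wave → ℝ → ℂ) : Wave → ℝ → ℝ :=
  fun u x => (u.val x * conj (ϖ u x)).im

/-- The Hamiltonian operator `𝓗(ϖ) = D_x ϖ - i u D_x⁻¹ Im(u ϖ̄)`. -/
def opH (ϖ : Wave → ℝ → ℂ) : Wave → ℝ → ℂ :=
  fun u x => Dx ϖ u x - Complex.I * u.val x * (waveInv (imPairing ϖ) u x : ℂ)

/-- The Hamiltonian operator `𝓘(ϖ) = -i ϖ`. -/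
def opI (ϖ : Wave → ℝ → ℂ) : Wave → ℝ → ℂ :=
  fun u x => -Complex.I * ϖ u x

/-- `(i𝓗)ⁿ u`. -/
def iHpow (n : ℕ) : Wave → ℝ → ℂ :=
  (fun ϖ : Wave → ℝ → ℂ => fun u x => Complex.I * opH ϖ u x)^[n] (fun u x => u.val x)

/-- `Im(ū (i𝓗)ⁿ⁺¹ u)`. -/
def hamPre (n : ℕ) : Wave → ℝ → ℝ :=
  fun u x => (conj (u.val x) * iHpow (n + 1) u x).im

/-- The Hamiltonian densities `H⁽ⁿ⁾ = 2/(1+n) D_x⁻¹ Im(ū (i𝓗)ⁿ⁺¹ u)`. -/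
def hamDensity (n : ℕ) : Wave → ℝ → ℝ :=
  fun u x => 2 / (1 + (n : ℝ)) * waveInv (hamPre n) u x

/-- The variation `u + ε v`. -/
def Wave.vary (u v : Wave) (ε : ℝ) : Wave :=
  ⟨fun x => u.1 x + (ε : ℂ) * v.1 x, u.2.add (contDiff_const.mul v.2)⟩

/-- `E = δ𝔥/δū` for `𝔥 = ∫ H dx`: for all smooth compactly supported `v`, the derivative at
`ε = 0` of `𝔥[u + ε v]` is `∫ 2 Re(Ē v) dx`. -/
def IsVarDeriv (H : Wave → ℝ → ℝ) (E : Wave → ℝ → ℂ) : Prop :=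
  (∀ u, Continuous (E u)) ∧
  ∀ u v : Wave, HasCompactSupport v.val →
    HasDerivAt (fun ε : ℝ => ∫ x, (H (u.vary v ε) x - H u x))
      (∫ x, 2 * (conj (E u x) * v.val x).re) 0

open Classical in
/-- The variational derivative `δ𝔥/δū` (`0` if it does not exist). -/
def varDeriv (H : Wave → ℝ → ℝ) : Wave → ℝ → ℂ :=
  if h : ∃! E, IsVarDeriv H E then h.exists.choose else 0

/-- The right-hand side `𝓗(δ𝔥⁽ⁿ⁾/δū)` of the `+n` flow on `u`. -/
def waveFlow (n : ℕ) : Wave → ℝ → ℂ := opH (varDeriv (hamDensity n))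

/-! ### The vector models -/

/-- Euclidean space. -/
abbrev E3 : Type := EuclideanSpace ℝ (Fin 3)

/-- The wedge (cross) product on Euclidean space. -/
def cross (a b : E3) : E3 :=
  WithLp.toLp 2 (crossProduct (WithLp.ofLp a) (WithLp.ofLp b))

/-- Smooth curves `S(x)` of unit vectors. -/
def SpinCurve : Type := {S : ℝ → E3 // ContDiff ℝ ∞ S ∧ ∀ x, ‖S x‖ = 1}

/-- The underlying vector function. -/
def SpinCurve.val (S : SpinCurve) : ℝ → E3 := S.1

/-- Differential polynomials in the components of `S`, modulo all consequences of `S·S = 1`. -/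
def spinPoly : Subalgebra ℝ (SpinCurve → ℝ → ℝ) :=
  Algebra.adjoin ℝ {F | ∃ (k : ℕ) (i : Fin 3), F = fun S x => (iteratedDeriv k S.val x : E3) i}

/-- The constant curves. -/
def spinConst : Set SpinCurve := {S | ∀ x y, S.val x = S.val y}

/-- `D_x⁻¹` on differential polynomials in `S`, normalised to vanish for constant `S`. -/
def spinInv (F : SpinCurve → ℝ → ℝ) : SpinCurve → ℝ → ℝ := DxInv spinPoly spinConst F

/-- `(S ∧ S_x) · f`. -/
def spinPairing (f : SpinCurve → ℝ → E3) : SpinCurve → ℝ → ℝ :=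
  fun S x => inner ℝ (cross (S.val x) (deriv S.val x)) (f S x)

/-- The recursion operator `𝒮 = S ∧ D_x - S_x D_x⁻¹ (S ∧ S_x)·`. -/
def spinOp (f : SpinCurve → ℝ → E3) : SpinCurve → ℝ → E3 :=
  fun S x => cross (S.val x) (Dx f S x) - spinInv (spinPairing f) S x • deriv S.val x

/-- `f⁽ⁿ⁾ = 𝒮ⁿ S_x`. -/
def spinFlow (n : ℕ) : SpinCurve → ℝ → E3 :=
  spinOp^[n] (fun S x => deriv S.val x)

/-- `S_x · D_x f⁽ⁿ⁾`. -/
def spinPre (n : ℕ) : SpinCurve → ℝ → ℝ :=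
  fun S x => inner ℝ (deriv S.val x) (Dx (spinFlow n) S x)

/-- `h⁽ⁿ⁾` with `(1+n) h⁽ⁿ⁾ = D_x⁻¹ (S_x · D_x f⁽ⁿ⁾)`. -/
def spinDensity (n : ℕ) : SpinCurve → ℝ → ℝ :=
  fun S x => 1 / (1 + (n : ℝ)) * spinInv (spinPre n) S x

/-- Polynomials in the scalars `∂ⁱS·∂ʲS` and `∂ⁱS·(∂ʲS ∧ ∂ᵏS)`. -/
def spinScalars : Subalgebra ℝ (SpinCurve → ℝ → ℝ) :=
  Algebra.adjoin ℝ
    ({F | ∃ i j : ℕ, F = fun S x =>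
        inner ℝ (iteratedDeriv i S.val x) (iteratedDeriv j S.val x)} ∪
     {F | ∃ i j k : ℕ, F = fun S x =>
        inner ℝ (iteratedDeriv i S.val x)
          (cross (iteratedDeriv j S.val x) (iteratedDeriv k S.val x))})

/-- `(S, e₂, e₃)` is a positively oriented orthonormal parallel frame along the curve with unit
tangent `S`, and `u = u₂ + i u₃` is its covariant. With `E^⊥ = e₂ + i e₃` the equations read
`S_x = Re(ū E^⊥)`, `E^⊥_x = -u S`. -/
structure IsParallelFrame (S : SpinCurve) (e₂ e₃ : ℝ → E3) (u : Wave) : Prop where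
  norm_e₂ : ∀ x, ‖e₂ x‖ = 1
  orth_e₂ : ∀ x, inner ℝ (S.val x) (e₂ x) = 0
  e₃_eq : ∀ x, e₃ x = cross (S.val x) (e₂ x)
  deriv_S : ∀ x, HasDerivAt S.val ((u.val x).re • e₂ x + (u.val x).im • e₃ x) x
  deriv_e₂ : ∀ x, HasDerivAt e₂ (-(u.val x).re • S.val x) x
  deriv_e₃ : ∀ x, HasDerivAt e₃ (-(u.val x).im • S.val x) x

/-! ### The dynamical maps into the 2-sphere -/

/-- The unit sphere in Euclidean space. -/
abbrev S2 : Type := Metric.sphere (0 : E3) 1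

/-- `ℝ³` has dimension `2 + 1`; this makes the unit sphere a smooth 2-manifold in Mathlib. -/
instance finrankE3 : Fact (Module.finrank ℝ E3 = 2 + 1) := ⟨finrank_euclideanSpace_fin⟩

/-- Smooth maps `γ : ℝ → S²`. -/
def SphereCurve : Type := {γ : ℝ → S2 // ContMDiff 𝓘(ℝ, ℝ) (𝓡 2) ∞ γ}

/-- `γ` as a vector function, through `S² ⊂ ℝ³`. -/
def SphereCurve.val (γ : SphereCurve) : ℝ → E3 := fun x => (γ.1 x : E3)

/-- The spin vector `S` that belongs to the map `γ`. -/
def SphereCurve.toSpin (γ : SphereCurve) : SpinCurve :=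
  ⟨γ.val, ((contMDiff_coe_sphere (E := E3) (n := 2)).comp γ.2).contDiff, fun x => norm_eq_of_mem_sphere (γ.1 x)⟩

/-- Differential polynomials in the ambient coordinates of `γ`. -/
def mapPoly : Subalgebra ℝ (SphereCurve → ℝ → ℝ) :=
  Algebra.adjoin ℝ {F | ∃ (k : ℕ) (i : Fin 3), F = fun γ x => (iteratedDeriv k γ.val x : E3) i}

/-- The constant maps. -/
def mapConst : Set SphereCurve := {γ | ∀ x y, γ.1 x = γ.1 y}

/-- `D_x⁻¹` on differential polynomials in `γ`, normalised to vanish for constant `γ`. -/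
def mapInv (F : SphereCurve → ℝ → ℝ) : SphereCurve → ℝ → ℝ := DxInv mapPoly mapConst F

/-- The tangent vector `γ_x`. Tangent vectors of `S²` at `γ` are vectors in `γ^⊥ ⊂ ℝ³`, and the
Riemannian metric `g` is the restriction of the Euclidean inner product. -/
def tangent : SphereCurve → ℝ → E3 := fun γ x => deriv γ.val x

/-- The Levi-Civita covariant derivative `∇_x` of a tangent vector field along `γ`: the
orthogonal projection of its `x`-derivative to the tangent plane `γ^⊥`. -/
def covDeriv (F : SphereCurve → ℝ → E3) : SphereCurve → ℝ → E3 :=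
  fun γ x => (Submodule.span ℝ {γ.val x})ᗮ.starProjection (Dx F γ x)

/-- The complex structure (Hodge dual) `J` of `S²`, with the outward orientation: rotation by a
right angle in the tangent plane. -/
def opJ (F : SphereCurve → ℝ → E3) : SphereCurve → ℝ → E3 :=
  fun γ x => cross (γ.val x) (F γ x)

/-- `g(F, G)`. -/
def metric (F G : SphereCurve → ℝ → E3) : SphereCurve → ℝ → ℝ :=
  fun γ x => inner ℝ (F γ x) (G γ x)

/-- `J∇_x - γ_x D_x⁻¹ g(Jγ_x, ·)`. -/
def mapOp (F : SphereCurve → ℝ → E3) : SphereCurve → ℝ → E3 :=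
  fun γ x => opJ (covDeriv F) γ x - mapInv (metric (opJ tangent) F) γ x • tangent γ x

/-- `F⁽ⁿ⁾ = (J∇_x - γ_x D_x⁻¹ g(Jγ_x, ·))ⁿ γ_x`. -/
def mapFlow (n : ℕ) : SphereCurve → ℝ → E3 := mapOp^[n] tangent

/-- `h⁽ⁿ⁾` with `(1+n) h⁽ⁿ⁾ = D_x⁻¹ g(γ_x, ∇_x F⁽ⁿ⁾)`. -/
def mapDensity (n : ℕ) : SphereCurve → ℝ → ℝ :=
  fun γ x => 1 / (1 + (n : ℝ)) * mapInv (metric tangent (covDeriv (mapFlow n))) γ x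

/-- Polynomials in the inner products of `γ_x, Jγ_x, ∇_xγ_x, J∇_xγ_x, …`. -/
def mapScalars : Subalgebra ℝ (SphereCurve → ℝ → ℝ) :=
  Algebra.adjoin ℝ
    {F | ∃ A ∈ {T | ∃ k : ℕ, T = covDeriv^[k] tangent ∨ T = opJ (covDeriv^[k] tangent)},
      ∃ B ∈ {T | ∃ k : ℕ, T = covDeriv^[k] tangent ∨ T = opJ (covDeriv^[k] tangent)},
        F = metric A B}

end

end SpinHierarchy

open SpinHierarchy

namespace SpinHierarchy

open Set Filter Topology

/-! ### Algebras of functionals generated by jets -/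

section Jets

variable {X : Type*} {𝓖 : Set (X → ℝ → ℝ)}

/-! The nonlocal recursion becomes local through a generating series V(z) = ∑ Vₙ zⁿ with V₀ = S, z
V_x = V ∧ S and V·V = 1. The differential equation gives the tangential part of Vₙ₊₁, and the
normalisation gives its normal part aₙ = S·Vₙ₊₁ as a polynomial in earlier terms. Hence every
coefficient (`spinV`, `spinA`) is a differential polynomial. `spinV_deriv_orth_and` shows that the
two conditions are compatible. It follows that f⁽ⁿ⁾ = D_x Vₙ (`spinFlow_eq`), that -aₙ is the
inverse D_x⁻¹ in the recursion operator, and that (1+n)h⁽ⁿ⁾ = -aₙ₊₁ (`spinPre_isDxInv`). The inverse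
is unique because every curve can be joined to a trivial one without changing its jet at a given
point (`isDiffRing_adjoin`).

In a parallel frame V(z) has components (α, ω) built from u alone (`IsParallelFrame.spinV_eq`), and
(i𝓗)ⁿu = ωₙ₊₁ (`iHpow_eq`). Every u has a parallel frame (`exists_parallelFrame`), so identities for
V transfer to u.

Along the n-th flow V_t = Rₙ ∧ V, where Rₙ(z) = ∑ Vₙ₊₁₊ₖ zᵏ (`spinV_evolution`). The coefficients of
Rₙ ∧ V are symmetric in the flow and the order (`spinX_symm`), which is commutativity. Their
components along S are total x-derivatives by descent in n (`exists_spin_flux`), which gives the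
conservation laws. The variational derivative comes from the triple product of the u-series with its
z-derivative and its variation: the x-derivative of this scalar contains exactly the variation of
the density and ω paired with δu (`waveVec_variation`).

Solutions correspond because the x- and t-equations of a frame form a flat linear system. This is
integrated by `exists_flat_section`, once for a frame with prescribed u (`exists_frame`) and once
for a frame along a given S (`exists_wave_solution`). On the sphere, J∇_x is S ∧ D_x, so the map
equations are the vector models under the identification of γ with S. -/

lemma adjoin_contDiff (h : ∀ g ∈ 𝓖, ∀ c, ContDiff ℝ ∞ (g c)) {G : X → ℝ → ℝ}
    (hG : G ∈ Algebra.adjoin ℝ 𝓖) (c : X) : ContDiff ℝ ∞ (G c) := by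
  induction hG using Algebra.adjoin_induction with
  | mem x hx => exact h x hx c
  | algebraMap r => exact contDiff_const
  | add x y _ _ hx hy => exact hx.add hy
  | mul x y _ _ hx hy => exact hx.mul hy

lemma adjoin_eq_of_jets_eq {c c' : X} {x x' : ℝ} (h : ∀ g ∈ 𝓖, g c x = g c' x') {G : X → ℝ → ℝ}
    (hG : G ∈ Algebra.adjoin ℝ 𝓖) : G c x = G c' x' := by
  induction hG using Algebra.adjoin_induction with
  | mem x hx => exact h x hx
  | algebraMap r => rfl
  | add F G _ _ hx hy => simp [hx, hy]
  | mul F G _ _ hx hy => simp [hx, hy]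

lemma adjoin_contDiffOn {c : ℝ → X} {s : Set (ℝ × ℝ)}
    (h : ∀ g ∈ 𝓖, ContDiffOn ℝ ∞ (fun p : ℝ × ℝ => g (c p.1) p.2) s) {G : X → ℝ → ℝ}
    (hG : G ∈ Algebra.adjoin ℝ 𝓖) : ContDiffOn ℝ ∞ (fun p : ℝ × ℝ => G (c p.1) p.2) s := by
  induction hG using Algebra.adjoin_induction with
  | mem x hx => exact h x hx
  | algebraMap r => exact contDiffOn_const
  | add x y _ _ hx hy => exact hx.add hy
  | mul x y _ _ hx hy => exact hx.mul hy

lemma adjoin_Dx_mem (h : ∀ g ∈ 𝓖, ∀ c, ContDiff ℝ ∞ (g c))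
    (h' : ∀ g ∈ 𝓖, Dx g ∈ Algebra.adjoin ℝ 𝓖) {G : X → ℝ → ℝ}
    (hG : G ∈ Algebra.adjoin ℝ 𝓖) : Dx G ∈ Algebra.adjoin ℝ 𝓖 := by
  induction hG using Algebra.adjoin_induction with
  | mem x hx => exact h' x hx
  | algebraMap r =>
    have : Dx (algebraMap ℝ (X → ℝ → ℝ) r) = 0 := by
      funext c x
      exact deriv_const x r
    rw [this]; exact zero_mem _
  | add F G hF hG hx hy =>
    have : Dx (F + G) = Dx F + Dx G := by
      funext c x
      exact deriv_add ((adjoin_contDiff h hF c).differentiable (by simp) x)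
        ((adjoin_contDiff h hG c).differentiable (by simp) x)
    rw [this]; exact add_mem hx hy
  | mul F G hF hG hx hy =>
    have : Dx (F * G) = Dx F * G + F * Dx G := by
      funext c x
      exact deriv_mul ((adjoin_contDiff h hF c).differentiable (by simp) x)
        ((adjoin_contDiff h hG c).differentiable (by simp) x)
    rw [this]; exact add_mem (mul_mem hx hG) (mul_mem hF hy)

/-- The two properties of a ring of differential polynomials that make `D_x⁻¹` unique. -/
structure IsDiffRing (P : Subalgebra ℝ (X → ℝ → ℝ)) (Z : Set X) : Prop where
  contDiff : ∀ G ∈ P, ∀ c, ContDiff ℝ ∞ (G c)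
  eq_zero : ∀ G ∈ P, (∀ c ∈ Z, G c = 0) → Dx G = 0 → G = 0

variable {P : Subalgebra ℝ (X → ℝ → ℝ)} {Z : Set X} {F G : X → ℝ → ℝ}

lemma IsDiffRing.unique (hP : IsDiffRing P Z) (h : IsDxInv P Z F G) {G' : X → ℝ → ℝ}
    (h' : IsDxInv P Z F G') : G' = G := by
  refine sub_eq_zero.1 (hP.eq_zero _ (sub_mem h'.1 h.1) (fun c hc => ?_) ?_)
  · show G' c - G c = 0
    rw [h.2.2 c hc, h'.2.2 c hc, sub_zero]
  · funext c x
    have e1 : deriv (G c) x = F c x := congrFun (congrFun h.2.1 c) x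
    have e2 : deriv (G' c) x = F c x := congrFun (congrFun h'.2.1 c) x
    have : Dx (G' - G) c x = deriv (G' c) x - deriv (G c) x :=
      deriv_sub ((hP.contDiff _ h'.1 c).differentiable (by simp) x)
        ((hP.contDiff _ h.1 c).differentiable (by simp) x)
    rw [this, e1, e2, sub_self]; rfl

lemma IsDiffRing.hasDxInv (hP : IsDiffRing P Z) (h : IsDxInv P Z F G) : HasDxInv P Z F :=
  ⟨G, h, fun _ h' => hP.unique h h'⟩

lemma IsDiffRing.DxInv_eq (hP : IsDiffRing P Z) (h : IsDxInv P Z F G) : DxInv P Z F = G := by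
  have h0 := hP.hasDxInv h
  rw [DxInv, dif_pos h0]
  exact hP.unique h h0.exists.choose_spec

/-- The algebra of functionals is a differential ring when every curve can be modified, away from
a point and without changing the jet there, so as to be trivial somewhere. -/
lemma isDiffRing_adjoin (h : ∀ g ∈ 𝓖, ∀ c, ContDiff ℝ ∞ (g c))
    (hZ : ∀ c x, ∃ c' : X, (∀ g ∈ 𝓖, g c' x = g c x) ∧
      ∃ z ∈ Z, ∃ y, ∀ g ∈ 𝓖, g c' y = g z y) :
    IsDiffRing (Algebra.adjoin ℝ 𝓖) Z := by
  refine ⟨fun G hG c => adjoin_contDiff h hG c, fun G hG h0 hD => ?_⟩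
  funext c x
  obtain ⟨c', h1, z, hz, y, h2⟩ := hZ c x
  -- `Dx G` vanishes on all curves, so it may be integrated along the modified curve `c'` even
  -- though the claim concerns `c`.
  have hc : ∀ a b, G c' a = G c' b :=
    is_const_of_deriv_eq_zero ((adjoin_contDiff h hG c').differentiable (by simp))
      (fun a => congrFun (congrFun hD c') a)
  rw [← adjoin_eq_of_jets_eq h1 hG, hc x y, adjoin_eq_of_jets_eq h2 hG, h0 z hz]
  rfl

end Jets

/-! ### Smooth families of curves -/

section Families

variable {E F : Type*} [NormedAddCommGroup E] [NormedSpace ℝ E]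
  [NormedAddCommGroup F] [NormedSpace ℝ F] {I : Set ℝ}

/-- Joint smoothness of `f(t,x)` on `I × ℝ`. -/
def SmoothFam (I : Set ℝ) (f : ℝ → ℝ → E) : Prop :=
  ContDiffOn ℝ ∞ (fun p : ℝ × ℝ => f p.1 p.2) (I ×ˢ univ)

variable {f : ℝ → ℝ → E}

lemma SmoothFam.contDiffAt (hf : SmoothFam I f) (hI : IsOpen I) {t : ℝ} (ht : t ∈ I) (x : ℝ) :
    ContDiffAt ℝ ∞ (fun p : ℝ × ℝ => f p.1 p.2) (t, x) :=
  ContDiffOn.contDiffAt hf ((hI.prod isOpen_univ).mem_nhds ⟨ht, mem_univ x⟩)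

lemma SmoothFam.hasFDerivAt (hf : SmoothFam I f) (hI : IsOpen I) {t : ℝ} (ht : t ∈ I) (x : ℝ) :
    HasFDerivAt (fun p : ℝ × ℝ => f p.1 p.2) (fderiv ℝ (fun p : ℝ × ℝ => f p.1 p.2) (t, x)) (t, x) :=
  ((hf.contDiffAt hI ht x).differentiableAt (by simp)).hasFDerivAt

lemma SmoothFam.contDiff_x (hf : SmoothFam I f) (hI : IsOpen I) {t : ℝ} (ht : t ∈ I) :
    ContDiff ℝ ∞ (f t) := by
  rw [contDiff_iff_contDiffAt]
  intro x
  exact (hf.contDiffAt hI ht x).comp x (contDiffAt_const.prodMk contDiffAt_id)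

lemma SmoothFam.hasDerivAt_x (hf : SmoothFam I f) (hI : IsOpen I) {t : ℝ} (ht : t ∈ I) (x : ℝ) :
    HasDerivAt (f t) (deriv (f t) x) x :=
  ((hf.contDiff_x hI ht).differentiable (by simp) x).hasDerivAt

lemma SmoothFam.hasDerivAt_t (hf : SmoothFam I f) (hI : IsOpen I) {t : ℝ} (ht : t ∈ I) (x : ℝ) :
    HasDerivAt (fun τ => f τ x) (deriv (fun τ => f τ x) t) t := by
  have : ContDiffAt ℝ ∞ (fun τ => f τ x) t :=
    (hf.contDiffAt hI ht x).comp t (contDiffAt_id.prodMk contDiffAt_const)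
  exact (this.differentiableAt (by simp)).hasDerivAt

lemma SmoothFam.deriv_x_eq (hf : SmoothFam I f) (hI : IsOpen I) {t : ℝ} (ht : t ∈ I) (x : ℝ) :
    deriv (f t) x = fderiv ℝ (fun p : ℝ × ℝ => f p.1 p.2) (t, x) (0, 1) := by
  have h1 : HasDerivAt (fun y : ℝ => ((t, y) : ℝ × ℝ)) (0, 1) x :=
    (hasDerivAt_const x t).prodMk (hasDerivAt_id x)
  exact ((hf.hasFDerivAt hI ht x).comp_hasDerivAt x h1).deriv

lemma SmoothFam.deriv_t_eq (hf : SmoothFam I f) (hI : IsOpen I) {t : ℝ} (ht : t ∈ I) (x : ℝ) :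
    deriv (fun τ => f τ x) t = fderiv ℝ (fun p : ℝ × ℝ => f p.1 p.2) (t, x) (1, 0) := by
  have h1 : HasDerivAt (fun y : ℝ => ((y, x) : ℝ × ℝ)) (1, 0) t :=
    (hasDerivAt_id t).prodMk (hasDerivAt_const t x)
  exact ((hf.hasFDerivAt hI ht x).comp_hasDerivAt t h1).deriv

lemma SmoothFam.fderiv_apply (hf : SmoothFam I f) (hI : IsOpen I) (v : ℝ × ℝ) :
    ContDiffOn ℝ ∞ (fun p => fderiv ℝ (fun p : ℝ × ℝ => f p.1 p.2) p v) (I ×ˢ univ) :=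
  (ContDiffOn.fderiv_of_isOpen hf (hI.prod isOpen_univ) (by simp)).clm_apply contDiffOn_const

lemma SmoothFam.dx (hf : SmoothFam I f) (hI : IsOpen I) :
    SmoothFam I (fun t x => deriv (f t) x) :=
  (hf.fderiv_apply hI (0, 1)).congr fun p hp => hf.deriv_x_eq hI hp.1 p.2

lemma SmoothFam.dt (hf : SmoothFam I f) (hI : IsOpen I) :
    SmoothFam I (fun t x => deriv (fun τ => f τ x) t) :=
  (hf.fderiv_apply hI (1, 0)).congr fun p hp => hf.deriv_t_eq hI hp.1 p.2

lemma SmoothFam.iteratedDeriv (hf : SmoothFam I f) (hI : IsOpen I) (k : ℕ) :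
    SmoothFam I (fun t x => iteratedDeriv k (f t) x) := by
  induction k with
  | zero => simpa using! hf
  | succ k ih => simpa [iteratedDeriv_succ] using! ih.dx hI

lemma SmoothFam.clm (L : E →L[ℝ] F) (hf : SmoothFam I f) : SmoothFam I (fun t x => L (f t x)) :=
  L.contDiff.comp_contDiffOn hf

/-- Mixed partial derivatives commute. -/
lemma SmoothFam.hasDerivAt_mixed (hf : SmoothFam I f) (hI : IsOpen I) {t : ℝ} (ht : t ∈ I)
    (x : ℝ) :
    HasDerivAt (fun τ => deriv (f τ) x) (deriv (fun y => deriv (fun τ => f τ y) t) x) t := by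
  set g := fun p : ℝ × ℝ => f p.1 p.2 with hg
  have hs : IsSymmSndFDerivAt ℝ g (t, x) :=
    (hf.contDiffAt hI ht x).isSymmSndFDerivAt
      (by rw [minSmoothness_of_isRCLikeNormedField]; exact WithTop.coe_le_coe.2 le_top)
  have hd : HasFDerivAt (fderiv ℝ g) (fderiv ℝ (fderiv ℝ g) (t, x)) (t, x) :=
    (((hf.contDiffAt hI ht x).fderiv_right (m := 1)
      (WithTop.coe_le_coe.2 le_top)).differentiableAt one_ne_zero).hasFDerivAt
  have ht1 : HasDerivAt (fun y : ℝ => ((y, x) : ℝ × ℝ)) (1, 0) t :=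
    (hasDerivAt_id t).prodMk (hasDerivAt_const t x)
  have hx1 : HasDerivAt (fun y : ℝ => ((t, y) : ℝ × ℝ)) (0, 1) x :=
    (hasDerivAt_const x t).prodMk (hasDerivAt_id x)
  have e1 : HasDerivAt (fun τ => fderiv ℝ g (τ, x) (0, 1))
      (fderiv ℝ (fderiv ℝ g) (t, x) (1, 0) (0, 1)) t := by
    exact ((ContinuousLinearMap.apply ℝ E ((0 : ℝ), (1 : ℝ))).hasFDerivAt.comp_hasDerivAt t
      (hd.comp_hasDerivAt t ht1))
  have e2 : HasDerivAt (fun y => fderiv ℝ g (t, y) (1, 0))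
      (fderiv ℝ (fderiv ℝ g) (t, x) (0, 1) (1, 0)) x := by
    exact ((ContinuousLinearMap.apply ℝ E ((1 : ℝ), (0 : ℝ))).hasFDerivAt.comp_hasDerivAt x
      (hd.comp_hasDerivAt x hx1))
  have e3 : deriv (fun y => deriv (fun τ => f τ y) t) x
      = fderiv ℝ (fderiv ℝ g) (t, x) (0, 1) (1, 0) := by
    rw [← e2.deriv]
    congr 1
    funext y
    exact hf.deriv_t_eq hI ht y
  rw [e3, ← hs (1, 0) (0, 1)]
  refine e1.congr_of_eventuallyEq ?_
  filter_upwards [hI.mem_nhds ht] with τ hτ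
  exact hf.deriv_x_eq hI hτ x

/-- Constancy of a family both of whose partial derivatives vanish. -/
lemma eq_of_partials_zero {f : ℝ → ℝ → ℝ} (hI : IsOpen I) (hc : I.OrdConnected)
    (hx : ∀ t ∈ I, ∀ x, HasDerivAt (f t) 0 x) (ht : ∀ t ∈ I, HasDerivAt (fun τ => f τ 0) 0 t)
    {s t : ℝ} (hs : s ∈ I) (ht' : t ∈ I) (x : ℝ) : f t x = f s 0 := by
  have h1 : f t x = f t 0 :=
    is_const_of_deriv_eq_zero (fun y => (hx t ht' y).differentiableAt)
      (fun y => (hx t ht' y).deriv) x 0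
  rw [h1]
  exact hI.is_const_of_deriv_eq_zero hc.isPreconnected
    (fun y hy => (ht y hy).differentiableAt.differentiableWithinAt)
    (fun y hy => (ht y hy).deriv) ht' hs

end Families

/-! ### Conserved densities -/

section Conservation

variable {I : Set ℝ}

/-- If `h_t = Φ_x`, the change of `∫_a^b h` is the time integral of the flux difference. -/
lemma integral_sub_of_flux (hI : IsOpen I) (hc : I.OrdConnected) {h Φ : ℝ → ℝ → ℝ}
    (hh : SmoothFam I h) (hΦ : SmoothFam I Φ)
    (hd : ∀ t ∈ I, ∀ x, HasDerivAt (fun τ => h τ x) (deriv (Φ t) x) t)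
    {s t : ℝ} (hs : s ∈ I) (ht : t ∈ I) (a b : ℝ) :
    (∫ x in a..b, h t x) - (∫ x in a..b, h s x) = ∫ τ in s..t, (Φ τ b - Φ τ a) := by
  have hsub : uIcc s t ⊆ I := hc.uIcc_subset hs ht
  have hcont : ContinuousOn (fun p : ℝ × ℝ => deriv (Φ p.1) p.2) (I ×ˢ univ) :=
    ContDiffOn.continuousOn (hΦ.dx hI)
  have hx : ∀ x, ContinuousOn (fun τ => deriv (Φ τ) x) (uIcc s t) := fun x =>
    hcont.comp (continuous_id.prodMk continuous_const).continuousOn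
      (fun τ hτ => ⟨hsub hτ, mem_univ x⟩)
  have e1 : ∀ x, h t x - h s x = ∫ τ in s..t, deriv (Φ τ) x := fun x =>
    (intervalIntegral.integral_eq_sub_of_hasDerivAt (fun τ hτ => hd τ (hsub hτ) x)
      (hx x).intervalIntegrable).symm
  have e2 : ∀ τ ∈ I, Φ τ b - Φ τ a = ∫ x in a..b, deriv (Φ τ) x := fun τ hτ =>
    (intervalIntegral.integral_eq_sub_of_hasDerivAt (fun x _ => hΦ.hasDerivAt_x hI hτ x)
      (((hΦ.dx hI).contDiff_x hI hτ).continuous.intervalIntegrable a b)).symm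
  rw [← intervalIntegral.integral_sub ((hh.contDiff_x hI ht).continuous.intervalIntegrable a b)
    ((hh.contDiff_x hI hs).continuous.intervalIntegrable a b),
    intervalIntegral.integral_congr (fun x _ => e1 x),
    intervalIntegral.integral_congr (fun τ hτ => e2 τ (hsub hτ))]
  apply MeasureTheory.intervalIntegral_intervalIntegral_swap
  have hK : IsCompact (uIcc a b ×ˢ uIcc s t) := isCompact_uIcc.prod isCompact_uIcc
  have : ContinuousOn (Function.uncurry fun x τ => deriv (Φ τ) x) (uIcc a b ×ˢ uIcc s t) :=
    hcont.comp continuous_swap.continuousOn (fun p hp => ⟨hsub hp.2, mem_univ _⟩)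
  exact (this.integrableOn_compact hK).mono_set (prod_mono uIoc_subset_uIcc uIoc_subset_uIcc)

end Conservation

/-! ### Flat linear systems -/

section Flat

variable {E : Type*} [NormedAddCommGroup E] [NormedSpace ℝ E] {I : Set ℝ}

/-- The terms of the Dyson series of the linear equation `y' = A y`, `y(t₀) = y₀`. -/
noncomputable def dysonTerm (A : ℝ → E →L[ℝ] E) (t₀ : ℝ) (y₀ : E) : ℕ → ℝ → E
  | 0 => fun _ => y₀
  | k + 1 => fun t => ∫ s in t₀..t, A s (dysonTerm A t₀ y₀ k s)

variable {A : ℝ → E →L[ℝ] E} {t₀ : ℝ} {y₀ : E}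

lemma dysonTerm_hasDerivAt [CompleteSpace E] (hI : IsOpen I) (hc : I.OrdConnected)
    (hA : ContinuousOn A I) (h0 : t₀ ∈ I) (k : ℕ) :
    ContinuousOn (dysonTerm A t₀ y₀ k) I ∧
      ∀ t ∈ I, HasDerivAt (dysonTerm A t₀ y₀ (k + 1)) (A t (dysonTerm A t₀ y₀ k t)) t := by
  have step : ∀ k, ContinuousOn (dysonTerm A t₀ y₀ k) I →
      ∀ t ∈ I, HasDerivAt (dysonTerm A t₀ y₀ (k + 1)) (A t (dysonTerm A t₀ y₀ k t)) t := by
    intro k hk t ht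
    have hcont : ContinuousOn (fun s => A s (dysonTerm A t₀ y₀ k s)) I := hA.clm_apply hk
    exact intervalIntegral.integral_hasDerivAt_right
      ((hcont.mono (hc.uIcc_subset h0 ht)).intervalIntegrable)
      (hcont.stronglyMeasurableAtFilter hI t ht) (hcont.continuousAt (hI.mem_nhds ht))
  induction k with
  | zero => exact ⟨continuousOn_const, step 0 continuousOn_const⟩
  | succ k ih =>
    have : ContinuousOn (dysonTerm A t₀ y₀ (k + 1)) I := fun t ht =>
      (ih.2 t ht).continuousAt.continuousWithinAt
    exact ⟨this, step _ this⟩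

/-- Iterated integration produces the factor 1/k!. It makes the Dyson series converge on every
compact interval, whatever its length, so linear equations are solved without patching local
solutions. -/
lemma dysonTerm_norm_le {a b M : ℝ} (hM : ∀ t ∈ Icc a b, ‖A t‖ ≤ M) (h0 : t₀ ∈ Icc a b)
    (k : ℕ) : ∀ t ∈ Icc a b,
      ‖dysonTerm A t₀ y₀ k t‖ ≤ (M * |t - t₀|) ^ k / k.factorial * ‖y₀‖ := by
  have hM0 : 0 ≤ M := (norm_nonneg _).trans (hM t₀ h0)
  induction k with
  | zero => intro t _; simp [dysonTerm]
  | succ k ih =>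
    intro t ht
    rw [dysonTerm, intervalIntegral.norm_intervalIntegral_eq]
    calc
      _ ≤ ∫ s in uIoc t₀ t, M ^ (k + 1) * |s - t₀| ^ k / k.factorial * ‖y₀‖ := by
        apply MeasureTheory.norm_integral_le_of_norm_le (Continuous.integrableOn_uIoc (by fun_prop))
        refine (MeasureTheory.ae_restrict_mem measurableSet_Ioc).mono fun s hs => ?_
        have hs' : s ∈ Icc a b := uIcc_subset_Icc h0 ht (uIoc_subset_uIcc hs)
        calc _ ≤ M * ((M * |s - t₀|) ^ k / k.factorial * ‖y₀‖) :=
              (ContinuousLinearMap.le_opNorm _ _).trans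
                (mul_le_mul (hM s hs') (ih s hs') (norm_nonneg _) hM0)
          _ = _ := by rw [mul_pow]; ring
      _ = _ := by
        rw [MeasureTheory.integral_mul_const, MeasureTheory.integral_div,
          MeasureTheory.integral_const_mul, integral_pow_abs_sub_uIoc, Nat.factorial_succ]
        push_cast
        rw [mul_pow M |t - t₀|]
        field_simp

/-- Global solvability of linear equations. -/
lemma exists_linear_ode [CompleteSpace E] (hI : IsOpen I) (hc : I.OrdConnected)
    (hA : ContinuousOn A I) (h0 : t₀ ∈ I) (y₀ : E) :
    ∃ y : ℝ → E, y t₀ = y₀ ∧ ∀ t ∈ I, HasDerivAt y (A t (y t)) t := by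
  refine ⟨fun t => ∑' k, dysonTerm A t₀ y₀ k t, ?_, fun t ht => ?_⟩
  · show ∑' k, dysonTerm A t₀ y₀ k t₀ = y₀
    rw [tsum_eq_single 0]
    · rfl
    · intro k hk
      obtain ⟨j, rfl⟩ := Nat.exists_eq_succ_of_ne_zero hk
      simp [dysonTerm]
  -- `A` is bounded only on compact parts of `I`. The interval must contain both points in its
  -- interior: `t` for differentiating there, `t₀` because the bounds are centred at it.
  · obtain ⟨a, b, hab, hJ⟩ : ∃ a b, (t ∈ Ioo a b ∧ t₀ ∈ Ioo a b) ∧ Icc a b ⊆ I := by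
      obtain ⟨p, q, hpq, h1⟩ := mem_nhds_iff_exists_Ioo_subset.1 (hI.mem_nhds ht)
      obtain ⟨p', q', hpq', h2⟩ := mem_nhds_iff_exists_Ioo_subset.1 (hI.mem_nhds h0)
      have m1 : (p + t) / 2 ∈ I := h1 ⟨by linarith [hpq.1], by linarith [hpq.1, hpq.2]⟩
      have m2 : (q + t) / 2 ∈ I := h1 ⟨by linarith [hpq.1, hpq.2], by linarith [hpq.2]⟩
      have m3 : (p' + t₀) / 2 ∈ I := h2 ⟨by linarith [hpq'.1], by linarith [hpq'.1, hpq'.2]⟩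
      have m4 : (q' + t₀) / 2 ∈ I := h2 ⟨by linarith [hpq'.1, hpq'.2], by linarith [hpq'.2]⟩
      refine ⟨min ((p + t) / 2) ((p' + t₀) / 2), max ((q + t) / 2) ((q' + t₀) / 2),
        ⟨⟨?_, ?_⟩, ?_, ?_⟩, hc.out ?_ ?_⟩
      · exact (min_le_left _ _).trans_lt (by linarith [hpq.1])
      · exact lt_of_lt_of_le (by linarith [hpq.2]) (le_max_left _ _)
      · exact (min_le_right _ _).trans_lt (by linarith [hpq'.1])
      · exact lt_of_lt_of_le (by linarith [hpq'.2]) (le_max_right _ _)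
      · rcases min_choice ((p + t) / 2) ((p' + t₀) / 2) with h | h <;> rw [h] <;> assumption
      · rcases max_choice ((q + t) / 2) ((q' + t₀) / 2) with h | h <;> rw [h] <;> assumption
    obtain ⟨M, hM⟩ := isCompact_Icc.exists_bound_of_continuousOn (hA.mono hJ)
    have h0' : t₀ ∈ Icc a b := Ioo_subset_Icc_self hab.2
    have hM0 : 0 ≤ M := (norm_nonneg _).trans (hM t₀ h0')
    set u : ℕ → ℝ := fun k => (M * (b - a)) ^ k / k.factorial * ‖y₀‖ with hu
    have hus : Summable u := (Real.summable_pow_div_factorial _).mul_right _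
    have hgu : ∀ k, ∀ s ∈ Icc a b, ‖dysonTerm A t₀ y₀ k s‖ ≤ u k := by
      intro k s hs
      refine (dysonTerm_norm_le hM h0' k s hs).trans ?_
      have : |s - t₀| ≤ b - a := by
        rw [abs_le]; constructor <;> linarith [hs.1, hs.2, h0'.1, h0'.2]
      show _ ≤ (M * (b - a)) ^ k / k.factorial * ‖y₀‖
      gcongr
    have hsum : ∀ s ∈ Icc a b, Summable fun k => dysonTerm A t₀ y₀ k s := fun s hs =>
      Summable.of_norm_bounded hus fun k => hgu k s hs
    -- The derivative of term j + 1 is `A` applied to term j, so the differentiated series is `A` of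
    -- the original one, shifted by one index.
    let g' : ℕ → ℝ → E := fun k => Nat.casesOn k (fun _ => 0) fun j s => A s (dysonTerm A t₀ y₀ j s)
    let u' : ℕ → ℝ := fun k => Nat.casesOn k 0 fun j => M * u j
    have hu' : Summable u' := (summable_nat_add_iff 1).1 (hus.mul_left M)
    have key := hasDerivAt_tsum_of_isPreconnected (g := dysonTerm A t₀ y₀) (g' := g') hu'
      isOpen_Ioo isPreconnected_Ioo (y₀ := t) (y := t) (t := Ioo a b) ?_ ?_ hab.1
      (hsum t (Ioo_subset_Icc_self hab.1)) hab.1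
    · have e : ∑' k, g' k t = A t (∑' k, dysonTerm A t₀ y₀ k t) := by
        rw [(A t).map_tsum (hsum t (Ioo_subset_Icc_self hab.1)), Summable.tsum_eq_zero_add]
        · simp [g']
        · refine (summable_nat_add_iff 1).1 ?_
          exact (A t).summable (hsum t (Ioo_subset_Icc_self hab.1))
      rw [← e]
      exact key
    · intro k s hs
      cases k with
      | zero => exact hasDerivAt_const s y₀
      | succ j => exact (dysonTerm_hasDerivAt hI hc hA h0 j).2 s (hJ (Ioo_subset_Icc_self hs))
    · intro k s hs
      cases k with
      | zero => simp [g', u']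
      | succ j =>
        exact (ContinuousLinearMap.le_opNorm _ _).trans
          (mul_le_mul (hM s (Ioo_subset_Icc_self hs)) (hgu j s (Ioo_subset_Icc_self hs))
            (norm_nonneg _) hM0)

/-- Grönwall's inequality on both sides of `0`. -/
lemma norm_le_of_deriv_le {Δ Δ' : ℝ → E} {K ε R : ℝ} (hK : 1 ≤ K) (hε : 0 ≤ ε)
    (hΔ : ∀ x, HasDerivAt Δ (Δ' x) x) (hb : ∀ x ∈ Icc (-R) R, ‖Δ' x‖ ≤ K * ‖Δ x‖ + ε) :
    ∀ x ∈ Icc (-R) R, ‖Δ x‖ ≤ Real.exp (K * R) * (‖Δ 0‖ + ε) := by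
  have main : ∀ {Δ Δ' : ℝ → E}, (∀ x, HasDerivAt Δ (Δ' x) x) →
      (∀ x ∈ Icc (-R) R, ‖Δ' x‖ ≤ K * ‖Δ x‖ + ε) →
      ∀ x ∈ Icc 0 R, ‖Δ x‖ ≤ Real.exp (K * R) * (‖Δ 0‖ + ε) := by
    intro Δ Δ' hΔ hb x hx
    have := norm_le_gronwallBound_of_norm_deriv_right_le (f := Δ) (f' := Δ') (a := 0) (b := R)
      (K := K) (ε := ε) (δ := ‖Δ 0‖) (fun y _ => (hΔ y).continuousAt.continuousWithinAt)
      (fun y _ => (hΔ y).hasDerivWithinAt) le_rfl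
      (fun y hy => hb y ⟨by linarith [hy.1, hy.2], hy.2.le⟩) x hx
    refine this.trans ?_
    have hK0 : K ≠ 0 := by linarith
    have hexp : Real.exp (K * (x - 0)) ≤ Real.exp (K * R) := by
      apply Real.exp_le_exp.2
      rw [sub_zero]
      exact mul_le_mul_of_nonneg_left hx.2 (by linarith)
    have h1 : 1 ≤ Real.exp (K * (x - 0)) := by
      apply Real.one_le_exp
      rw [sub_zero]
      exact mul_nonneg (by linarith) hx.1
    rw [gronwallBound_of_K_ne_0 hK0]
    -- The assumption 1 ≤ K serves to absorb the factor 1/K of Grönwall's bound.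
    have h2 : ε / K ≤ ε := div_le_self hε hK
    have h3 : ε / K * (Real.exp (K * (x - 0)) - 1) ≤ ε * Real.exp (K * R) :=
      mul_le_mul h2 (by linarith) (by linarith) hε
    have h4 : ‖Δ 0‖ * Real.exp (K * (x - 0)) ≤ ‖Δ 0‖ * Real.exp (K * R) :=
      mul_le_mul_of_nonneg_left hexp (norm_nonneg _)
    linarith
  intro x hx
  rcases le_total 0 x with h | h
  · exact main hΔ hb x ⟨h, hx.2⟩
  · have hn : ∀ y, HasDerivAt (fun y => Δ (-y)) (-Δ' (-y)) y := fun y => by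
      have h := (hΔ (-y)).scomp y (hasDerivAt_neg y)
      rw [neg_one_smul] at h
      exact h
    have := main hn (fun y hy => by
      rw [norm_neg]
      exact hb (-y) ⟨by linarith [hy.2], by linarith [hy.1]⟩) (-x)
      ⟨by linarith, by linarith [hx.1]⟩
    simpa using this

/-- Uniform first and second order Taylor bounds in `t`. -/
lemma SmoothFam.exists_lipschitz {f : ℝ → ℝ → E} (hf : SmoothFam I f) (hI : IsOpen I) {t r : ℝ}
    (hr : 0 < r) (hJ : Icc (t - r) (t + r) ⊆ I) (R : ℝ) :
    ∃ C, 0 ≤ C ∧ ∀ s ∈ Icc (t - r) (t + r), ∀ x ∈ Icc (-R) R, ‖f s x - f t x‖ ≤ C * |s - t| := by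
  have hcont : ContinuousOn (fun p : ℝ × ℝ => deriv (fun τ => f τ p.2) p.1)
      (Icc (t - r) (t + r) ×ˢ Icc (-R) R) :=
    (ContDiffOn.continuousOn (hf.dt hI)).mono (prod_mono hJ (subset_univ _))
  obtain ⟨C, hC⟩ := (isCompact_Icc.prod isCompact_Icc).exists_bound_of_continuousOn hcont
  refine ⟨max C 0, le_max_right _ _, fun s hs x hx => ?_⟩
  have := (convex_Icc (t - r) (t + r)).norm_image_sub_le_of_norm_hasDerivWithin_le
    (f := fun τ => f τ x) (C := max C 0)
    (fun τ hτ => (hf.hasDerivAt_t hI (hJ hτ) x).hasDerivWithinAt)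
    (fun τ hτ => (hC (τ, x) ⟨hτ, hx⟩).trans (le_max_left _ _))
    (⟨by linarith, by linarith⟩ : t ∈ Icc (t - r) (t + r)) hs
  simpa using this

lemma SmoothFam.exists_taylor {f : ℝ → ℝ → E} (hf : SmoothFam I f) (hI : IsOpen I) {t r : ℝ}
    (hr : 0 < r) (hJ : Icc (t - r) (t + r) ⊆ I) (R : ℝ) :
    ∃ C, 0 ≤ C ∧ ∀ s ∈ Icc (t - r) (t + r), ∀ x ∈ Icc (-R) R,
      ‖f s x - f t x - (s - t) • deriv (fun τ => f τ x) t‖ ≤ C * (s - t) ^ 2 := by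
  obtain ⟨C, hC0, hC⟩ := (hf.dt hI).exists_lipschitz hI hr hJ R
  have htm : t ∈ Icc (t - r) (t + r) := ⟨by linarith, by linarith⟩
  refine ⟨C, hC0, fun s hs x hx => ?_⟩
  set v := deriv (fun τ => f τ x) t with hv
  have hsub : uIcc t s ⊆ Icc (t - r) (t + r) := uIcc_subset_Icc htm hs
  have hd : ∀ τ ∈ uIcc t s, HasDerivWithinAt (fun τ => f τ x - (τ - t) • v)
      (deriv (fun τ => f τ x) τ - v) (uIcc t s) τ := by
    intro τ hτ
    have h1 : HasDerivAt (fun τ : ℝ => (τ - t) • v) v τ := by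
      simpa using ((hasDerivAt_id τ).sub_const t).smul_const v
    exact ((hf.hasDerivAt_t hI (hJ (hsub hτ)) x).sub h1).hasDerivWithinAt
  have := (convex_uIcc t s).norm_image_sub_le_of_norm_hasDerivWithin_le (C := C * |s - t|) hd
    (fun τ hτ => (hC τ (hsub hτ) x hx).trans
      (mul_le_mul_of_nonneg_left (abs_sub_left_of_mem_uIcc hτ) hC0)) left_mem_uIcc right_mem_uIcc
  have e : f s x - (s - t) • v - (f t x - (t - t) • v) = f s x - f t x - (s - t) • v := by
    simp; abel
  rw [e, Real.norm_eq_abs, mul_assoc, abs_mul_abs_self, ← sq] at this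
  exact this

/-- A family with total derivative depending smoothly and linearly on it is smooth. -/
lemma contDiffOn_of_linear_fderiv {W : Type*} [NormedAddCommGroup W] [NormedSpace ℝ W] {U : Set W}
    (hU : IsOpen U) {y : W → E} {L : W → E →L[ℝ] W →L[ℝ] E} (hL : ContDiffOn ℝ ∞ L U)
    (hy : ∀ p ∈ U, HasFDerivAt y (L p (y p)) p) : ContDiffOn ℝ ∞ y U := by
  rw [contDiffOn_infty]
  intro n
  -- Bootstrapping: if `y` is Cⁿ, its derivative `L p (y p)` is Cⁿ, hence `y` is Cⁿ⁺¹.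
  induction n with
  | zero =>
    rw [Nat.cast_zero, contDiffOn_zero]
    exact fun p hp => (hy p hp).continuousAt.continuousWithinAt
  | succ n ih =>
    rw [Nat.cast_succ, contDiffOn_succ_iff_fderiv_of_isOpen hU]
    refine ⟨fun p hp => (hy p hp).differentiableAt.differentiableWithinAt, by simp, ?_⟩
    refine ((hL.of_le (by exact_mod_cast le_top)).clm_apply ih).congr fun p hp => (hy p hp).fderiv

/-- **Frobenius.** A flat linear system `y_x = A y`, `y_t = B y` on `I × ℝ` is solvable. -/
theorem exists_flat_section [CompleteSpace E] {A B : ℝ → ℝ → E →L[ℝ] E} (hI : IsOpen I)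
    (hc : I.OrdConnected) (hA : SmoothFam I A) (hB : SmoothFam I B)
    (flat : ∀ t ∈ I, ∀ x, deriv (fun τ => A τ x) t - deriv (B t) x
      = (B t x).comp (A t x) - (A t x).comp (B t x))
    {t₀ : ℝ} (h0 : t₀ ∈ I) (y₀ : E) :
    ∃ y : ℝ → ℝ → E, SmoothFam I y ∧ y t₀ 0 = y₀ ∧ ∀ t ∈ I, ∀ x,
      HasDerivAt (y t) (A t x (y t x)) x ∧ HasDerivAt (fun τ => y τ x) (B t x (y t x)) t := by
  -- The candidate is built by integrating in t along x = 0 and then in x at each fixed t. Off the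
  -- line x = 0 nothing is known yet about its dependence on t, not even continuity.
  have hB0 : ContinuousOn (fun t => B t 0) I :=
    (ContDiffOn.continuousOn hB).comp (continuous_id.prodMk continuous_const).continuousOn
      (fun t ht => ⟨ht, mem_univ _⟩)
  obtain ⟨e, he0, he⟩ := exists_linear_ode hI hc hB0 h0 y₀
  have hex : ∀ t, ∃ z : ℝ → E, z 0 = e t ∧ (t ∈ I → ∀ x, HasDerivAt z (A t x (z x)) x) := by
    intro t
    by_cases ht : t ∈ I
    · obtain ⟨z, h1, h2⟩ := exists_linear_ode isOpen_univ ordConnected_univ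
        (hA.contDiff_x hI ht).continuous.continuousOn (mem_univ 0) (e t)
      exact ⟨z, h1, fun _ x => h2 x (mem_univ x)⟩
    · exact ⟨fun _ => e t, rfl, fun h => absurd h ht⟩
  choose y hy0 hyx using hex
  have hyx' : ∀ t ∈ I, ∀ x, HasDerivAt (y t) (A t x (y t x)) x := fun t ht => hyx t ht
  have hyc : ∀ t ∈ I, Continuous (y t) := fun t ht =>
    continuous_iff_continuousAt.2 fun x => (hyx' t ht x).continuousAt
  -- first order expansion in `t`, uniform in `x`
  have est : ∀ t ∈ I, ∀ R : ℝ, ∃ C : ℝ, ∃ r > 0, ∀ s ∈ Icc (t - r) (t + r), ∀ x ∈ Icc (-R) R,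
      ‖y s x - y t x - (s - t) • B t x (y t x)‖
        ≤ C * (‖e s - e t - (s - t) • B t 0 (e t)‖ + (s - t) ^ 2) := by
    intro t ht R
    obtain ⟨r, hr, hJ⟩ := Metric.nhds_basis_closedBall.mem_iff.1 (hI.mem_nhds ht)
    rw [Real.closedBall_eq_Icc] at hJ
    obtain ⟨C1, hC1, h1⟩ := hA.exists_taylor hI hr hJ R
    obtain ⟨C2, hC2, h2⟩ := hA.exists_lipschitz hI hr hJ R
    obtain ⟨K, hK⟩ := (isCompact_Icc.prod isCompact_Icc).exists_bound_of_continuousOn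
      ((ContDiffOn.continuousOn hA).mono (prod_mono hJ (subset_univ (Icc (-R) R))))
    have hBy : Continuous fun x => B t x (y t x) :=
      (hB.contDiff_x hI ht).continuous.clm_apply (hyc t ht)
    obtain ⟨Y, hY⟩ := (isCompact_Icc (a := -R) (b := R)).exists_bound_of_continuousOn
      (hyc t ht).continuousOn
    obtain ⟨Z, hZ⟩ := (isCompact_Icc (a := -R) (b := R)).exists_bound_of_continuousOn
      hBy.continuousOn
    set D := C1 * max Y 0 + C2 * max Z 0 with hD
    have hD0 : 0 ≤ D := by positivity
    refine ⟨Real.exp (max K 1 * R) * max 1 D, r, hr, fun s hs x hx => ?_⟩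
    -- The error of the first-order expansion that the t-equation predicts. It is controlled at x =
    -- 0 by the choice of `e`, and propagates in x by Grönwall.
    set Δ : ℝ → E := fun x => y s x - y t x - (s - t) • B t x (y t x) with hΔ
    have hder : ∀ x, HasDerivAt Δ (A s x (y s x) - A t x (y t x)
        - (s - t) • (deriv (B t) x (y t x) + B t x (A t x (y t x)))) x := fun x =>
      ((hyx' s (hJ hs) x).sub (hyx' t ht x)).sub
        (((hB.hasDerivAt_x hI ht x).clm_apply (hyx' t ht x)).const_smul (s - t))
    have hΔ0 : Δ 0 = e s - e t - (s - t) • B t 0 (e t) := by rw [hΔ]; simp only [hy0]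
    have hst : 0 ≤ (s - t) ^ 2 := sq_nonneg _
    have := norm_le_of_deriv_le (K := max K 1) (ε := D * (s - t) ^ 2) (R := R) (le_max_right _ _)
      (by positivity) hder (fun x hx => ?_) x hx
    · rw [hΔ0] at this
      refine this.trans ?_
      rw [mul_assoc]
      refine mul_le_mul_of_nonneg_left ?_ (Real.exp_pos _).le
      rw [mul_add]
      refine add_le_add ?_ (mul_le_mul_of_nonneg_right (le_max_right _ _) hst)
      exact le_mul_of_one_le_left (norm_nonneg _) (le_max_left _ _)
    · have hf := congrArg (fun L : E →L[ℝ] E => L (y t x)) (flat t ht x)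
      simp only [_root_.sub_apply, ContinuousLinearMap.comp_apply] at hf
      have e1 : A s x (y s x) - A t x (y t x)
          - (s - t) • (deriv (B t) x (y t x) + B t x (A t x (y t x)))
          = A s x (Δ x) + (A s x - A t x - (s - t) • deriv (fun τ => A τ x) t) (y t x)
            + (s - t) • (A s x - A t x) (B t x (y t x)) := by
        -- Flatness enters here: it replaces B_x + BA by A_t + AB. The inhomogeneous terms in Δ_x
        -- are then a Taylor remainder of A and a product of two increments, both of order (s - t)².
        have : deriv (B t) x (y t x) + B t x (A t x (y t x))
            = deriv (fun τ => A τ x) t (y t x) + A t x (B t x (y t x)) := by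
          rw [sub_eq_sub_iff_add_eq_add] at hf
          rw [hf]; abel
        rw [this, hΔ]
        simp only [_root_.sub_apply, _root_.smul_apply, map_sub,
          map_smul, smul_add, smul_sub]
        abel
      rw [e1]
      have n1 : ‖A s x (Δ x)‖ ≤ max K 1 * ‖Δ x‖ :=
        ((A s x).le_opNorm _).trans (mul_le_mul_of_nonneg_right
          ((hK (s, x) ⟨hs, hx⟩).trans (le_max_left _ _)) (norm_nonneg _))
      have n2 : ‖(A s x - A t x - (s - t) • deriv (fun τ => A τ x) t) (y t x)‖
          ≤ C1 * (s - t) ^ 2 * max Y 0 :=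
        (ContinuousLinearMap.le_opNorm _ _).trans (mul_le_mul (h1 s hs x hx)
          ((hY x hx).trans (le_max_left _ _)) (norm_nonneg _) (by positivity))
      have n3 : ‖(s - t) • (A s x - A t x) (B t x (y t x))‖
          ≤ |s - t| * (C2 * |s - t| * max Z 0) := by
        rw [norm_smul, Real.norm_eq_abs]
        refine mul_le_mul_of_nonneg_left ?_ (abs_nonneg _)
        exact (ContinuousLinearMap.le_opNorm _ _).trans (mul_le_mul (h2 s hs x hx)
          ((hZ x hx).trans (le_max_left _ _)) (norm_nonneg _) (by positivity))
      have n4 : |s - t| * (C2 * |s - t| * max Z 0) = C2 * max Z 0 * (s - t) ^ 2 := by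
        rw [← sq_abs (s - t)]; ring
      refine (norm_add₃_le).trans ?_
      rw [hD]
      linarith
  -- The increment from (t, x) splits into the uniform t-expansion at the moved x (`o1`), the
  -- variation of its coefficient with x (`o2`), and the x-expansion at fixed t (`o3`).
  have hpart : ∀ t ∈ I, ∀ x, HasFDerivAt (fun p : ℝ × ℝ => y p.1 p.2)
      ((ContinuousLinearMap.fst ℝ ℝ ℝ).smulRight (B t x (y t x))
        + (ContinuousLinearMap.snd ℝ ℝ ℝ).smulRight (A t x (y t x))) (t, x) := by
    intro t ht x
    obtain ⟨C, r, hr, hC⟩ := est t ht (|x| + 1)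
    rw [hasFDerivAt_iff_isLittleO]
    have hfst : (fun p : ℝ × ℝ => p.1 - t) =O[𝓝 (t, x)] fun p => p - (t, x) :=
      Asymptotics.isBigO_of_le _ fun p => norm_fst_le (p - (t, x))
    have hsnd : (fun p : ℝ × ℝ => p.2 - x) =O[𝓝 (t, x)] fun p => p - (t, x) :=
      Asymptotics.isBigO_of_le _ fun p => norm_snd_le (p - (t, x))
    have tfst : Tendsto (fun p : ℝ × ℝ => p.1) (𝓝 (t, x)) (𝓝 t) := continuous_fst.tendsto _
    have tsnd : Tendsto (fun p : ℝ × ℝ => p.2) (𝓝 (t, x)) (𝓝 x) := continuous_snd.tendsto _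
    have o1 : (fun p : ℝ × ℝ => y p.1 p.2 - y t p.2 - (p.1 - t) • B t p.2 (y t p.2))
        =o[𝓝 (t, x)] fun p => p - (t, x) := by
      have hb : (fun p : ℝ × ℝ => y p.1 p.2 - y t p.2 - (p.1 - t) • B t p.2 (y t p.2))
          =O[𝓝 (t, x)] fun p => ‖e p.1 - e t - (p.1 - t) • B t 0 (e t)‖ + (p.1 - t) ^ 2 := by
        refine Asymptotics.IsBigO.of_bound C ?_
        have m1 : ∀ᶠ p : ℝ × ℝ in 𝓝 (t, x), p.1 ∈ Icc (t - r) (t + r) :=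
          tfst (Icc_mem_nhds (by linarith) (by linarith))
        have m2 : ∀ᶠ p : ℝ × ℝ in 𝓝 (t, x), p.2 ∈ Icc (-(|x| + 1)) (|x| + 1) :=
          tsnd (Icc_mem_nhds (by linarith [neg_abs_le x]) (by linarith [le_abs_self x]))
        filter_upwards [m1, m2] with p h1 h2
        refine (hC p.1 h1 p.2 h2).trans_eq ?_
        rw [Real.norm_of_nonneg (by positivity)]
      have ho : (fun s => ‖e s - e t - (s - t) • B t 0 (e t)‖ + (s - t) ^ 2)
          =o[𝓝 t] fun s => s - t := by
        refine ((hasDerivAt_iff_isLittleO.1 (he t ht)).norm_left).add ?_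
        have : Tendsto (fun s : ℝ => s - t) (𝓝 t) (𝓝 0) := by
          simpa using (continuous_id.sub continuous_const).tendsto (f := fun s : ℝ => s - t) t
        simpa using! (Asymptotics.isLittleO_pow_id (one_lt_two)).comp_tendsto this
      exact (hb.trans_isLittleO (ho.comp_tendsto tfst)).trans_isBigO hfst
    have o2 : (fun p : ℝ × ℝ => (p.1 - t) • (B t p.2 (y t p.2) - B t x (y t x)))
        =o[𝓝 (t, x)] fun p => p - (t, x) := by
      have hBy : Continuous fun x => B t x (y t x) :=
        (hB.contDiff_x hI ht).continuous.clm_apply (hyc t ht)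
      have h1 : (fun p : ℝ × ℝ => B t p.2 (y t p.2) - B t x (y t x)) =o[𝓝 (t, x)]
          fun _ => (1 : ℝ) := by
        rw [Asymptotics.isLittleO_one_iff]
        have := ((hBy.tendsto x).comp tsnd).sub_const (B t x (y t x))
        rwa [sub_self] at this
      have := (Asymptotics.isBigO_refl (fun p : ℝ × ℝ => p.1 - t) (𝓝 (t, x))).smul_isLittleO h1
      exact (this.congr_right (g₂ := fun p : ℝ × ℝ => p.1 - t) (by simp)).trans_isBigO hfst
    have o3 : (fun p : ℝ × ℝ => y t p.2 - y t x - (p.2 - x) • A t x (y t x))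
        =o[𝓝 (t, x)] fun p => p - (t, x) :=
      ((hasDerivAt_iff_isLittleO.1 (hyx' t ht x)).comp_tendsto tsnd).trans_isBigO hsnd
    refine ((o1.add o2).add o3).congr_left fun p => ?_
    simp only [_root_.add_apply, ContinuousLinearMap.smulRight_apply,
      ContinuousLinearMap.coe_fst', ContinuousLinearMap.coe_snd', Prod.fst_sub, Prod.snd_sub,
      smul_sub]
    abel
  have hU : IsOpen (I ×ˢ (univ : Set ℝ)) := hI.prod isOpen_univ
  refine ⟨y, ?_, by rw [hy0, he0], fun t ht x => ⟨hyx' t ht x, ?_⟩⟩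
  · let S₁ : E →L[ℝ] (ℝ × ℝ →L[ℝ] E) :=
      ContinuousLinearMap.smulRightL ℝ (ℝ × ℝ) E (ContinuousLinearMap.fst ℝ ℝ ℝ)
    let S₂ : E →L[ℝ] (ℝ × ℝ →L[ℝ] E) :=
      ContinuousLinearMap.smulRightL ℝ (ℝ × ℝ) E (ContinuousLinearMap.snd ℝ ℝ ℝ)
    refine contDiffOn_of_linear_fderiv (L := fun p => S₁.comp (B p.1 p.2) + S₂.comp (A p.1 p.2)) hU
      ?_ (fun p hp => hpart p.1 hp.1 p.2)
    exact (contDiffOn_const.clm_comp hB).add (contDiffOn_const.clm_comp hA)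
  · have h1 : HasDerivAt (fun y : ℝ => ((y, x) : ℝ × ℝ)) (1, 0) t :=
      (hasDerivAt_id t).prodMk (hasDerivAt_const t x)
    have := (hpart t ht x).comp_hasDerivAt t h1
    simpa using! this

end Flat

/-! ### Vector algebra in Euclidean space -/

section Vectors

@[simp] lemma cross_zero_apply (a b : E3) : cross a b 0 = a 1 * b 2 - a 2 * b 1 := rfl
@[simp] lemma cross_one_apply (a b : E3) : cross a b 1 = a 2 * b 0 - a 0 * b 2 := rfl
@[simp] lemma cross_two_apply (a b : E3) : cross a b 2 = a 0 * b 1 - a 1 * b 0 := rfl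

lemma inner_E3 (a b : E3) : inner ℝ a b = a 0 * b 0 + a 1 * b 1 + a 2 * b 2 := by
  simp [PiLp.inner_apply, Fin.sum_univ_three]; ring

lemma E3_ext {a b : E3} (h0 : a 0 = b 0) (h1 : a 1 = b 1) (h2 : a 2 = b 2) : a = b := by
  ext i; fin_cases i <;> assumption

lemma inner_self_of_norm {a : E3} (h : ‖a‖ = 1) : inner ℝ a a = (1 : ℝ) := by
  rw [real_inner_self_eq_norm_sq, h, one_pow]

lemma norm_of_inner_self {a : E3} (h : inner ℝ a a = (1 : ℝ)) : ‖a‖ = 1 := by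
  rw [real_inner_self_eq_norm_sq] at h
  exact (pow_eq_one_iff_of_nonneg (norm_nonneg a) two_ne_zero).1 h

lemma cross_self' (a : E3) : cross a a = 0 := by
  apply E3_ext <;> simp <;> ring

lemma cross_swap (a b : E3) : cross a b = -cross b a := by
  apply E3_ext <;> simp <;> ring

lemma inner_cross_left (a b : E3) : inner ℝ a (cross a b) = 0 := by
  simp only [inner_E3, cross_zero_apply, cross_one_apply, cross_two_apply]; ring

lemma inner_cross_right (a b : E3) : inner ℝ b (cross a b) = 0 := by
  simp only [inner_E3, cross_zero_apply, cross_one_apply, cross_two_apply]; ring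

lemma cross_cross_left (a b c : E3) :
    cross (cross a b) c = (inner ℝ a c : ℝ) • b - (inner ℝ b c : ℝ) • a := by
  apply E3_ext <;> simp [inner_E3] <;> ring

lemma cross_cross_right (a b c : E3) :
    cross a (cross b c) = (inner ℝ a c : ℝ) • b - (inner ℝ a b : ℝ) • c := by
  apply E3_ext <;> simp [inner_E3] <;> ring

lemma inner_cross_cross (a b c d : E3) : inner ℝ (cross a b) (cross c d)
    = (inner ℝ a c : ℝ) * inner ℝ b d - (inner ℝ a d : ℝ) * inner ℝ b c := by
  simp only [inner_E3, cross_zero_apply, cross_one_apply, cross_two_apply]; ring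

/-- The cross product as a continuous bilinear map. -/
noncomputable def crossL : E3 →L[ℝ] E3 →L[ℝ] E3 :=
  LinearMap.toContinuousLinearMap
    { toFun := fun a => LinearMap.toContinuousLinearMap
        { toFun := fun b => cross a b
          map_add' := fun x y => by apply E3_ext <;> simp <;> ring
          map_smul' := fun r x => by apply E3_ext <;> simp <;> ring }
      map_add' := fun x y => by ext1 b; apply E3_ext <;> simp <;> ring
      map_smul' := fun r x => by ext1 b; apply E3_ext <;> simp <;> ring }

@[simp] lemma crossL_apply (a b : E3) : crossL a b = cross a b := rfl

lemma cross_add_left (a b c : E3) : cross (a + b) c = cross a c + cross b c := by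
  simp [← crossL_apply]
lemma cross_add_right (a b c : E3) : cross a (b + c) = cross a b + cross a c := by
  simp [← crossL_apply]
lemma cross_smul_left (r : ℝ) (a b : E3) : cross (r • a) b = r • cross a b := by
  simp [← crossL_apply]
lemma cross_smul_right (r : ℝ) (a b : E3) : cross a (r • b) = r • cross a b := by
  simp [← crossL_apply]
lemma cross_sub_right (a b c : E3) : cross a (b - c) = cross a b - cross a c := by
  simp [← crossL_apply]
@[simp] lemma cross_zero_right (a : E3) : cross a 0 = 0 := by simp [← crossL_apply]
@[simp] lemma cross_zero_left (a : E3) : cross 0 a = 0 := by simp [← crossL_apply]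

lemma hasDerivAt_cross {a b : ℝ → E3} {a' b' : E3} {x : ℝ} (ha : HasDerivAt a a' x)
    (hb : HasDerivAt b b' x) :
    HasDerivAt (fun y => cross (a y) (b y)) (cross a' (b x) + cross (a x) b') x := by
  have := (crossL.hasFDerivAt.comp_hasDerivAt x ha).clm_apply hb
  simpa using! this

lemma contDiff_cross {W : Type*} [NormedAddCommGroup W] [NormedSpace ℝ W] {a b : W → E3}
    (ha : ContDiff ℝ ∞ a) (hb : ContDiff ℝ ∞ b) : ContDiff ℝ ∞ (fun y => cross (a y) (b y)) :=
  (crossL.contDiff.comp ha).clm_apply hb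

lemma SmoothFam.cross {I : Set ℝ} {a b : ℝ → ℝ → E3} (ha : SmoothFam I a) (hb : SmoothFam I b) :
    SmoothFam I (fun t x => cross (a t x) (b t x)) :=
  ContDiffOn.clm_apply (crossL.contDiff.comp_contDiffOn ha) hb

/-- The coordinates as continuous linear maps. -/
noncomputable def coordL (i : Fin 3) : E3 →L[ℝ] ℝ := EuclideanSpace.proj i

@[simp] lemma coordL_apply (i : Fin 3) (a : E3) : coordL i a = a i := rfl

lemma hasDerivAt_coord {f : ℝ → E3} {f' : E3} {x : ℝ} (h : HasDerivAt f f' x) (i : Fin 3) :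
    HasDerivAt (fun y => f y i) (f' i) x :=
  (coordL i).hasFDerivAt.comp_hasDerivAt x h

lemma contDiffOn_E3 {W : Type*} [NormedAddCommGroup W] [NormedSpace ℝ W] {s : Set W} {f : W → E3} :
    ContDiffOn ℝ ∞ f s ↔ ∀ i, ContDiffOn ℝ ∞ (fun y => f y i) s :=
  contDiffOn_euclidean

lemma hasDerivAt_E3 {f : ℝ → E3} {f' : E3} {x : ℝ}
    (h : ∀ i, HasDerivAt (fun y => f y i) (f' i) x) : HasDerivAt f f' x := by
  have := (PiLp.continuousLinearEquiv 2 ℝ (fun _ : Fin 3 => ℝ)).symm.toContinuousLinearMap.hasFDerivAt.comp_hasDerivAt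
    x (hasDerivAt_pi.2 h)
  exact this

end Vectors

/-! ### Power series of vectors -/

section Series

open PowerSeries

/-- Coefficientwise derivative of a power series depending on a real variable. -/
def HasCoeffDerivAt (F : ℝ → ℝ⟦X⟧) (F' : ℝ⟦X⟧) (x : ℝ) : Prop :=
  ∀ n, HasDerivAt (fun y => coeff n (F y)) (coeff n F') x

lemma HasCoeffDerivAt.mul {F G : ℝ → ℝ⟦X⟧} {F' G' : ℝ⟦X⟧} {x : ℝ} (hF : HasCoeffDerivAt F F' x)
    (hG : HasCoeffDerivAt G G' x) :
    HasCoeffDerivAt (fun y => F y * G y) (F' * G x + F x * G') x := by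
  intro n
  simp only [coeff_mul, map_add, ← Finset.sum_add_distrib]
  exact HasDerivAt.fun_sum fun p _ => (hF p.1).mul (hG p.2)

lemma HasCoeffDerivAt.add {F G : ℝ → ℝ⟦X⟧} {F' G' : ℝ⟦X⟧} {x : ℝ} (hF : HasCoeffDerivAt F F' x)
    (hG : HasCoeffDerivAt G G' x) : HasCoeffDerivAt (fun y => F y + G y) (F' + G') x :=
  fun n => by simpa using! (hF n).fun_add (hG n)

lemma HasCoeffDerivAt.sub {F G : ℝ → ℝ⟦X⟧} {F' G' : ℝ⟦X⟧} {x : ℝ} (hF : HasCoeffDerivAt F F' x)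
    (hG : HasCoeffDerivAt G G' x) : HasCoeffDerivAt (fun y => F y - G y) (F' - G') x :=
  fun n => by simpa using! (hF n).fun_sub (hG n)

lemma HasCoeffDerivAt.unique {F : ℝ → ℝ⟦X⟧} {F' F'' : ℝ⟦X⟧} {x : ℝ} (h : HasCoeffDerivAt F F' x)
    (h' : HasCoeffDerivAt F F'' x) : F' = F'' := by
  ext n; exact (h n).unique (h' n)

/-- The generating series of a sequence of vectors. -/
noncomputable def vecSeries (v : ℕ → E3) : Fin 3 → ℝ⟦X⟧ := fun i => PowerSeries.mk fun n => v n i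

@[simp] lemma coeff_vecSeries (v : ℕ → E3) (i : Fin 3) (n : ℕ) : coeff n (vecSeries v i) = v n i :=
  coeff_mk _ _

lemma hasCoeffDerivAt_vecSeries {v : ℕ → ℝ → E3} {v' : ℕ → E3} {x : ℝ}
    (h : ∀ n, HasDerivAt (v n) (v' n) x) (i : Fin 3) :
    HasCoeffDerivAt (fun y => vecSeries (fun n => v n y) i) (vecSeries v' i) x := fun n => by
  simpa using hasDerivAt_coord (h n) i

/-- Dot product of two triples. -/
def dot3 {R : Type*} [CommRing R] (a b : Fin 3 → R) : R := a 0 * b 0 + a 1 * b 1 + a 2 * b 2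

lemma coeff_dot3 (v w : ℕ → E3) (n : ℕ) : coeff n (dot3 (vecSeries v) (vecSeries w))
    = ∑ k ∈ Finset.range (n + 1), (inner ℝ (v k) (w (n - k)) : ℝ) := by
  simp only [dot3, map_add, coeff_mul, coeff_vecSeries, inner_E3, Finset.sum_add_distrib]
  simp only [Finset.Nat.sum_antidiagonal_eq_sum_range_succ_mk]

lemma coeff_cross (v w : ℕ → E3) (n : ℕ) (i : Fin 3) :
    coeff n (crossProduct (vecSeries v) (vecSeries w) i)
    = ∑ k ∈ Finset.range (n + 1), cross (v k) (w (n - k)) i := by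
  fin_cases i <;>
  simp [cross_apply, coeff_mul, coeff_vecSeries,
    Finset.Nat.sum_antidiagonal_eq_sum_range_succ_mk, Finset.sum_sub_distrib]

end Series

/-! ### Differential polynomials in `S` -/

section SpinPoly

lemma spin_jet_contDiff (S : SpinCurve) (k : ℕ) : ContDiff ℝ ∞ (iteratedDeriv k S.val) := by
  induction k with
  | zero => simpa using! S.2.1
  | succ k ih =>
    rw [iteratedDeriv_succ]
    exact ContDiff.iterate_deriv 1 ih

lemma spin_gen_contDiff : ∀ g ∈ {F : SpinCurve → ℝ → ℝ | ∃ (k : ℕ) (i : Fin 3),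
    F = fun S x => (iteratedDeriv k S.val x : E3) i}, ∀ S, ContDiff ℝ ∞ (g S) := by
  rintro _ ⟨k, i, rfl⟩ S
  exact (coordL i).contDiff.comp (spin_jet_contDiff S k)

lemma spinPoly_Dx {G : SpinCurve → ℝ → ℝ} (hG : G ∈ spinPoly) : Dx G ∈ spinPoly := by
  refine adjoin_Dx_mem spin_gen_contDiff ?_ hG
  rintro _ ⟨k, i, rfl⟩
  refine Algebra.subset_adjoin ⟨k + 1, i, ?_⟩
  funext S x
  rw [iteratedDeriv_succ]
  exact (hasDerivAt_coord ((spin_jet_contDiff S k).differentiable (by simp) x).hasDerivAt i).deriv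

/-- A smooth map that is the identity near `x` and constantly `x` far away. -/
lemma exists_smooth_retraction (x : ℝ) : ∃ φ : ℝ → ℝ, ContDiff ℝ ∞ φ ∧
    (φ =ᶠ[𝓝 x] id) ∧ ∃ y, φ =ᶠ[𝓝 y] fun _ => x := by
  let b : ContDiffBump x := ⟨1, 2, one_pos, one_lt_two⟩
  refine ⟨fun y => x + b y * (y - x), ?_, ?_, x + 3, ?_⟩
  · exact contDiff_const.add (b.contDiff.mul (contDiff_id.sub contDiff_const))
  · filter_upwards [b.eventuallyEq_one] with y hy
    simp [hy]
  · have h : ∀ᶠ y in 𝓝 (x + 3), x + 2 < y := lt_mem_nhds (by linarith)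
    filter_upwards [h] with y hy
    have hz : b y = 0 := by
      apply b.zero_of_le_dist
      rw [Real.dist_eq]
      exact le_trans (by show (2 : ℝ) ≤ y - x; linarith) (le_abs_self _)
    simp [hz]

/-- The constant curve. -/
def SpinCurve.const (a : E3) (ha : ‖a‖ = 1) : SpinCurve := ⟨fun _ => a, contDiff_const, fun _ => ha⟩

/-- The curve is reparametrised rather than cut off: S ∘ φ stays on the sphere, agrees with S near
x, and is constant near another point. -/
lemma isDiffRing_spin : IsDiffRing spinPoly spinConst := by
  refine isDiffRing_adjoin spin_gen_contDiff fun S x => ?_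
  obtain ⟨φ, hφ, h1, y, h2⟩ := exists_smooth_retraction x
  refine ⟨⟨S.val ∘ φ, S.2.1.comp hφ, fun z => S.2.2 _⟩, ?_,
    SpinCurve.const (S.val x) (S.2.2 x), fun _ _ => rfl, y, ?_⟩
  · rintro _ ⟨k, i, rfl⟩
    have : S.val ∘ φ =ᶠ[𝓝 x] S.val := by
      filter_upwards [h1] with z hz
      simp [hz]
    exact congrArg (coordL i) (this.iteratedDeriv_eq k)
  · rintro _ ⟨k, i, rfl⟩
    have : S.val ∘ φ =ᶠ[𝓝 y] fun _ => S.val x := by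
      filter_upwards [h2] with z hz
      simp [hz]
    exact congrArg (coordL i) (this.iteratedDeriv_eq k)

/-- Vector fields along `S` whose components are differential polynomials. -/
def IsPolyVec (F : SpinCurve → ℝ → E3) : Prop := ∀ i : Fin 3, (fun S x => F S x i) ∈ spinPoly

variable {F G : SpinCurve → ℝ → E3}

lemma isPolyVec_jet (k : ℕ) : IsPolyVec fun S x => iteratedDeriv k S.val x :=
  fun i => Algebra.subset_adjoin ⟨k, i, rfl⟩

lemma isPolyVec_val : IsPolyVec fun S x => S.val x := by
  simpa using! isPolyVec_jet 0

lemma IsPolyVec.contDiff (hF : IsPolyVec F) (S : SpinCurve) : ContDiff ℝ ∞ (F S) :=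
  contDiff_euclidean.2 fun i => isDiffRing_spin.contDiff _ (hF i) S

lemma IsPolyVec.hasDerivAt (hF : IsPolyVec F) (S : SpinCurve) (x : ℝ) :
    HasDerivAt (F S) (deriv (F S) x) x :=
  ((hF.contDiff S).differentiable (by simp) x).hasDerivAt

lemma IsPolyVec.deriv (hF : IsPolyVec F) : IsPolyVec fun S x => deriv (F S) x := by
  intro i
  have : (fun (S : SpinCurve) x => (_root_.deriv (F S) x) i) = Dx fun S x => F S x i := by
    funext S x
    exact (hasDerivAt_coord (hF.hasDerivAt S x) i).deriv.symm
  rw [this]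
  exact spinPoly_Dx (hF i)

lemma IsPolyVec.inner (hF : IsPolyVec F) (hG : IsPolyVec G) :
    (fun S x => (inner ℝ (F S x) (G S x) : ℝ)) ∈ spinPoly := by
  simp only [inner_E3]
  exact add_mem (add_mem (mul_mem (hF 0) (hG 0)) (mul_mem (hF 1) (hG 1))) (mul_mem (hF 2) (hG 2))

lemma IsPolyVec.cross (hF : IsPolyVec F) (hG : IsPolyVec G) :
    IsPolyVec fun S x => cross (F S x) (G S x) := by
  intro i
  fin_cases i
  · exact sub_mem (mul_mem (hF 1) (hG 2)) (mul_mem (hF 2) (hG 1))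
  · exact sub_mem (mul_mem (hF 2) (hG 0)) (mul_mem (hF 0) (hG 2))
  · exact sub_mem (mul_mem (hF 0) (hG 1)) (mul_mem (hF 1) (hG 0))

lemma IsPolyVec.add (hF : IsPolyVec F) (hG : IsPolyVec G) : IsPolyVec fun S x => F S x + G S x :=
  fun i => add_mem (hF i) (hG i)

lemma IsPolyVec.smul {a : SpinCurve → ℝ → ℝ} (ha : a ∈ spinPoly) (hF : IsPolyVec F) :
    IsPolyVec fun S x => a S x • F S x :=
  fun i => mul_mem ha (hF i)

lemma spinPoly_sum {ι : Type*} (s : Finset ι) {a : ι → SpinCurve → ℝ → ℝ}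
    (h : ∀ j ∈ s, a j ∈ spinPoly) : (fun S x => ∑ j ∈ s, a j S x) ∈ spinPoly := by
  have : (fun S x => ∑ j ∈ s, a j S x) = ∑ j ∈ s, a j := by
    funext S x; simp
  rw [this]; exact sum_mem h

lemma spinPoly_const_mul (r : ℝ) {a : SpinCurve → ℝ → ℝ} (h : a ∈ spinPoly) :
    (fun S x => r * a S x) ∈ spinPoly := Subalgebra.smul_mem _ h r

lemma cross_eq_smul_of_orth {s u w : E3} (hs : inner ℝ s s = (1 : ℝ)) (hu : inner ℝ s u = (0 : ℝ))
    (hw : inner ℝ s w = (0 : ℝ)) : cross u w = (inner ℝ s (cross u w) : ℝ) • s := by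
  have h1 : cross s (cross u w) = 0 := by rw [cross_cross_right, hu, hw]; simp
  have h2 := cross_cross_left s (cross u w) s
  rw [h1, hs, one_smul, cross_zero_left, real_inner_comm] at h2
  exact (sub_eq_zero.1 h2.symm)

end SpinPoly

/-! ### The generating sequence of the vector models -/

section SpinSequence

/-- The vectors `V₀ = S`, `Vₙ₊₁ = S ∧ D_x Vₙ + aₙ S`, with `aₙ` fixed by `V(z) · V(z) = 1`. -/
noncomputable def spinV : ℕ → SpinCurve → ℝ → E3
  | 0 => fun S x => S.val x
  | n + 1 => fun S x => cross (S.val x) (deriv (spinV n S) x)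
      + (-(1 / 2) * ∑ j : Fin n, (inner ℝ (spinV (j + 1) S x) (spinV (n - j) S x) : ℝ)) • S.val x
termination_by n => n
decreasing_by all_goals omega

/-- The normal component `aₙ` of `Vₙ₊₁`. -/
noncomputable def spinA (n : ℕ) : SpinCurve → ℝ → ℝ := fun S x =>
  -(1 / 2) * ∑ j ∈ Finset.range n, (inner ℝ (spinV (j + 1) S x) (spinV (n - j) S x) : ℝ)

@[simp] lemma spinV_zero (S : SpinCurve) : spinV 0 S = S.val := by
  funext x; rw [spinV]

lemma spinV_succ (n : ℕ) (S : SpinCurve) (x : ℝ) :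
    spinV (n + 1) S x = cross (S.val x) (deriv (spinV n S) x) + spinA n S x • S.val x := by
  rw [spinV, spinA]
  simp only [Finset.sum_range]

lemma isPolyVec_spinV (n : ℕ) : IsPolyVec (spinV n) := by
  induction n using Nat.strong_induction_on with
  | _ n ih =>
    cases n with
    | zero =>
      have : spinV 0 = fun S x => S.val x := by funext S x; simp
      rw [this]; exact isPolyVec_val
    | succ n =>
      have : spinV (n + 1) = fun S x => cross (S.val x) (deriv (spinV n S) x)
          + spinA n S x • S.val x := by funext S x; exact spinV_succ n S x
      rw [this]
      refine (isPolyVec_val.cross (ih n (by omega)).deriv).add (.smul ?_ isPolyVec_val)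
      refine spinPoly_const_mul _ (spinPoly_sum _ fun j hj => ?_)
      have := Finset.mem_range.1 hj
      exact (ih (j + 1) (by omega)).inner (ih (n - j) (by omega))

lemma spinA_mem (n : ℕ) : spinA n ∈ spinPoly :=
  spinPoly_const_mul _ (spinPoly_sum _ fun _ _ => (isPolyVec_spinV _).inner (isPolyVec_spinV _))

lemma spinV_hasDerivAt (n : ℕ) (S : SpinCurve) (x : ℝ) :
    HasDerivAt (spinV n S) (deriv (spinV n S) x) x :=
  (isPolyVec_spinV n).hasDerivAt S x

variable (S : SpinCurve) (x : ℝ)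

lemma spin_inner_self : inner ℝ (S.val x) (S.val x) = (1 : ℝ) := inner_self_of_norm (S.2.2 x)

lemma spin_hasDerivAt : HasDerivAt S.val (deriv S.val x) x :=
  (S.2.1.differentiable (by simp) x).hasDerivAt

lemma spin_inner_deriv : inner ℝ (S.val x) (deriv S.val x) = (0 : ℝ) := by
  have h := (spin_hasDerivAt S x).inner ℝ (spin_hasDerivAt S x)
  have h2 : (fun y => (inner ℝ (S.val y) (S.val y) : ℝ)) = fun _ => 1 :=
    funext (spin_inner_self S)
  rw [h2] at h
  have := h.unique (hasDerivAt_const x 1)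
  rw [real_inner_comm (S.val x) (deriv S.val x)] at this
  linarith

lemma inner_spinV_succ (n : ℕ) : inner ℝ (S.val x) (spinV (n + 1) S x) = spinA n S x := by
  rw [spinV_succ, inner_add_right, inner_cross_left, inner_smul_right, spin_inner_self]
  ring

/-- `V(z) · V(z) = 1`. -/
lemma spinV_norm (n : ℕ) :
    ∑ k ∈ Finset.range (n + 2), (inner ℝ (spinV k S x) (spinV (n + 1 - k) S x) : ℝ) = 0 := by
  rw [Finset.sum_range_succ, Finset.sum_range_succ']
  simp only [Nat.sub_self, spinV_zero, Nat.sub_zero, Nat.add_sub_add_right]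
  rw [real_inner_comm (S.val x) (spinV (n + 1) S x), inner_spinV_succ, spinA]
  ring

/-- The normalisation is preserved by the recursion. Differentiate the coefficient of V·V = 1 of the
relevant order. For the lower terms D_x Vₖ = Vₖ₊₁ ∧ S is already known, and the resulting triple
products cancel in pairs under reflection of the index, so only S·D_x Vₙ survives and must vanish. A
vector orthogonal to S is recovered from its product with S, which yields the second claim. -/
lemma spinV_deriv_orth_and (n : ℕ) : inner ℝ (S.val x) (deriv (spinV n S) x) = (0 : ℝ) ∧
    deriv (spinV n S) x = cross (spinV (n + 1) S x) (S.val x) := by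
  induction n using Nat.strong_induction_on with
  | _ n ih =>
    have orth : inner ℝ (S.val x) (deriv (spinV n S) x) = (0 : ℝ) := by
      cases n with
      | zero => simpa using spin_inner_deriv S x
      | succ n =>
        have hd : HasDerivAt (fun y => ∑ k ∈ Finset.range (n + 2),
            (inner ℝ (spinV k S y) (spinV (n + 1 - k) S y) : ℝ))
            (∑ k ∈ Finset.range (n + 2), ((inner ℝ (spinV k S x) (deriv (spinV (n + 1 - k) S) x) : ℝ)
              + inner ℝ (deriv (spinV k S) x) (spinV (n + 1 - k) S x))) x :=
          HasDerivAt.fun_sum fun k _ =>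
            (spinV_hasDerivAt k S x).inner ℝ (spinV_hasDerivAt (n + 1 - k) S x)
        rw [funext (fun y => spinV_norm S y n)] at hd
        have h0 := hd.unique (hasDerivAt_const x 0)
        rw [Finset.sum_add_distrib] at h0
        have hrefl : ∑ k ∈ Finset.range (n + 2),
            (inner ℝ (spinV k S x) (deriv (spinV (n + 1 - k) S) x) : ℝ)
            = ∑ k ∈ Finset.range (n + 2),
              (inner ℝ (deriv (spinV k S) x) (spinV (n + 1 - k) S x) : ℝ) := by
          rw [← Finset.sum_range_reflect]
          refine Finset.sum_congr rfl fun k hk => ?_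
          have hk' := Finset.mem_range.1 hk
          rw [real_inner_comm, show n + 2 - 1 - k = n + 1 - k by omega,
            show n + 1 - (n + 1 - k) = k by omega]
        have h1 : ∑ k ∈ Finset.range (n + 2),
            (inner ℝ (deriv (spinV k S) x) (spinV (n + 1 - k) S x) : ℝ) = 0 := by linarith
        rw [Finset.sum_range_succ, Nat.sub_self, spinV_zero] at h1
        have h2 : ∑ k ∈ Finset.range (n + 1),
            (inner ℝ (deriv (spinV k S) x) (spinV (n + 1 - k) S x) : ℝ) = 0 := by
          have e : ∀ k ∈ Finset.range (n + 1),
              (inner ℝ (deriv (spinV k S) x) (spinV (n + 1 - k) S x) : ℝ)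
              = inner ℝ (cross (spinV (k + 1) S x) (S.val x)) (spinV (n + 1 - k) S x) := by
            intro k hk
            rw [(ih k (Finset.mem_range.1 hk)).2]
          rw [Finset.sum_congr rfl e]
          have r := Finset.sum_range_reflect (fun k =>
            (inner ℝ (cross (spinV (k + 1) S x) (S.val x)) (spinV (n + 1 - k) S x) : ℝ)) (n + 1)
          have r' : ∑ k ∈ Finset.range (n + 1), (inner ℝ (cross (spinV (n + 1 - 1 - k + 1) S x)
              (S.val x)) (spinV (n + 1 - (n + 1 - 1 - k)) S x) : ℝ)
              = -∑ k ∈ Finset.range (n + 1),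
                (inner ℝ (cross (spinV (k + 1) S x) (S.val x)) (spinV (n + 1 - k) S x) : ℝ) := by
            rw [← Finset.sum_neg_distrib]
            refine Finset.sum_congr rfl fun k hk => ?_
            have hk' := Finset.mem_range.1 hk
            rw [show n + 1 - 1 - k + 1 = n + 1 - k by omega,
              show n + 1 - (n + 1 - 1 - k) = k + 1 by omega]
            simp only [inner_E3, cross_zero_apply, cross_one_apply, cross_two_apply]; ring
          linarith
        rw [real_inner_comm]
        linarith
    refine ⟨orth, ?_⟩
    rw [spinV_succ, cross_add_left, cross_smul_left, cross_self', smul_zero, add_zero,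
      cross_cross_left, spin_inner_self, real_inner_comm, orth]
    simp

lemma spinV_deriv_orth (n : ℕ) : inner ℝ (S.val x) (deriv (spinV n S) x) = (0 : ℝ) :=
  (spinV_deriv_orth_and S x n).1

lemma spinV_deriv (n : ℕ) : deriv (spinV n S) x = cross (spinV (n + 1) S x) (S.val x) :=
  (spinV_deriv_orth_and S x n).2

lemma spinA_hasDerivAt (n : ℕ) : HasDerivAt (spinA n S) (deriv (spinA n S) x) x :=
  ((isDiffRing_spin.contDiff _ (spinA_mem n) S).differentiable (by simp) x).hasDerivAt

lemma spinV_succ_deriv_aux (n : ℕ) : deriv (spinV (n + 1) S) x =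
    cross (deriv S.val x) (deriv (spinV n S) x) + cross (S.val x) (deriv (deriv (spinV n S)) x)
    + (spinA n S x • deriv S.val x + deriv (spinA n S) x • S.val x) := by
  have h : spinV (n + 1) S = fun y => cross (S.val y) (deriv (spinV n S) y) + spinA n S y • S.val y :=
    funext (spinV_succ n S)
  rw [h]
  exact ((hasDerivAt_cross (spin_hasDerivAt S x) ((isPolyVec_spinV n).deriv.hasDerivAt S x)).add
    ((spinA_hasDerivAt S x n).smul (spin_hasDerivAt S x))).deriv

/-- `D_x aₙ = -(S ∧ S_x) · D_x Vₙ`. -/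
lemma spinA_deriv (n : ℕ) : deriv (spinA n S) x
    = -inner ℝ (cross (S.val x) (deriv S.val x)) (deriv (spinV n S) x) := by
  have h := spinV_deriv_orth S x (n + 1)
  rw [spinV_succ_deriv_aux, inner_add_right, inner_add_right, inner_add_right, inner_cross_left,
    inner_smul_right, inner_smul_right, spin_inner_deriv, spin_inner_self] at h
  have e : inner ℝ (cross (S.val x) (deriv S.val x)) (deriv (spinV n S) x)
      = inner ℝ (S.val x) (cross (deriv S.val x) (deriv (spinV n S) x)) := by
    simp only [inner_E3, cross_zero_apply, cross_one_apply, cross_two_apply]; ring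
  rw [e]
  linarith [h]

/-- The terms S_x ∧ D_x Vₙ and (D_x aₙ) S of the product rule are both normal and cancel, since D_x
Vₙ₊₁ is tangential. What remains is the recursion operator applied to D_x Vₙ, with -aₙ in the place
of the nonlocal term. -/
lemma spinV_succ_deriv (n : ℕ) : deriv (spinV (n + 1) S) x =
    cross (S.val x) (deriv (deriv (spinV n S)) x) + spinA n S x • deriv S.val x := by
  have h1 := spinV_succ_deriv_aux S x n
  have h2 := cross_eq_smul_of_orth (spin_inner_self S x) (spin_inner_deriv S x)
    (spinV_deriv_orth S x n)
  have h3 : inner ℝ (S.val x) (cross (deriv S.val x) (deriv (spinV n S) x))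
      = -deriv (spinA n S) x := by
    rw [spinA_deriv]
    simp only [inner_E3, cross_zero_apply, cross_one_apply, cross_two_apply]; ring
  rw [h3] at h2
  rw [h1, h2, neg_smul]
  abel

end SpinSequence

/-! ### The vector models -/

section SpinModels

lemma spinV_const_curve {S : SpinCurve} (hS : S ∈ spinConst) (n : ℕ) (x : ℝ) :
    spinV (n + 1) S x = 0 := by
  induction n using Nat.strong_induction_on generalizing x with
  | _ n ih =>
    have hd : deriv (spinV n S) x = 0 := by
      cases n with
      | zero =>
        have : spinV 0 S = fun _ => S.val 0 := by
          rw [spinV_zero]; funext y; exact hS y 0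
        rw [this]; exact deriv_const x _
      | succ n =>
        have : spinV (n + 1) S = fun _ => 0 := funext fun y => ih n (by omega) y
        rw [this]; exact deriv_const x _
    have ha : spinA n S x = 0 := by
      rw [spinA, Finset.sum_eq_zero, mul_zero]
      intro j hj
      rw [ih j (Finset.mem_range.1 hj), inner_zero_left]
    rw [spinV_succ, hd, ha]; simp

lemma spinA_const_curve {S : SpinCurve} (hS : S ∈ spinConst) (n : ℕ) : spinA n S = 0 := by
  funext x
  rw [← inner_spinV_succ, spinV_const_curve hS, inner_zero_right]; rfl

lemma neg_spinA_isDxInv {F : SpinCurve → ℝ → ℝ} {n : ℕ}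
    (h : ∀ S x, deriv (spinA n S) x = -F S x) :
    IsDxInv spinPoly spinConst F (-spinA n) := by
  refine ⟨neg_mem (spinA_mem n), ?_, fun S hS => ?_⟩
  · funext S x
    show deriv (-spinA n S) x = F S x
    rw [deriv.neg, h, neg_neg]
  · show -spinA n S = 0
    rw [spinA_const_curve hS, neg_zero]

/-- The recursion operator acts on the sequence D_x Vₙ as an index shift, because the required D_x⁻¹
is the differential polynomial -aₙ. -/
lemma spinFlow_eq (n : ℕ) : spinFlow n = fun S x => deriv (spinV n S) x := by
  induction n with
  | zero => funext S x; rw [spinV_zero]; rfl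
  | succ n ih =>
    have hinv : spinInv (spinPairing (fun S x => deriv (spinV n S) x)) = -spinA n :=
      isDiffRing_spin.DxInv_eq (neg_spinA_isDxInv fun S x => spinA_deriv S x n)
    funext S x
    rw [spinFlow, Function.iterate_succ_apply', ← spinFlow, ih, spinOp, hinv, spinV_succ_deriv]
    show cross (S.val x) (deriv (fun x => deriv (spinV n S) x) x) - (-spinA n S x) • deriv S.val x
      = _
    rw [neg_smul, sub_neg_eq_add]

lemma spinFlow_apply (n : ℕ) (S : SpinCurve) (x : ℝ) : spinFlow n S x = deriv (spinV n S) x := by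
  rw [spinFlow_eq]

lemma spinPairing_isDxInv (n : ℕ) :
    IsDxInv spinPoly spinConst (spinPairing (spinFlow n)) (-spinA n) := by
  rw [spinFlow_eq]
  exact neg_spinA_isDxInv fun S x => spinA_deriv S x n

/-- In D_x aₙ₊₁ = -(S ∧ S_x)·D_x Vₙ₊₁ the part of D_x Vₙ₊₁ along S_x drops out, and (S ∧ S_x)·(S ∧
D_x f⁽ⁿ⁾) = S_x·D_x f⁽ⁿ⁾ because S is a unit vector orthogonal to S_x. -/
lemma spinPre_isDxInv (n : ℕ) : IsDxInv spinPoly spinConst (spinPre n) (-spinA (n + 1)) := by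
  refine neg_spinA_isDxInv fun S x => ?_
  rw [spinA_deriv, spinV_succ_deriv, inner_add_right, inner_cross_cross, inner_smul_right,
    real_inner_comm (deriv S.val x) (cross _ _), inner_cross_right, spin_inner_self,
    real_inner_comm (S.val x) (deriv S.val x), spin_inner_deriv, spinPre, spinFlow_eq]
  simp [Dx]

lemma spinDensity_eq (n : ℕ) : spinDensity n = fun S x => -(1 / (1 + (n : ℝ))) * spinA (n + 1) S x := by
  funext S x
  rw [spinDensity, spinInv, isDiffRing_spin.DxInv_eq (spinPre_isDxInv n)]
  show _ * (-spinA (n + 1) S x) = _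
  ring

lemma spinDensity_mem (n : ℕ) : spinDensity n ∈ spinPoly := by
  rw [spinDensity_eq]; exact spinPoly_const_mul _ (spinA_mem _)

lemma isPolyVec_spinFlow (n : ℕ) : IsPolyVec (spinFlow n) := by
  rw [spinFlow_eq]; exact (isPolyVec_spinV n).deriv

lemma spinFlow_orth (n : ℕ) (S : SpinCurve) (x : ℝ) :
    inner ℝ (S.val x) (spinFlow n S x) = (0 : ℝ) := by
  rw [spinFlow_apply]; exact spinV_deriv_orth S x n

/-- Rotations preserve the cross product. -/
lemma map_cross (A : E3 ≃ₗᵢ[ℝ] E3) (hA : LinearMap.det (A.toLinearEquiv : E3 →ₗ[ℝ] E3) = 1)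
    (a b : E3) : cross (A a) (A b) = A (cross a b) := by
  let e := (EuclideanSpace.basisFun (Fin 3) ℝ).toBasis
  have hdet : ∀ v : Fin 3 → E3, e.det v = inner ℝ (v 0) (cross (v 1) (v 2)) := by
    intro v
    rw [Module.Basis.det_apply, Matrix.det_fin_three, inner_E3]
    simp [e, Module.Basis.toMatrix_apply]
    ring
  refine ext_inner_left ℝ fun c => ?_
  -- Testing against c = A(A⁻¹c) turns the claim into invariance of the triple product, which is a
  -- determinant.
  have h := Module.Basis.det_comp e (A.toLinearEquiv : E3 →ₗ[ℝ] E3) ![A.symm c, a, b]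
  rw [hA, one_mul, hdet, hdet] at h
  have h' : inner ℝ c (cross (A a) (A b)) = (inner ℝ (A.symm c) (cross a b) : ℝ) := by
    simpa using! h
  rw [h', ← A.inner_map_map, A.apply_symm_apply]

lemma spinV_equivariant (A : E3 ≃ₗᵢ[ℝ] E3)
    (hA : LinearMap.det (A.toLinearEquiv : E3 →ₗ[ℝ] E3) = 1) {S S' : SpinCurve}
    (h : ∀ x, S'.val x = A (S.val x)) (n : ℕ) :
    (∀ x, spinV n S' x = A (spinV n S x)) ∧
      ∀ x, deriv (spinV n S') x = A (deriv (spinV n S) x) := by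
  have hd : ∀ n, (∀ x, spinV n S' x = A (spinV n S x)) →
      ∀ x, deriv (spinV n S') x = A (deriv (spinV n S) x) := by
    intro n hn x
    rw [funext hn]
    exact (A.toContinuousLinearEquiv.toContinuousLinearMap.hasFDerivAt.comp_hasDerivAt x
      (spinV_hasDerivAt n S x)).deriv
  induction n using Nat.strong_induction_on with
  | _ n ih =>
    suffices hn : ∀ x, spinV n S' x = A (spinV n S x) from ⟨hn, hd n hn⟩
    cases n with
    | zero => simpa using h
    | succ n =>
      intro x
      have ha : spinA n S' x = spinA n S x := by
        rw [spinA, spinA]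
        congr 1
        refine Finset.sum_congr rfl fun j hj => ?_
        have hj' := Finset.mem_range.1 hj
        rw [(ih (j + 1) (by omega)).1, (ih (n - j) (by omega)).1, A.inner_map_map]
      rw [spinV_succ, spinV_succ, (ih n (by omega)).2, h, ha, map_cross A hA, map_add, map_smul]

lemma spinA_zero : spinA 0 = 0 := by
  funext S x; simp [spinA]

lemma spinFlow_one (S : SpinCurve) (x : ℝ) :
    spinFlow 1 S x = cross (S.val x) (iteratedDeriv 2 S.val x) := by
  rw [spinFlow_apply, spinV_succ_deriv, spinA_zero, spinV_zero, iteratedDeriv_succ,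
    iteratedDeriv_one]
  simp

lemma spin_jet_hasDerivAt (S : SpinCurve) (k : ℕ) (x : ℝ) :
    HasDerivAt (iteratedDeriv k S.val) (iteratedDeriv (k + 1) S.val x) x := by
  rw [iteratedDeriv_succ]
  exact ((spin_jet_contDiff S k).differentiable (by simp) x).hasDerivAt

lemma spin_inner_two (S : SpinCurve) (x : ℝ) :
    inner ℝ (S.val x) (iteratedDeriv 2 S.val x)
      = -(inner ℝ (deriv S.val x) (deriv S.val x) : ℝ) := by
  have h2 := spin_jet_hasDerivAt S 1 x
  rw [iteratedDeriv_one] at h2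
  have h := (spin_hasDerivAt S x).inner ℝ h2
  rw [funext (spin_inner_deriv S)] at h
  have := h.unique (hasDerivAt_const x 0)
  linarith

lemma spin_inner_three (S : SpinCurve) (x : ℝ) :
    inner ℝ (S.val x) (iteratedDeriv 3 S.val x)
      = -(3 * inner ℝ (deriv S.val x) (iteratedDeriv 2 S.val x) : ℝ) := by
  have h2 := spin_jet_hasDerivAt S 1 x
  rw [iteratedDeriv_one] at h2
  have h := (spin_hasDerivAt S x).inner ℝ (spin_jet_hasDerivAt S 2 x)
  rw [funext (spin_inner_two S)] at h
  have := h.unique (h2.inner ℝ h2).neg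
  simp only [Nat.reduceAdd] at this
  rw [real_inner_comm (deriv S.val x) (iteratedDeriv 2 S.val x)] at this
  linarith

lemma spinV_one (S : SpinCurve) (x : ℝ) : spinV 1 S x = cross (S.val x) (deriv S.val x) := by
  rw [spinV_succ, spinA_zero]; simp

lemma spinA_one (S : SpinCurve) (x : ℝ) :
    spinA 1 S x = -(1 / 2) * inner ℝ (deriv S.val x) (deriv S.val x) := by
  rw [spinA, Finset.sum_range_one]
  simp only [zero_add, Nat.sub_zero]
  rw [spinV_one, inner_cross_cross, spin_inner_self, spin_inner_deriv]
  ring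

lemma spinV_one_deriv (S : SpinCurve) :
    deriv (spinV 1 S) = fun y => cross (S.val y) (iteratedDeriv 2 S.val y) := by
  funext y; rw [← spinFlow_apply, spinFlow_one]

lemma spinFlow_two (S : SpinCurve) (x : ℝ) : spinFlow 2 S x = -(iteratedDeriv 3 S.val x +
    (3 / 2 : ℝ) • deriv (fun y => ‖deriv S.val y‖ ^ 2 • S.val y) x) := by
  have h2 := spin_jet_hasDerivAt S 1 x
  rw [iteratedDeriv_one] at h2
  have hd : deriv (fun y => ‖deriv S.val y‖ ^ 2 • S.val y) x
      = (inner ℝ (deriv S.val x) (deriv S.val x) : ℝ) • deriv S.val x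
        + (2 * inner ℝ (deriv S.val x) (iteratedDeriv 2 S.val x) : ℝ) • S.val x := by
    simp only [← real_inner_self_eq_norm_sq]
    rw [((h2.inner ℝ h2).fun_smul (spin_hasDerivAt S x)).deriv,
      real_inner_comm (deriv S.val x) (iteratedDeriv 2 S.val x), two_mul]
  rw [hd, spinFlow_apply, spinV_succ_deriv, spinA_one, spinV_one_deriv,
    (hasDerivAt_cross (spin_hasDerivAt S x) (spin_jet_hasDerivAt S 2 x)).deriv, cross_add_right,
    cross_cross_right, cross_cross_right, spin_inner_two, spin_inner_three, spin_inner_deriv,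
    spin_inner_self]
  module

end SpinModels

/-! ### Evolution of the generating sequence along the flows -/

section Evolution

open PowerSeries

lemma crossProduct_zero {R : Type*} [CommRing R] (a b : Fin 3 → R) :
    crossProduct a b 0 = a 1 * b 2 - a 2 * b 1 := rfl
lemma crossProduct_one {R : Type*} [CommRing R] (a b : Fin 3 → R) :
    crossProduct a b 1 = a 2 * b 0 - a 0 * b 2 := rfl
lemma crossProduct_two {R : Type*} [CommRing R] (a b : Fin 3 → R) :
    crossProduct a b 2 = a 0 * b 1 - a 1 * b 0 := rfl

/-- The coefficients of `Rₙ(z) ∧ V(z)`, where `Rₙ(z) = ∑ Vₙ₊₁₊ₖ zᵏ`. -/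
noncomputable def spinX (n m : ℕ) (S : SpinCurve) (x : ℝ) : E3 :=
  ∑ k ∈ Finset.range (m + 1), cross (spinV (n + 1 + k) S x) (spinV (m - k) S x)

/-- The coefficients of `Rₙ(z) · V(z)`. -/
noncomputable def spinP (n m : ℕ) (S : SpinCurve) (x : ℝ) : ℝ :=
  ∑ k ∈ Finset.range (m + 1), inner ℝ (spinV (n + 1 + k) S x) (spinV (m - k) S x)

/-- A constant vector as a vector of power series. -/
noncomputable def constVec (a : E3) : Fin 3 → ℝ⟦X⟧ := fun i => C (a i)

/-- The generating series `V(z)`. -/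
noncomputable def serV (S : SpinCurve) (x : ℝ) : Fin 3 → ℝ⟦X⟧ := vecSeries fun k => spinV k S x

/-- The generating series `Rₙ(z)`. -/
noncomputable def serR (n : ℕ) (S : SpinCurve) (x : ℝ) : Fin 3 → ℝ⟦X⟧ :=
  vecSeries fun k => spinV (n + 1 + k) S x

lemma coeff_cross_const (v : ℕ → E3) (a : E3) (n : ℕ) (i : Fin 3) :
    coeff n (crossProduct (vecSeries v) (constVec a) i) = cross (v n) a i := by
  fin_cases i <;> simp [cross_apply, constVec]

lemma coeff_dot_const (a : E3) (F : Fin 3 → ℝ⟦X⟧) (n : ℕ) :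
    coeff n (dot3 (constVec a) F) = a 0 * coeff n (F 0) + a 1 * coeff n (F 1) + a 2 * coeff n (F 2) := by
  simp [dot3, constVec]

variable (S : SpinCurve) (x : ℝ)

lemma serV_deriv (i : Fin 3) : X * vecSeries (fun k => deriv (spinV k S) x) i
    = crossProduct (serV S x) (constVec (S.val x)) i := by
  ext n
  rw [serV, coeff_cross_const]
  cases n with
  | zero => rw [coeff_zero_X_mul, spinV_zero, cross_self']; rfl
  | succ n => rw [coeff_succ_X_mul, coeff_vecSeries, spinV_deriv]

/-- Rₙ is a shifted tail of V and satisfies the same equation up to its constant term Vₙ₊₁, which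
has to be subtracted. -/
lemma serR_deriv (n : ℕ) (i : Fin 3) : X * vecSeries (fun k => deriv (spinV (n + 1 + k) S) x) i
    = crossProduct (serR n S x - constVec (spinV (n + 1) S x)) (constVec (S.val x)) i := by
  ext m
  rw [map_sub, LinearMap.sub_apply, Pi.sub_apply, map_sub, serR, coeff_cross_const]
  have hc : crossProduct (constVec (spinV (n + 1) S x)) (constVec (S.val x)) i
      = C (cross (spinV (n + 1) S x) (S.val x) i) := by
    fin_cases i <;> simp [cross_apply, constVec]
  rw [hc, coeff_C]
  cases m with
  | zero => simp
  | succ m => rw [coeff_succ_X_mul, coeff_vecSeries, spinV_deriv]; simp [add_assoc]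

lemma serV_norm : dot3 (serV S x) (serV S x) = 1 := by
  ext n
  rw [serV, coeff_dot3, coeff_one]
  cases n with
  | zero => simpa using! spin_inner_self S x
  | succ n => simpa using! spinV_norm S x n

lemma vecSeries_spinX (n : ℕ) : vecSeries (fun m => spinX n m S x)
    = crossProduct (serR n S x) (serV S x) := by
  funext i
  ext m
  rw [serR, serV, coeff_cross, coeff_vecSeries, spinX]
  exact map_sum (coordL i) _ _

lemma spinX_hasDerivAt (n m : ℕ) : HasDerivAt (spinX n m S)
    (∑ k ∈ Finset.range (m + 1), (cross (deriv (spinV (n + 1 + k) S) x) (spinV (m - k) S x)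
      + cross (spinV (n + 1 + k) S x) (deriv (spinV (m - k) S) x))) x :=
  HasDerivAt.fun_sum fun _ _ => hasDerivAt_cross (spinV_hasDerivAt _ S x) (spinV_hasDerivAt _ S x)

/-- By the Jacobi identity z (r ∧ V)' = (r ∧ V) ∧ s + V ∧ (c ∧ s). This is the inhomogeneous
equation assumed for Y, so the difference Y - r ∧ V solves the homogeneous one. -/
lemma evolution_identity {R : Type*} [CommRing R] (z : R) {V V' r r' Y Y' s c : Fin 3 → R}
    (hV : ∀ i, z * V' i = crossProduct V s i) (hr : ∀ i, z * r' i = crossProduct (r - c) s i)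
    (hY : ∀ i, z * Y' i = (crossProduct Y s + crossProduct V (crossProduct c s)) i) (i : Fin 3) :
    z * (Y' i - (crossProduct r' V i + crossProduct r V' i))
      = crossProduct (Y - crossProduct r V) s i := by
  have hV0 := hV 0; have hV1 := hV 1; have hV2 := hV 2
  have hr0 := hr 0; have hr1 := hr 1; have hr2 := hr 2
  have hY0 := hY 0; have hY1 := hY 1; have hY2 := hY 2
  simp only [crossProduct_zero, crossProduct_one, crossProduct_two, Pi.sub_apply, Pi.add_apply]
    at hV0 hV1 hV2 hr0 hr1 hr2 hY0 hY1 hY2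
  fin_cases i
  · show z * (Y' 0 - ((r' 1 * V 2 - r' 2 * V 1) + (r 1 * V' 2 - r 2 * V' 1)))
        = (Y 1 - (r 2 * V 0 - r 0 * V 2)) * s 2 - (Y 2 - (r 0 * V 1 - r 1 * V 0)) * s 1
    linear_combination hY0 - V 2 * hr1 + V 1 * hr2 - r 1 * hV2 + r 2 * hV1
  · show z * (Y' 1 - ((r' 2 * V 0 - r' 0 * V 2) + (r 2 * V' 0 - r 0 * V' 2)))
        = (Y 2 - (r 0 * V 1 - r 1 * V 0)) * s 0 - (Y 0 - (r 1 * V 2 - r 2 * V 1)) * s 2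
    linear_combination hY1 - V 0 * hr2 + V 2 * hr0 - r 2 * hV0 + r 0 * hV2
  · show z * (Y' 2 - ((r' 0 * V 1 - r' 1 * V 0) + (r 0 * V' 1 - r 1 * V' 0)))
        = (Y 0 - (r 1 * V 2 - r 2 * V 1)) * s 1 - (Y 1 - (r 2 * V 0 - r 0 * V 2)) * s 0
    linear_combination hY2 - V 1 * hr0 + V 0 * hr1 - r 0 * hV1 + r 1 * hV0

variable {S}

lemma eq_zero_of_cross_inner {s d : E3} (hs : inner ℝ s s = (1 : ℝ)) (h1 : cross d s = 0)
    (h2 : inner ℝ s d = (0 : ℝ)) : d = 0 := by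
  have := cross_cross_right s d s
  rw [h1, hs, h2] at this
  simpa using this.symm

lemma spinPoly_smoothFam {I : Set ℝ} (hI : IsOpen I) {c : ℝ → SpinCurve}
    (hc : SmoothFam I fun t x => (c t).val x) {G : SpinCurve → ℝ → ℝ} (hG : G ∈ spinPoly) :
    SmoothFam I fun t x => G (c t) x := by
  refine adjoin_contDiffOn ?_ hG
  rintro _ ⟨k, i, rfl⟩
  exact (hc.iteratedDeriv hI k).clm (coordL i)

lemma IsPolyVec.smoothFam {I : Set ℝ} (hI : IsOpen I) {c : ℝ → SpinCurve}
    (hc : SmoothFam I fun t x => (c t).val x) {F : SpinCurve → ℝ → E3} (hF : IsPolyVec F) :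
    SmoothFam I fun t x => F (c t) x :=
  contDiffOn_E3.2 fun i => spinPoly_smoothFam hI hc (hF i)

/-- Along the `n`-th flow, `V(z)_t = Rₙ(z) ∧ V(z)`. -/
theorem spinV_evolution {I : Set ℝ} (hI : IsOpen I) {c : ℝ → SpinCurve}
    (hc : SmoothFam I fun t x => (c t).val x) {t : ℝ} (ht : t ∈ I) {n : ℕ}
    (hflow : ∀ x, HasDerivAt (fun τ => (c τ).val x) (spinFlow n (c t) x) t) (m : ℕ) :
    ∀ x, HasDerivAt (fun τ => spinV m (c τ) x) (spinX n m (c t) x) t := by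
  have hsm : ∀ k, SmoothFam I fun τ x => spinV k (c τ) x := fun k =>
    (isPolyVec_spinV k).smoothFam hI hc
  set Y : ℕ → ℝ → E3 := fun k x => deriv (fun τ => spinV k (c τ) x) t with hYdef
  have hYt : ∀ k x, HasDerivAt (fun τ => spinV k (c τ) x) (Y k x) t := fun k x =>
    (hsm k).hasDerivAt_t hI ht x
  have hYx : ∀ k x, HasDerivAt (Y k) (deriv (Y k) x) x := fun k x =>
    ((hsm k).dt hI).hasDerivAt_x hI ht x
  have hY0 : ∀ x, Y 0 x = cross (spinV (n + 1) (c t) x) ((c t).val x) := fun x => by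
    have := hYt 0 x
    simp only [spinV_zero] at this
    rw [this.unique (hflow x), spinFlow_apply, spinV_deriv]
  -- The variational equation of D_x Vₖ = Vₖ₊₁ ∧ S, obtained by interchanging the x- and
  -- t-derivatives.
  have hYd : ∀ k x, deriv (Y k) x = cross (Y (k + 1) x) ((c t).val x)
      + cross (spinV (k + 1) (c t) x) (Y 0 x) := by
    intro k x
    have h1 := (hsm k).hasDerivAt_mixed hI ht x
    have h2 : HasDerivAt (fun τ => deriv (spinV k (c τ)) x) (cross (Y (k + 1) x) ((c t).val x)
      + cross (spinV (k + 1) (c t) x) (Y 0 x)) t := by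
      simp only [spinV_deriv]
      have := hYt 0 x
      simp only [spinV_zero] at this
      exact hasDerivAt_cross (hYt (k + 1) x) this
    exact h1.unique h2
  -- The discrepancy series satisfies z d_x = d ∧ S. Together with V·d = 0 this forces it to vanish
  -- order by order.
  set d : ℕ → ℝ → E3 := fun k x => Y k x - spinX n k (c t) x with hd
  have hdx : ∀ k x, HasDerivAt (d k) (cross (d (k + 1) x) ((c t).val x)) x := by
    intro k x
    have h := (hYx k x).sub (spinX_hasDerivAt (c t) x n k)
    convert! h using 1
    apply PiLp.ext
    intro i
    have hYs : ∀ i, X * vecSeries (fun k => deriv (Y k) x) i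
        = (crossProduct (vecSeries fun k => Y k x) (constVec ((c t).val x))
          + crossProduct (serV (c t) x) (crossProduct (constVec (spinV (n + 1) (c t) x))
            (constVec ((c t).val x)))) i := by
      intro i
      have hcc : crossProduct (constVec (spinV (n + 1) (c t) x)) (constVec ((c t).val x))
          = constVec (Y 0 x) := by
        rw [hY0]
        funext i
        fin_cases i <;> simp [cross_apply, constVec]
      ext m
      rw [hcc, Pi.add_apply, map_add, serV, coeff_cross_const, coeff_cross_const]
      cases m with
      | zero =>
        rw [coeff_zero_X_mul, hY0, spinV_zero]
        simp only [← PiLp.add_apply]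
        rw [cross_swap ((c t).val x), add_neg_cancel]; rfl
      | succ m =>
        rw [coeff_succ_X_mul, coeff_vecSeries, hYd]; rfl
    have := congrArg (coeff (k + 1)) (evolution_identity X (serV_deriv (c t) x)
      (serR_deriv (c t) x n) hYs i)
    rw [coeff_succ_X_mul, map_sub, coeff_vecSeries, ← vecSeries_spinX] at this
    have e : (vecSeries fun k => Y k x) - (vecSeries fun m => spinX n m (c t) x)
        = vecSeries fun k => d k x := by
      funext i; ext m; simp [hd]
    rw [e, coeff_cross_const, map_add, serR, serV, coeff_cross, coeff_cross] at this
    rw [← this, PiLp.sub_apply]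
    congr 1
    rw [← Finset.sum_add_distrib]
    symm
    exact map_sum (coordL i) _ _
  have hnorm : ∀ x, dot3 (serV (c t) x) (vecSeries fun k => d k x) = 0 := by
    intro x
    have h1 : ∀ i, HasCoeffDerivAt (fun τ => serV (c τ) x i) (vecSeries (fun k => Y k x) i) t :=
      hasCoeffDerivAt_vecSeries fun k => hYt k x
    have h2 := ((h1 0).mul (h1 0)).add ((h1 1).mul (h1 1)) |>.add ((h1 2).mul (h1 2))
    have h3 : (fun τ => serV (c τ) x 0 * serV (c τ) x 0 + serV (c τ) x 1 * serV (c τ) x 1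
        + serV (c τ) x 2 * serV (c τ) x 2) = fun _ => 1 := funext fun τ => serV_norm (c τ) x
    rw [h3] at h2
    have h4 := h2.unique (F'' := 0) fun k => by simpa using hasDerivAt_const t _
    have e : (vecSeries fun k => d k x)
        = (vecSeries fun k => Y k x) - crossProduct (serR n (c t) x) (serV (c t) x) := by
      rw [← vecSeries_spinX]
      funext i; ext m; simp [hd]
    have h5 : (2 : ℝ⟦X⟧) * dot3 (serV (c t) x) (vecSeries fun k => d k x) = 0 := by
      rw [e]
      simp only [dot3, crossProduct_zero, crossProduct_one, crossProduct_two, Pi.sub_apply]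
      linear_combination h4
    have h6 : (2 : ℝ⟦X⟧) ≠ 0 := fun h => by
      have := congrArg (constantCoeff (R := ℝ)) h
      rw [map_ofNat, map_zero] at this
      norm_num at this
    exact (mul_eq_zero.1 h5).resolve_left h6
  -- If all lower terms vanish, then dₖ ∧ S is the x-derivative of the preceding term, hence zero,
  -- and the coefficient of V·d at order k reduces to S·dₖ. At order zero the flow equation itself
  -- gives the claim.
  have hzero : ∀ k x, d k x = 0 := by
    intro k
    induction k using Nat.strong_induction_on with
    | _ k ih =>
      intro x
      have hin : inner ℝ ((c t).val x) (d k x) = (0 : ℝ) := by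
        have := congrArg (coeff k) (hnorm x)
        rw [serV, coeff_dot3, Finset.sum_range_succ', map_zero, Finset.sum_eq_zero, zero_add,
          spinV_zero] at this
        · exact this
        · intro j hj
          rw [ih (k - (j + 1)) (by have := Finset.mem_range.1 hj; omega), inner_zero_right]
      refine eq_zero_of_cross_inner (spin_inner_self (c t) x) ?_ hin
      cases k with
      | zero => simp [hd, hY0, spinX]
      | succ k =>
        have h := hdx k x
        rw [show d k = fun _ => 0 from funext fun y => ih k (by omega) y] at h
        exact h.unique (hasDerivAt_const x 0)
  intro x
  have := hYt m x
  rwa [sub_eq_zero.1 (hzero m x)] at this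

/-! ### Commutation of the flows -/

variable (S)

lemma spinX_succ (n m : ℕ) : spinX n (m + 1) S x
    = cross (spinV (n + 1) S x) (spinV (m + 1) S x) + spinX (n + 1) m S x := by
  rw [spinX, Finset.sum_range_succ', add_comm, spinX]
  simp only [add_zero, Nat.sub_zero, Nat.add_sub_add_right]
  congr 1
  refine Finset.sum_congr rfl fun k _ => ?_
  rw [show n + 1 + (k + 1) = n + 1 + 1 + k by omega]

/-- R₀ is V without its leading term S, divided by z. Since V ∧ V = 0, only the contribution of S
remains. -/
lemma spinX_zero_left (m : ℕ) : spinX 0 m S x = cross (spinV (m + 1) S x) (S.val x) := by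
  have h : ∀ i, ∑ k ∈ Finset.range (m + 1 + 1), cross (spinV k S x) (spinV (m + 1 - k) S x) i = 0 := by
    intro i
    have := coeff_cross (fun k => spinV k S x) (fun k => spinV k S x) (m + 1) i
    rw [cross_self] at this
    rw [← this]; simp
  have h' : ∑ k ∈ Finset.range (m + 1 + 1), cross (spinV k S x) (spinV (m + 1 - k) S x) = 0 := by
    apply PiLp.ext
    intro i
    refine Eq.trans ?_ (h i)
    exact map_sum (coordL i) _ _
  rw [Finset.sum_range_succ', spinV_zero] at h'
  simp only [Nat.sub_zero, Nat.add_sub_add_right] at h'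
  rw [cross_swap, ← eq_neg_of_add_eq_zero_left h', spinX]
  refine Finset.sum_congr rfl fun k _ => ?_
  rw [show 0 + 1 + k = k + 1 by omega]

/-- Moving one unit of index between the two arguments costs Vₘ₊₁ ∧ Vₙ₊₁ one way and Vₙ₊₁ ∧ Vₘ₊₁ the
other way, and these cancel. -/
lemma spinX_symm (m n : ℕ) : spinX m n S x = spinX n m S x := by
  induction n generalizing m with
  | zero => rw [spinX_zero_left]; simp [spinX]
  | succ n ih =>
    have h := spinX_succ S x n m
    rw [spinX_succ, ih (m + 1), h, cross_swap (spinV (m + 1) S x)]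
    abel

/-- Since f⁽ⁿ⁾ = D_x Vₙ, its linearisation along the m-th flow is D_x of `spinX m n`, so
commutativity is the symmetry of `spinX`. Only the initial velocity of the variation matters,
because `spinV_evolution` is a statement at a single time. -/
lemma spin_flowsCommute (m n : ℕ) : FlowsCommute SpinCurve.val (spinFlow m) (spinFlow n) := by
  have key : ∀ {m n : ℕ} {a : ℝ → SpinCurve},
      ContDiff ℝ ∞ (fun p : ℝ × ℝ => SpinCurve.val (a p.1) p.2) →
      (∀ x, HasDerivAt (fun ε => SpinCurve.val (a ε) x) (spinFlow m (a 0) x) 0) →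
      ∀ x, HasDerivAt (fun ε => spinFlow n (a ε) x) (deriv (spinX m n (a 0)) x) 0 := by
    intro m n a ha hf x
    have hs : SmoothFam univ fun t x => (a t).val x := ha.contDiffOn
    have hv := ((isPolyVec_spinV n).smoothFam isOpen_univ hs).hasDerivAt_mixed isOpen_univ
      (mem_univ 0) x
    have e : (fun y => deriv (fun τ => spinV n (a τ) y) 0) = spinX m n (a 0) :=
      funext fun y => (spinV_evolution isOpen_univ hs (mem_univ 0) hf n y).deriv
    rw [e] at hv
    simpa only [spinFlow_apply] using hv
  intro a b ha hb hab hfa hfb x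
  refine ⟨_, key ha hfa x, ?_⟩
  have := key (n := m) hb hfb x
  rwa [← hab, show spinX n m (a 0) = spinX m n (a 0) from funext fun y => spinX_symm (a 0) y n m]
    at this

/-! ### Local conservation laws -/

lemma spinP_mem (n m : ℕ) : spinP n m ∈ spinPoly :=
  spinPoly_sum _ fun _ _ => (isPolyVec_spinV _).inner (isPolyVec_spinV _)

/-- In z (r·V)' the rotations of r and V by s cancel, leaving the triple product of s, c and V. -/
lemma conservation_identity {R : Type*} [CommRing R] (z : R) {V V' r r' s c : Fin 3 → R}
    (hV : ∀ i, z * V' i = crossProduct V s i) (hr : ∀ i, z * r' i = crossProduct (r - c) s i) :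
    dot3 s (crossProduct (r - c) V)
      = dot3 s (crossProduct r V) - z * (dot3 r V' + dot3 r' V) := by
  have hV0 := hV 0; have hV1 := hV 1; have hV2 := hV 2
  have hr0 := hr 0; have hr1 := hr 1; have hr2 := hr 2
  simp only [crossProduct_zero, crossProduct_one, crossProduct_two, Pi.sub_apply]
    at hV0 hV1 hV2 hr0 hr1 hr2
  simp only [crossProduct_zero, crossProduct_one, crossProduct_two, Pi.sub_apply, dot3]
  linear_combination V 0 * hr0 + V 1 * hr1 + V 2 * hr2 + r 0 * hV0 + r 1 * hV1 + r 2 * hV2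

/-- Rₙ - Vₙ₊₁ = z Rₙ₊₁, so comparing coefficients in `conservation_identity` trades one unit of n
for one unit of m at the price of a total derivative. -/
lemma inner_spinX_succ (n m : ℕ) : inner ℝ (S.val x) (spinX (n + 1) m S x)
    = inner ℝ (S.val x) (spinX n (m + 1) S x) - deriv (spinP n m S) x := by
  have hder : HasDerivAt (spinP n m S) (∑ k ∈ Finset.range (m + 1),
      ((inner ℝ (spinV (n + 1 + k) S x) (deriv (spinV (m - k) S) x) : ℝ)
      + inner ℝ (deriv (spinV (n + 1 + k) S) x) (spinV (m - k) S x))) x :=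
    HasDerivAt.fun_sum fun k _ => (spinV_hasDerivAt _ S x).inner ℝ (spinV_hasDerivAt _ S x)
  rw [hder.deriv]
  have hshift : serR n S x - constVec (spinV (n + 1) S x) = fun i => X * serR (n + 1) S x i := by
    funext i
    ext k
    cases k with
    | zero =>
      rw [coeff_zero_X_mul, Pi.sub_apply, map_sub, serR, constVec, coeff_vecSeries, coeff_zero_C,
        add_zero, sub_self]
    | succ k => simp [serR, constVec, coeff_succ_X_mul, show n + 1 + 1 + k = n + 1 + (k + 1) by omega]
  have h := congrArg (coeff (m + 1)) (conservation_identity X (serV_deriv S x) (serR_deriv S x n))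
  have e1 : dot3 (constVec (S.val x)) (crossProduct (fun i => X * serR (n + 1) S x i) (serV S x))
      = X * dot3 (constVec (S.val x)) (crossProduct (serR (n + 1) S x) (serV S x)) := by
    simp [dot3, cross_apply]; ring
  rw [hshift, e1, map_sub, coeff_succ_X_mul, coeff_succ_X_mul, ← vecSeries_spinX,
    ← vecSeries_spinX, coeff_dot_const, coeff_dot_const, map_add, serR, serV, coeff_dot3,
    coeff_dot3, ← Finset.sum_add_distrib] at h
  simpa only [inner_E3 (S.val x), coeff_vecSeries] using h

/-- The fluxes of the conservation laws. -/
lemma exists_spin_flux (n : ℕ) : ∀ m, ∃ Ψ ∈ spinPoly, (∀ c ∈ spinConst, Ψ c = 0) ∧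
    ∀ S x, deriv (Ψ S) x = inner ℝ (S.val x) (spinX n m S x) := by
  induction n with
  | zero =>
    intro m
    -- The descent ends at R₀ ∧ V = D_x V, which is orthogonal to S and so needs no flux.
    refine ⟨0, zero_mem _, fun _ _ => rfl, fun S x => ?_⟩
    rw [spinX_zero_left, inner_cross_right]
    exact deriv_const x 0
  | succ n ih =>
    intro m
    obtain ⟨Ψ, h1, h2, h3⟩ := ih (m + 1)
    refine ⟨Ψ - spinP n m, sub_mem h1 (spinP_mem n m), fun c hc => ?_, fun S x => ?_⟩
    · funext x
      show Ψ c x - spinP n m c x = 0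
      rw [h2 c hc, spinP, Finset.sum_eq_zero]
      · simp
      · intro k _
        rw [show n + 1 + k = n + k + 1 by omega, spinV_const_curve hc, inner_zero_left]
    · rw [inner_spinX_succ, ← h3]
      exact deriv_sub ((isDiffRing_spin.contDiff _ h1 S).differentiable (by simp) x)
        ((isDiffRing_spin.contDiff _ (spinP_mem n m) S).differentiable (by simp) x)

/-- In the derivative of aₘ = S·Vₘ₊₁ the term S_t·Vₘ₊₁ with S_t = Vₙ₊₁ ∧ S cancels the contribution
of Vₙ₊₁ ∧ Vₘ₊₁, the leading summand of `spinX n (m + 1)`. -/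
lemma spinA_evolution {I : Set ℝ} (hI : IsOpen I) {c : ℝ → SpinCurve}
    (hc : SmoothFam I fun t x => (c t).val x) {t : ℝ} (ht : t ∈ I) {n : ℕ}
    (hflow : ∀ x, HasDerivAt (fun τ => (c τ).val x) (spinFlow n (c t) x) t) (m : ℕ) (x : ℝ) :
    HasDerivAt (fun τ => spinA m (c τ) x) (inner ℝ ((c t).val x) (spinX (n + 1) m (c t) x)) t := by
  have h := (hflow x).inner ℝ (spinV_evolution hI hc ht hflow (m + 1) x)
  simp only [inner_spinV_succ] at h
  convert! h using 1
  rw [spinX_succ, spinFlow_apply, spinV_deriv, inner_add_right]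
  simp only [inner_E3, cross_zero_apply, cross_one_apply, cross_two_apply]; ring

lemma spin_localConservation (m n : ℕ) : HasLocalConservationLaw spinPoly spinConst SpinCurve.val
    (spinFlow n) (spinDensity m) := by
  obtain ⟨Ψ, h1, h2, h3⟩ := exists_spin_flux (n + 1) (m + 1)
  refine ⟨fun S x => -(1 / (1 + (m : ℝ))) * Ψ S x, spinPoly_const_mul _ h1, fun c hc => ?_,
    fun I c hI hsol t ht x => ?_⟩
  · funext x
    show -(1 / (1 + (m : ℝ))) * Ψ c x = 0
    rw [h2 c hc]; simp
  · have h := (spinA_evolution hI hsol.1 ht (hsol.2 t ht) (m + 1) x).const_mul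
      (-(1 / (1 + (m : ℝ))))
    rw [← h3] at h
    rw [spinDensity_eq]
    convert! h using 1
    exact deriv_const_mul _ ((isDiffRing_spin.contDiff _ h1 _).differentiable (by simp) x)

end Evolution

/-! ### Integrated conservation laws -/

section Integrated

lemma abs_coord_le (a : E3) (i : Fin 3) : |a i| ≤ ‖a‖ := PiLp.norm_apply_le a i

lemma spin_isConservedOnCircle {n : ℕ} {h : SpinCurve → ℝ → ℝ} (hh : h ∈ spinPoly)
    (hloc : HasLocalConservationLaw spinPoly spinConst SpinCurve.val (spinFlow n) h) :
    IsConservedOnCircle SpinCurve.val (spinFlow n) h := by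
  obtain ⟨Φ, hΦ, -, hcons⟩ := hloc
  intro I c L hI hconn hL hsol hper s hs t ht
  have hc : SmoothFam I fun t x => (c t).val x := hsol.1
  have hfl := integral_sub_of_flux hI hconn (spinPoly_smoothFam hI hc hh)
    (spinPoly_smoothFam hI hc hΦ) (fun t ht x => hcons I c hI hsol t ht x) hs ht 0 L
  -- The flux depends only on the jet of the curve, and the jets at 0 and at L agree by periodicity.
  have hz : ∀ τ ∈ uIcc s t, Φ (c τ) L - Φ (c τ) 0 = 0 := by
    intro τ hτ
    rw [sub_eq_zero]
    refine adjoin_eq_of_jets_eq ?_ hΦ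
    rintro _ ⟨k, i, rfl⟩
    have := iteratedDeriv_comp_add_const k (c τ).val L
    rw [funext (hper τ (hconn.uIcc_subset hs ht hτ))] at this
    have h0 := congrFun this 0
    rw [zero_add] at h0
    exact congrArg (coordL i) h0.symm
  rw [intervalIntegral.integral_congr hz] at hfl
  simp only [intervalIntegral.integral_zero] at hfl
  linarith

/-- Differential polynomials differ from their values on constant curves by a term that decays
with the derivatives of the curve. -/
lemma spinPoly_decay {K : Set ℝ} {c : ℝ → SpinCurve}
    (hdec : ∀ k : ℕ, 1 ≤ k → ∃ B : ℝ, ∀ t ∈ K, ∀ x,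
      ‖iteratedDeriv k (c t).val x‖ ≤ B / (1 + x ^ 2)) {G : SpinCurve → ℝ → ℝ}
    (hG : G ∈ spinPoly) : ∃ B : ℝ, 0 ≤ B ∧ ∀ t ∈ K, ∀ x,
      |G (c t) x - G (SpinCurve.const ((c t).val x) ((c t).2.2 x)) 0| ≤ B / (1 + x ^ 2) ∧
      |G (SpinCurve.const ((c t).val x) ((c t).2.2 x)) 0| ≤ B := by
  have hpos : ∀ x : ℝ, 0 < 1 + x ^ 2 := fun x => by positivity
  induction hG using Algebra.adjoin_induction with
  | mem g hg =>
    obtain ⟨k, i, rfl⟩ := hg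
    cases k with
    | zero =>
      refine ⟨1, zero_le_one, fun t _ x => ⟨?_, ?_⟩⟩
      · have : (iteratedDeriv 0 (c t).val x : E3) i
            - (iteratedDeriv 0 (SpinCurve.const ((c t).val x) ((c t).2.2 x)).val 0 : E3) i = 0 := by
          simp [SpinCurve.const, SpinCurve.val]
        rw [this, abs_zero]
        exact (div_pos one_pos (hpos x)).le
      · refine (abs_coord_le _ i).trans_eq ?_
        simpa using! (c t).2.2 x
    | succ k =>
      obtain ⟨B, hB⟩ := hdec (k + 1) (by omega)
      refine ⟨max B 0, le_max_right _ _, fun t ht x => ?_⟩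
      have h0 : (iteratedDeriv (k + 1)
          (SpinCurve.const ((c t).val x) ((c t).2.2 x)).val 0 : E3) i = 0 := by
        have : (SpinCurve.const ((c t).val x) ((c t).2.2 x)).val = fun _ => (c t).val x := rfl
        rw [this, iteratedDeriv_const, if_neg (by omega)]; rfl
      simp only [h0, sub_zero, abs_zero]
      refine ⟨(abs_coord_le _ i).trans ((hB t ht x).trans ?_), le_max_right _ _⟩
      exact div_le_div_of_nonneg_right (le_max_left _ _) (hpos x).le
  | algebraMap r =>
    refine ⟨|r|, abs_nonneg r, fun t _ x => ⟨?_, le_rfl⟩⟩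
    have : algebraMap ℝ (SpinCurve → ℝ → ℝ) r (c t) x - algebraMap ℝ (SpinCurve → ℝ → ℝ) r
        (SpinCurve.const ((c t).val x) ((c t).2.2 x)) 0 = 0 := sub_self r
    rw [this, abs_zero]
    exact div_nonneg (abs_nonneg r) (hpos x).le
  | add F G _ _ hF hG =>
    obtain ⟨B, hB, h1⟩ := hF
    obtain ⟨C, hC, h2⟩ := hG
    refine ⟨B + C, add_nonneg hB hC, fun t ht x => ⟨?_, ?_⟩⟩
    · rw [add_div]
      refine le_trans (le_of_eq ?_) ((abs_add_le _ _).trans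
        (add_le_add (h1 t ht x).1 (h2 t ht x).1))
      congr 1
      simp only [Pi.add_apply]; ring
    · exact (abs_add_le _ _).trans (add_le_add (h1 t ht x).2 (h2 t ht x).2)
  | mul F G _ _ hF hG =>
    obtain ⟨B, hB, h1⟩ := hF
    obtain ⟨C, hC, h2⟩ := hG
    refine ⟨3 * (B * C), by positivity, fun t ht x => ⟨?_, ?_⟩⟩
    · obtain ⟨p1, p2⟩ := h1 t ht x
      obtain ⟨q1, q2⟩ := h2 t ht x
      simp only [Pi.mul_apply]
      generalize F (c t) x = f at *
      generalize G (c t) x = g at *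
      generalize F (SpinCurve.const ((c t).val x) ((c t).2.2 x)) 0 = f0 at *
      generalize G (SpinCurve.const ((c t).val x) ((c t).2.2 x)) 0 = g0 at *
      -- Each of the three terms contains at least one decaying factor and is bounded by BC/(1 +
      -- x²). This accounts for the constant 3.
      have e : f * g - f0 * g0 = (f - f0) * (g - g0) + f0 * (g - g0) + (f - f0) * g0 := by ring
      have hle : C / (1 + x ^ 2) ≤ C := div_le_self hC (by nlinarith [sq_nonneg x])
      rw [e]
      refine (abs_add_three _ _ _).trans ?_
      rw [abs_mul, abs_mul, abs_mul]
      have b1 : |f - f0| * |g - g0| ≤ B / (1 + x ^ 2) * C :=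
        mul_le_mul p1 (q1.trans hle) (abs_nonneg _) (div_nonneg hB (hpos x).le)
      have b2 : |f0| * |g - g0| ≤ B * (C / (1 + x ^ 2)) :=
        mul_le_mul p2 q1 (abs_nonneg _) hB
      have b3 : |f - f0| * |g0| ≤ B / (1 + x ^ 2) * C :=
        mul_le_mul p1 q2 (abs_nonneg _) (div_nonneg hB (hpos x).le)
      refine (add_le_add (add_le_add b1 b2) b3).trans_eq ?_
      ring
    · simp only [Pi.mul_apply, abs_mul]
      have : B * C ≤ 3 * (B * C) := by nlinarith [mul_nonneg hB hC]
      exact (mul_le_mul (h1 t ht x).2 (h2 t ht x).2 (abs_nonneg _) hB).trans this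

lemma spinPoly_decay_of_const {K : Set ℝ} {c : ℝ → SpinCurve}
    (hdec : ∀ k : ℕ, 1 ≤ k → ∃ B : ℝ, ∀ t ∈ K, ∀ x,
      ‖iteratedDeriv k (c t).val x‖ ≤ B / (1 + x ^ 2)) {G : SpinCurve → ℝ → ℝ}
    (hG : G ∈ spinPoly) (h0 : ∀ S ∈ spinConst, G S = 0) :
    ∃ B : ℝ, 0 ≤ B ∧ ∀ t ∈ K, ∀ x, |G (c t) x| ≤ B / (1 + x ^ 2) := by
  obtain ⟨B, hB, h⟩ := spinPoly_decay hdec hG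
  refine ⟨B, hB, fun t ht x => ?_⟩
  have := (h t ht x).1
  rwa [h0 (SpinCurve.const ((c t).val x) ((c t).2.2 x)) (fun _ _ => rfl), Pi.zero_apply, sub_zero] at this

/-- Density and flux vanish on constant curves, so both decay like 1/(1 + x²) even though S itself
need not tend to a limit prescribed in advance. The change of the integral over [-R, R] is at most
2B|t - s|/(1 + R²). -/
lemma spin_isConservedOnLine {n : ℕ} {h : SpinCurve → ℝ → ℝ} (hh : h ∈ spinPoly)
    (h0 : ∀ S ∈ spinConst, h S = 0)
    (hloc : HasLocalConservationLaw spinPoly spinConst SpinCurve.val (spinFlow n) h) :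
    IsConservedOnLine SpinCurve.val (spinFlow n) h := by
  obtain ⟨Φ, hΦ, hΦ0, hcons⟩ := hloc
  intro I c hI hconn hsol hdec
  have hc : SmoothFam I fun t x => (c t).val x := hsol.1
  have hint : ∀ t ∈ I, MeasureTheory.Integrable (h (c t)) := by
    intro t ht
    obtain ⟨B, hB, hb⟩ := spinPoly_decay_of_const (hdec {t} (singleton_subset_iff.2 ht)
      isCompact_singleton) hh h0
    refine (integrable_inv_one_add_sq.const_mul B).mono'
      (isDiffRing_spin.contDiff _ hh _).continuous.aestronglyMeasurable
      (Eventually.of_forall fun x => ?_)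
    exact hb t rfl x
  refine ⟨hint, fun s hs t ht => ?_⟩
  have hsub : uIcc s t ⊆ I := hconn.uIcc_subset hs ht
  obtain ⟨B, hB, hb⟩ := spinPoly_decay_of_const (hdec (uIcc s t) hsub isCompact_uIcc) hΦ hΦ0
  have lim := (MeasureTheory.intervalIntegral_tendsto_integral (hint t ht) tendsto_neg_atTop_atBot
    tendsto_id).sub (MeasureTheory.intervalIntegral_tendsto_integral (hint s hs)
      tendsto_neg_atTop_atBot tendsto_id)
  have lim0 : Tendsto (fun R : ℝ => (∫ x in -R..id R, h (c t) x) - ∫ x in -R..id R, h (c s) x)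
      atTop (𝓝 0) := by
    have hden : Tendsto (fun R : ℝ => 1 + R ^ 2) atTop atTop :=
      tendsto_atTop_add_const_left _ _ (tendsto_pow_atTop two_ne_zero)
    refine squeeze_zero_norm (a := fun R => 2 * B / (1 + R ^ 2) * |t - s|) (fun R => ?_) ?_
    · rw [integral_sub_of_flux hI hconn (spinPoly_smoothFam hI hc hh)
        (spinPoly_smoothFam hI hc hΦ) (fun t ht x => hcons I c hI hsol t ht x) hs ht]
      refine intervalIntegral.norm_integral_le_of_norm_le_const fun τ hτ => ?_
      have hτ' := uIoc_subset_uIcc hτ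
      refine (norm_sub_le _ _).trans ?_
      have b1 := hb τ hτ' R
      have b2 := hb τ hτ' (-R)
      rw [neg_sq] at b2
      rw [Real.norm_eq_abs, Real.norm_eq_abs, two_mul, add_div]
      exact add_le_add b1 b2
    · have := (hden.const_div_atTop (2 * B)).mul_const |t - s|
      simpa using this
  have := tendsto_nhds_unique lim lim0
  linarith

lemma spinDensity_const_curve (m : ℕ) : ∀ S ∈ spinConst, spinDensity m S = 0 := by
  intro S hS
  funext x
  rw [spinDensity_eq]
  show -(1 / (1 + (m : ℝ))) * spinA (m + 1) S x = 0
  rw [spinA_const_curve hS]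
  simp

theorem spin_isConstantOfMotion (m n : ℕ) : IsConstantOfMotion spinPoly spinConst SpinCurve.val
    (spinFlow n) (spinDensity m) :=
  ⟨spin_localConservation m n,
    spin_isConservedOnCircle (spinDensity_mem m) (spin_localConservation m n),
    spin_isConservedOnLine (spinDensity_mem m) (spinDensity_const_curve m)
      (spin_localConservation m n)⟩

end Integrated

/-! ### Dynamical maps into the sphere -/

section Maps

/-- The map into the sphere that belongs to a spin vector. -/
noncomputable def SpinCurve.toMap (S : SpinCurve) : SphereCurve :=
  ⟨Set.codRestrict S.val (Metric.sphere (0 : E3) 1) fun x => mem_sphere_zero_iff_norm.2 (S.2.2 x),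
    ContMDiff.codRestrict_sphere (n := 2) S.2.1.contMDiff _⟩

lemma toSpin_bijective : Function.Bijective SphereCurve.toSpin := by
  refine ⟨fun γ γ' h => ?_, fun S => ⟨S.toMap, rfl⟩⟩
  apply Subtype.ext
  funext x
  apply Subtype.ext
  exact congrFun (congrArg SpinCurve.val h) x

lemma comp_toSpin_mem {G : SpinCurve → ℝ → ℝ} (hG : G ∈ spinPoly) :
    (fun γ : SphereCurve => G γ.toSpin) ∈ mapPoly := by
  induction hG using Algebra.adjoin_induction with
  | mem g hg =>
    obtain ⟨k, i, rfl⟩ := hg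
    exact Algebra.subset_adjoin ⟨k, i, rfl⟩
  | algebraMap r => exact Subalgebra.algebraMap_mem mapPoly r
  | add F G _ _ hF hG => exact add_mem hF hG
  | mul F G _ _ hF hG => exact mul_mem hF hG

lemma comp_toMap_mem {G : SphereCurve → ℝ → ℝ} (hG : G ∈ mapPoly) :
    (fun S : SpinCurve => G S.toMap) ∈ spinPoly := by
  induction hG using Algebra.adjoin_induction with
  | mem g hg =>
    obtain ⟨k, i, rfl⟩ := hg
    exact Algebra.subset_adjoin ⟨k, i, rfl⟩
  | algebraMap r => exact Subalgebra.algebraMap_mem spinPoly r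
  | add F G _ _ hF hG => exact add_mem hF hG
  | mul F G _ _ hF hG => exact mul_mem hF hG

lemma toMap_toSpin (γ : SphereCurve) : γ.toSpin.toMap = γ := toSpin_bijective.1 rfl

lemma isDiffRing_map : IsDiffRing mapPoly mapConst := by
  refine ⟨fun G hG γ => ?_, fun G hG h0 hD => ?_⟩
  · have := isDiffRing_spin.contDiff _ (comp_toMap_mem hG) γ.toSpin
    rwa [toMap_toSpin] at this
  · have := isDiffRing_spin.eq_zero _ (comp_toMap_mem hG)
      (fun S hS => h0 S.toMap fun x y => Subtype.ext (hS x y))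
      (by funext S x; exact congrFun (congrFun hD S.toMap) x)
    funext γ
    have h : G γ.toSpin.toMap = 0 := congrFun this γ.toSpin
    rwa [toMap_toSpin] at h

lemma IsDxInv.comp_toSpin {F G : SpinCurve → ℝ → ℝ} (h : IsDxInv spinPoly spinConst F G) :
    IsDxInv mapPoly mapConst (fun γ => F γ.toSpin) (fun γ => G γ.toSpin) :=
  ⟨comp_toSpin_mem h.1, funext fun γ => congrFun h.2.1 γ.toSpin,
    fun γ hγ => h.2.2 γ.toSpin fun x y => congrArg Subtype.val (hγ x y)⟩

lemma covDeriv_apply (F : SphereCurve → ℝ → E3) (γ : SphereCurve) (x : ℝ) :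
    covDeriv F γ x = deriv (F γ) x - (inner ℝ (γ.val x) (deriv (F γ) x) : ℝ) • γ.val x := by
  have hn : ‖γ.val x‖ = 1 := γ.toSpin.2.2 x
  rw [covDeriv, Submodule.starProjection_orthogonal_val, Submodule.starProjection_unit_singleton ℝ hn]
  rfl

/-- The projection in the covariant derivative removes only a multiple of γ, which the cross product
with γ kills. This is why J∇_x and S ∧ D_x are the same operator. -/
lemma opJ_covDeriv (F : SphereCurve → ℝ → E3) (γ : SphereCurve) (x : ℝ) :
    opJ (covDeriv F) γ x = cross (γ.val x) (deriv (F γ) x) := by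
  rw [opJ, covDeriv_apply, cross_sub_right, cross_smul_right, cross_self', smul_zero, sub_zero]

lemma mapOp_comp (f : SpinCurve → ℝ → E3) {G : SpinCurve → ℝ → ℝ}
    (h : IsDxInv spinPoly spinConst (spinPairing f) G) :
    mapOp (fun γ => f γ.toSpin) = fun γ => spinOp f γ.toSpin := by
  have hm : mapInv (metric (opJ tangent) fun γ => f γ.toSpin) = fun γ => G γ.toSpin :=
    isDiffRing_map.DxInv_eq h.comp_toSpin
  have hs : spinInv (spinPairing f) = G := isDiffRing_spin.DxInv_eq h
  funext γ x
  rw [mapOp, opJ_covDeriv, hm, spinOp, hs]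
  rfl

lemma mapFlow_eq (n : ℕ) : mapFlow n = fun γ => spinFlow n γ.toSpin := by
  induction n with
  | zero => rfl
  | succ n ih =>
    rw [mapFlow, Function.iterate_succ_apply', ← mapFlow, ih, mapOp_comp _ (spinPairing_isDxInv n)]
    have e : spinFlow (n + 1) = spinOp (spinFlow n) := Function.iterate_succ_apply' _ _ _
    rw [e]

lemma mapPairing_isDxInv (n : ℕ) : IsDxInv mapPoly mapConst (metric (opJ tangent) (mapFlow n))
    (fun γ => (-spinA n) γ.toSpin) := by
  rw [mapFlow_eq]
  exact (spinPairing_isDxInv n).comp_toSpin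

lemma mapPre_eq (n : ℕ) :
    metric tangent (covDeriv (mapFlow n)) = fun γ => spinPre n γ.toSpin := by
  funext γ x
  have h : inner ℝ (deriv γ.val x) (γ.val x) = (0 : ℝ) := by
    rw [real_inner_comm]; exact spin_inner_deriv γ.toSpin x
  rw [metric, covDeriv_apply, inner_sub_right, inner_smul_right, tangent, h, mul_zero, sub_zero,
    mapFlow_eq]
  rfl

lemma mapPre_isDxInv (n : ℕ) : IsDxInv mapPoly mapConst (metric tangent (covDeriv (mapFlow n)))
    (fun γ => (-spinA (n + 1)) γ.toSpin) := by
  rw [mapPre_eq]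
  exact (spinPre_isDxInv n).comp_toSpin

lemma mapDensity_eq (n : ℕ) : mapDensity n = fun γ => spinDensity n γ.toSpin := by
  funext γ x
  rw [mapDensity, mapInv, isDiffRing_map.DxInv_eq (mapPre_isDxInv n), spinDensity, spinInv,
    isDiffRing_spin.DxInv_eq (spinPre_isDxInv n)]

lemma mapFlow_one (γ : SphereCurve) (x : ℝ) : mapFlow 1 γ x = opJ (covDeriv tangent) γ x := by
  rw [mapFlow_eq, opJ_covDeriv]
  show spinFlow 1 γ.toSpin x = _
  rw [spinFlow_one, iteratedDeriv_succ, iteratedDeriv_one]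
  rfl

/-- `J` squares to `-1` on tangent vectors. -/
lemma cross_cross_orth {s v : E3} (hs : inner ℝ s s = (1 : ℝ)) (hv : inner ℝ s v = (0 : ℝ)) :
    cross s (cross s v) = -v := by
  rw [cross_cross_right, hv, hs]; simp

/-- A tangent vector field along curves in the sphere, with smooth dependence on `x`. -/
structure IsTangentField (F : SphereCurve → ℝ → E3) : Prop where
  contDiff : ∀ γ, ContDiff ℝ ∞ (F γ)
  orth : ∀ γ x, inner ℝ (SphereCurve.val γ x) (F γ x) = (0 : ℝ)

lemma map_hasDerivAt (γ : SphereCurve) (x : ℝ) : HasDerivAt γ.val (deriv γ.val x) x :=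
  spin_hasDerivAt γ.toSpin x

lemma map_inner_self (γ : SphereCurve) (x : ℝ) : inner ℝ (γ.val x) (γ.val x) = (1 : ℝ) :=
  spin_inner_self γ.toSpin x

variable {F G : SphereCurve → ℝ → E3}

lemma IsTangentField.hasDerivAt (hF : IsTangentField F) (γ : SphereCurve) (x : ℝ) :
    HasDerivAt (F γ) (deriv (F γ) x) x :=
  ((hF.contDiff γ).differentiable (by simp) x).hasDerivAt

lemma isTangentField_tangent : IsTangentField tangent :=
  ⟨fun γ => ContDiff.iterate_deriv 1 γ.toSpin.2.1, fun γ x => spin_inner_deriv γ.toSpin x⟩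

lemma IsTangentField.covDeriv (hF : IsTangentField F) : IsTangentField (covDeriv F) := by
  refine ⟨fun γ => ?_, fun γ x => ?_⟩
  · rw [funext (covDeriv_apply F γ)]
    have h1 : ContDiff ℝ ∞ (deriv (F γ)) := ContDiff.iterate_deriv 1 (hF.contDiff γ)
    have h2 : ContDiff ℝ ∞ γ.val := γ.toSpin.2.1
    exact h1.sub ((h2.inner ℝ h1).smul h2)
  · rw [covDeriv_apply, inner_sub_right, inner_smul_right, map_inner_self]
    ring

lemma IsTangentField.opJ (hF : IsTangentField F) : IsTangentField (opJ F) :=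
  ⟨fun γ => contDiff_cross γ.toSpin.2.1 (hF.contDiff γ), fun _ _ => inner_cross_left _ _⟩

lemma opJ_opJ (hF : IsTangentField F) : opJ (opJ F) = fun γ x => -F γ x := by
  funext γ x
  exact cross_cross_orth (map_inner_self γ x) (hF.orth γ x)

/-- The complex structure is parallel: γ_x and F are both tangent, so the extra term γ_x ∧ F is
normal and is projected away. -/
lemma covDeriv_opJ (hF : IsTangentField F) : covDeriv (opJ F) = opJ (covDeriv F) := by
  funext γ x
  have hd : deriv (opJ F γ) x = cross (deriv γ.val x) (F γ x) + cross (γ.val x) (deriv (F γ) x) :=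
    (hasDerivAt_cross (map_hasDerivAt γ x) (hF.hasDerivAt γ x)).deriv
  have hc : cross (deriv γ.val x) (F γ x)
      = (inner ℝ (γ.val x) (cross (deriv γ.val x) (F γ x)) : ℝ) • γ.val x :=
    cross_eq_smul_of_orth (map_inner_self γ x) (spin_inner_deriv γ.toSpin x) (hF.orth γ x)
  rw [covDeriv_apply, opJ_covDeriv, hd, hc, inner_add_right, inner_cross_left, inner_smul_right, map_inner_self]
  module

lemma metric_hasDerivAt (hF : IsTangentField F) (hG : IsTangentField G) (γ : SphereCurve) (x : ℝ) :
    HasDerivAt (metric F G γ) (metric (covDeriv F) G γ x + metric F (covDeriv G) γ x) x := by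
  have h := (hF.hasDerivAt γ x).inner ℝ (hG.hasDerivAt γ x)
  convert! h using 1
  rw [metric, metric, covDeriv_apply, covDeriv_apply, inner_sub_left, inner_sub_right,
    inner_smul_left, inner_smul_right, hG.orth, real_inner_comm (γ.val x) (F γ x), hF.orth]
  simp [add_comm]

lemma mapFlow_two (γ : SphereCurve) (x : ℝ) :
    mapFlow 2 γ x = -(covDeriv (covDeriv tangent) γ x +
      ((1 / 2 : ℝ) * metric tangent tangent γ x) • tangent γ x) := by
  have h1 : mapFlow 1 = opJ (covDeriv tangent) := funext fun γ => funext (mapFlow_one γ)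
  have h2 : mapFlow 2 γ x = opJ (covDeriv (mapFlow 1)) γ x
      + spinA 1 γ.toSpin x • tangent γ x := by
    rw [mapFlow_eq, opJ_covDeriv, mapFlow_eq]
    show spinFlow 2 γ.toSpin x = cross (γ.val x) (deriv (spinFlow 1 γ.toSpin) x) + _
    rw [spinFlow_apply, spinV_succ_deriv, spinFlow_eq]
    rfl
  have h3 := isTangentField_tangent
  rw [h2, h1, covDeriv_opJ h3.covDeriv, opJ_opJ h3.covDeriv.covDeriv, spinA_one]
  show _ + (-(1 / 2) * metric tangent tangent γ x) • tangent γ x = _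
  module

lemma map_isSolution_iff (n : ℕ) (I : Set ℝ) (γ : ℝ → SphereCurve) :
    IsSolution SphereCurve.val (mapFlow n) I γ ↔
      IsSolution SpinCurve.val (spinFlow n) I (fun t => (γ t).toSpin) := by
  rw [mapFlow_eq]; rfl

theorem map_isConstantOfMotion (m n : ℕ) : IsConstantOfMotion mapPoly mapConst SphereCurve.val
    (mapFlow n) (mapDensity m) := by
  obtain ⟨⟨Φ, h1, h2, h3⟩, hcirc, hline⟩ := spin_isConstantOfMotion m n
  rw [mapDensity_eq]
  refine ⟨⟨fun γ => Φ γ.toSpin, comp_toSpin_mem h1, fun γ hγ => h2 γ.toSpin fun x y =>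
    congrArg Subtype.val (hγ x y), fun I c hI hsol => ?_⟩, ?_, ?_⟩
  · exact h3 I (fun t => (c t).toSpin) hI ((map_isSolution_iff n I c).1 hsol)
  · intro I c L hI hconn hL hsol
    exact hcirc I (fun t => (c t).toSpin) L hI hconn hL ((map_isSolution_iff n I c).1 hsol)
  · intro I c hI hconn hsol
    exact hline I (fun t => (c t).toSpin) hI hconn ((map_isSolution_iff n I c).1 hsol)

end Maps

/-! ### The densities as polynomials in inner products -/

section MapScalars

lemma isTangentField_iterate (k : ℕ) : IsTangentField (covDeriv^[k] tangent) := by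
  induction k with
  | zero => exact isTangentField_tangent
  | succ k ih => rw [Function.iterate_succ_apply']; exact ih.covDeriv

/-- The vector fields whose inner products generate `mapScalars`. -/
abbrev mapFrames : Set (SphereCurve → ℝ → E3) :=
  {T | ∃ k : ℕ, T = covDeriv^[k] tangent ∨ T = opJ (covDeriv^[k] tangent)}

lemma mapFrames_tangent {A : SphereCurve → ℝ → E3} (hA : A ∈ mapFrames) : IsTangentField A := by
  obtain ⟨k, rfl | rfl⟩ := hA
  · exact isTangentField_iterate k
  · exact (isTangentField_iterate k).opJ

lemma mapFrames_covDeriv {A : SphereCurve → ℝ → E3} (hA : A ∈ mapFrames) :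
    covDeriv A ∈ mapFrames := by
  obtain ⟨k, rfl | rfl⟩ := hA
  · exact ⟨k + 1, Or.inl (Function.iterate_succ_apply' _ _ _).symm⟩
  · refine ⟨k + 1, Or.inr ?_⟩
    rw [covDeriv_opJ (isTangentField_iterate k), Function.iterate_succ_apply']

lemma metric_mem {A B : SphereCurve → ℝ → E3} (hA : A ∈ mapFrames) (hB : B ∈ mapFrames) :
    metric A B ∈ mapScalars := Algebra.subset_adjoin ⟨A, hA, B, hB, rfl⟩

lemma metric_contDiff {A B : SphereCurve → ℝ → E3} (hA : IsTangentField A) (hB : IsTangentField B)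
    (γ : SphereCurve) : ContDiff ℝ ∞ (metric A B γ) :=
  (hA.contDiff γ).inner ℝ (hB.contDiff γ)

lemma mapScalars_gen_contDiff : ∀ g ∈ {F | ∃ A ∈ mapFrames, ∃ B ∈ mapFrames, F = metric A B},
    ∀ γ, ContDiff ℝ ∞ (g γ) := by
  rintro _ ⟨A, hA, B, hB, rfl⟩ γ
  exact metric_contDiff (mapFrames_tangent hA) (mapFrames_tangent hB) γ

lemma mapScalars_contDiff {a : SphereCurve → ℝ → ℝ} (ha : a ∈ mapScalars) (γ : SphereCurve) :
    ContDiff ℝ ∞ (a γ) := adjoin_contDiff mapScalars_gen_contDiff ha γ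

lemma mapScalars_Dx {a : SphereCurve → ℝ → ℝ} (ha : a ∈ mapScalars) : Dx a ∈ mapScalars := by
  refine adjoin_Dx_mem mapScalars_gen_contDiff ?_ ha
  rintro _ ⟨A, hA, B, hB, rfl⟩
  have : Dx (metric A B) = metric (covDeriv A) B + metric A (covDeriv B) := by
    funext γ x
    exact (metric_hasDerivAt (mapFrames_tangent hA) (mapFrames_tangent hB) γ x).deriv
  rw [this]
  exact add_mem (metric_mem (mapFrames_covDeriv hA) hB) (metric_mem hA (mapFrames_covDeriv hB))

/-- Combinations of `∇ₓᵏ γₓ` and `J ∇ₓᵏ γₓ` with coefficients in `mapScalars`. -/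
inductive IsMapVec : (SphereCurve → ℝ → E3) → Prop
  | frame {A} : A ∈ mapFrames → IsMapVec A
  | add {F G} : IsMapVec F → IsMapVec G → IsMapVec fun γ x => F γ x + G γ x
  | smul {a F} : a ∈ mapScalars → IsMapVec F → IsMapVec fun γ x => a γ x • F γ x

variable {F G : SphereCurve → ℝ → E3}

lemma IsMapVec.isTangentField (hF : IsMapVec F) : IsTangentField F := by
  induction hF with
  | frame hA => exact mapFrames_tangent hA
  | add _ _ hF hG =>
    exact ⟨fun γ => (hF.contDiff γ).add (hG.contDiff γ), fun γ x => by
      rw [inner_add_right, hF.orth, hG.orth, add_zero]⟩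
  | smul ha _ hF =>
    exact ⟨fun γ => (mapScalars_contDiff ha γ).smul (hF.contDiff γ), fun γ x => by
      rw [inner_smul_right, hF.orth, mul_zero]⟩

lemma IsMapVec.metric_mem (hF : IsMapVec F) (hG : IsMapVec G) : metric F G ∈ mapScalars := by
  induction hF with
  | @frame A hA =>
    induction hG with
    | frame hB => exact SpinHierarchy.metric_mem hA hB
    | @add F G _ _ hF hG =>
      have : metric A (fun γ x => F γ x + G γ x) = metric A F + metric A G := by
        funext γ x; exact inner_add_right _ _ _
      rw [this]; exact add_mem hF hG
    | @smul a F ha _ hF =>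
      have : metric A (fun γ x => a γ x • F γ x) = a * metric A F := by
        funext γ x; exact inner_smul_right _ _ _
      rw [this]; exact mul_mem ha hF
  | @add F H _ _ hF hH =>
    have : metric (fun γ x => F γ x + H γ x) G = metric F G + metric H G := by
      funext γ x; exact inner_add_left _ _ _
    rw [this]; exact add_mem hF hH
  | @smul a F ha _ hF =>
    have : metric (fun γ x => a γ x • F γ x) G = a * metric F G := by
      funext γ x; exact real_inner_smul_left _ _ _
    rw [this]; exact mul_mem ha hF

lemma IsMapVec.covDeriv (hF : IsMapVec F) : IsMapVec (covDeriv F) := by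
  induction hF with
  | frame hA => exact .frame (mapFrames_covDeriv hA)
  | @add F G hF hG ihF ihG =>
    have : SpinHierarchy.covDeriv (fun γ x => F γ x + G γ x)
        = fun γ x => SpinHierarchy.covDeriv F γ x + SpinHierarchy.covDeriv G γ x := by
      funext γ x
      have hd : deriv (fun x => F γ x + G γ x) x = deriv (F γ) x + deriv (G γ) x :=
        ((hF.isTangentField.hasDerivAt γ x).fun_add (hG.isTangentField.hasDerivAt γ x)).deriv
      rw [covDeriv_apply, covDeriv_apply, covDeriv_apply, hd, inner_add_right]
      module
    rw [this]; exact .add ihF ihG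
  | @smul a F ha hF ih =>
    have : SpinHierarchy.covDeriv (fun γ x => a γ x • F γ x)
        = fun γ x => a γ x • SpinHierarchy.covDeriv F γ x + Dx a γ x • F γ x := by
      funext γ x
      have hd : deriv (fun x => a γ x • F γ x) x = a γ x • deriv (F γ) x + Dx a γ x • F γ x :=
        ((((mapScalars_contDiff ha γ).differentiable (by simp) x).hasDerivAt).fun_smul
          (hF.isTangentField.hasDerivAt γ x)).deriv
      rw [covDeriv_apply, covDeriv_apply, hd, inner_add_right, inner_smul_right, inner_smul_right,
        hF.isTangentField.orth]
      module
    rw [this]; exact .add (.smul ha ih) (.smul (mapScalars_Dx ha) hF)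

lemma IsMapVec.opJ (hF : IsMapVec F) : IsMapVec (opJ F) := by
  induction hF with
  | frame hA =>
    obtain ⟨k, rfl | rfl⟩ := hA
    · exact .frame ⟨k, Or.inr rfl⟩
    · have h1 : (fun _ _ => -1 : SphereCurve → ℝ → ℝ) ∈ mapScalars :=
        Subalgebra.algebraMap_mem mapScalars (-1)
      have := IsMapVec.smul h1 (.frame ⟨k, Or.inl rfl⟩)
      rw [opJ_opJ (isTangentField_iterate k)]
      simpa using! this
  | @add F G _ _ hF hG =>
    have : SpinHierarchy.opJ (fun γ x => F γ x + G γ x)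
        = fun γ x => SpinHierarchy.opJ F γ x + SpinHierarchy.opJ G γ x := by
      funext γ x; exact cross_add_right _ _ _
    rw [this]; exact .add hF hG
  | @smul a F ha _ hF =>
    have : SpinHierarchy.opJ (fun γ x => a γ x • F γ x)
        = fun γ x => a γ x • SpinHierarchy.opJ F γ x := by
      funext γ x; exact cross_smul_right _ _ _
    rw [this]; exact .smul ha hF

/-- Split Vⱼ₊₁ into S ∧ f⁽ʲ⁾ and aⱼ S. The product with S is an isometry of the tangent plane, so aₙ
is expressed by lower aⱼ and inner products of tangent fields only. -/
lemma spinA_eq_flows (n : ℕ) (S : SpinCurve) (x : ℝ) : spinA n S x = -(1 / 2) *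
    ∑ j ∈ Finset.range n, (spinA j S x * spinA (n - 1 - j) S x
      + inner ℝ (spinFlow j S x) (spinFlow (n - 1 - j) S x)) := by
  rw [spinA]
  congr 1
  refine Finset.sum_congr rfl fun j hj => ?_
  have hj' := Finset.mem_range.1 hj
  rw [show n - j = n - 1 - j + 1 by omega, spinV_succ, spinV_succ, ← spinFlow_apply,
    ← spinFlow_apply, inner_add_left, inner_add_right, inner_add_right, inner_smul_left,
    inner_smul_left, inner_smul_right, inner_smul_right, inner_cross_left, spin_inner_self,
    real_inner_comm (S.val x) (cross _ _), inner_cross_left, inner_cross_cross, spin_inner_self,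
    spinFlow_orth]
  simp only [conj_trivial]
  ring

lemma mapFlow_succ (n : ℕ) : mapFlow (n + 1) = fun γ x => opJ (covDeriv (mapFlow n)) γ x
    + spinA n γ.toSpin x • tangent γ x := by
  funext γ x
  rw [mapFlow_eq, opJ_covDeriv, mapFlow_eq]
  show spinFlow (n + 1) γ.toSpin x = cross (γ.val x) (deriv (spinFlow n γ.toSpin) x) + _
  rw [spinFlow_apply, spinV_succ_deriv, spinFlow_eq]
  rfl

/-- The two claims feed each other: aₙ needs inner products of lower flows, and the next flow needs
aₙ as a coefficient. No inverse derivative has to be examined within the smaller algebra. -/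
lemma mapFlow_mapVec (n : ℕ) :
    (fun γ : SphereCurve => spinA n γ.toSpin) ∈ mapScalars ∧ IsMapVec (mapFlow n) := by
  induction n using Nat.strong_induction_on with
  | _ n ih =>
    constructor
    · have : (fun γ : SphereCurve => spinA n γ.toSpin) = (-(1 / 2) : ℝ) •
          ∑ j ∈ Finset.range n, ((fun γ : SphereCurve => spinA j γ.toSpin)
            * (fun γ : SphereCurve => spinA (n - 1 - j) γ.toSpin)
            + metric (mapFlow j) (mapFlow (n - 1 - j))) := by
        funext γ x
        rw [spinA_eq_flows]
        simp [metric, mapFlow_eq]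
      rw [this]
      refine Subalgebra.smul_mem _ (sum_mem fun j hj => ?_) _
      have hj' := Finset.mem_range.1 hj
      exact add_mem (mul_mem (ih j hj').1 (ih (n - 1 - j) (by omega)).1)
        ((ih j hj').2.metric_mem (ih (n - 1 - j) (by omega)).2)
    · cases n with
      | zero => exact .frame ⟨0, Or.inl rfl⟩
      | succ n =>
        rw [mapFlow_succ]
        exact .add (ih n (by omega)).2.covDeriv.opJ
          (.smul (ih n (by omega)).1 (.frame ⟨0, Or.inl rfl⟩))

lemma mapDensity_mem (n : ℕ) : mapDensity n ∈ mapScalars := by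
  have : mapDensity n
      = (-(1 / (1 + (n : ℝ)))) • fun γ : SphereCurve => spinA (n + 1) γ.toSpin := by
    rw [mapDensity_eq, spinDensity_eq]; rfl
  rw [this]
  exact Subalgebra.smul_mem _ (mapFlow_mapVec (n + 1)).1 _

end MapScalars

section SpinScalars

/-! #### Dot and triple products of the jets of `S` -/

lemma inner_jet_mem (i j : ℕ) : (fun (S : SpinCurve) x =>
    (inner ℝ (iteratedDeriv i S.val x) (iteratedDeriv j S.val x) : ℝ)) ∈ spinScalars :=
  Algebra.subset_adjoin (Or.inl ⟨i, j, rfl⟩)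

lemma triple_jet_mem (i j k : ℕ) : (fun (S : SpinCurve) x =>
    (inner ℝ (iteratedDeriv i S.val x)
      (cross (iteratedDeriv j S.val x) (iteratedDeriv k S.val x)) : ℝ)) ∈ spinScalars :=
  Algebra.subset_adjoin (Or.inr ⟨i, j, k, rfl⟩)

lemma spinScalars_le : spinScalars ≤ spinPoly := by
  refine Algebra.adjoin_le ?_
  rintro _ (⟨i, j, rfl⟩ | ⟨i, j, k, rfl⟩)
  · exact (isPolyVec_jet i).inner (isPolyVec_jet j)
  · exact (isPolyVec_jet i).inner ((isPolyVec_jet j).cross (isPolyVec_jet k))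

lemma spinScalars_Dx {a : SpinCurve → ℝ → ℝ} (ha : a ∈ spinScalars) : Dx a ∈ spinScalars := by
  refine adjoin_Dx_mem (fun g hg S =>
    isDiffRing_spin.contDiff _ (spinScalars_le (Algebra.subset_adjoin hg)) S) ?_ ha
  rintro _ (⟨i, j, rfl⟩ | ⟨i, j, k, rfl⟩)
  · have : (Dx fun (S : SpinCurve) x =>
        (inner ℝ (iteratedDeriv i S.val x) (iteratedDeriv j S.val x) : ℝ))
        = (fun (S : SpinCurve) x =>
          (inner ℝ (iteratedDeriv i S.val x) (iteratedDeriv (j + 1) S.val x) : ℝ))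
        + fun (S : SpinCurve) x =>
          (inner ℝ (iteratedDeriv (i + 1) S.val x) (iteratedDeriv j S.val x) : ℝ) := by
      funext S x
      exact ((spin_jet_hasDerivAt S i x).inner ℝ (spin_jet_hasDerivAt S j x)).deriv
    rw [this]
    exact add_mem (inner_jet_mem _ _) (inner_jet_mem _ _)
  · have : (Dx fun (S : SpinCurve) x => (inner ℝ (iteratedDeriv i S.val x)
        (cross (iteratedDeriv j S.val x) (iteratedDeriv k S.val x)) : ℝ))
        = ((fun (S : SpinCurve) x => (inner ℝ (iteratedDeriv i S.val x)
          (cross (iteratedDeriv (j + 1) S.val x) (iteratedDeriv k S.val x)) : ℝ))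
        + fun (S : SpinCurve) x => (inner ℝ (iteratedDeriv i S.val x)
          (cross (iteratedDeriv j S.val x) (iteratedDeriv (k + 1) S.val x)) : ℝ))
        + fun (S : SpinCurve) x => (inner ℝ (iteratedDeriv (i + 1) S.val x)
          (cross (iteratedDeriv j S.val x) (iteratedDeriv k S.val x)) : ℝ) := by
      funext S x
      have := ((spin_jet_hasDerivAt S i x).inner ℝ
        (hasDerivAt_cross (spin_jet_hasDerivAt S j x) (spin_jet_hasDerivAt S k x))).deriv
      rw [inner_add_right] at this
      exact this
    rw [this]
    exact add_mem (add_mem (triple_jet_mem _ _ _) (triple_jet_mem _ _ _)) (triple_jet_mem _ _ _)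

/-- Combinations of the jets of `S` with coefficients in `spinScalars`. -/
inductive IsJetVec : (SpinCurve → ℝ → E3) → Prop
  | jet (k : ℕ) : IsJetVec fun S x => iteratedDeriv k S.val x
  | add {F G} : IsJetVec F → IsJetVec G → IsJetVec fun S x => F S x + G S x
  | smul {a F} : a ∈ spinScalars → IsJetVec F → IsJetVec fun S x => a S x • F S x

variable {F G : SpinCurve → ℝ → E3}

lemma IsJetVec.isPolyVec (hF : IsJetVec F) : IsPolyVec F := by
  induction hF with
  | jet k => exact isPolyVec_jet k
  | add _ _ hF hG => exact hF.add hG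
  | smul ha _ hF => exact hF.smul (spinScalars_le ha)

lemma isJetVec_val : IsJetVec fun S x => S.val x := by
  simpa using! IsJetVec.jet 0

lemma IsJetVec.deriv (hF : IsJetVec F) : IsJetVec fun S x => deriv (F S) x := by
  induction hF with
  | jet k =>
    have := IsJetVec.jet (k + 1)
    simpa only [iteratedDeriv_succ] using this
  | @add F G hF hG ihF ihG =>
    have : (fun (S : SpinCurve) x => _root_.deriv (fun x => F S x + G S x) x)
        = fun S x => _root_.deriv (F S) x + _root_.deriv (G S) x := by
      funext S x
      exact ((hF.isPolyVec.hasDerivAt S x).fun_add (hG.isPolyVec.hasDerivAt S x)).deriv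
    rw [this]; exact .add ihF ihG
  | @smul a F ha hF ih =>
    have : (fun (S : SpinCurve) x => _root_.deriv (fun x => a S x • F S x) x)
        = fun S x => a S x • _root_.deriv (F S) x + Dx a S x • F S x := by
      funext S x
      exact (((isDiffRing_spin.contDiff _ (spinScalars_le ha) S).differentiable
        (by simp) x).hasDerivAt.fun_smul (hF.isPolyVec.hasDerivAt S x)).deriv
    rw [this]; exact .add (.smul ha ih) (.smul (spinScalars_Dx ha) hF)

/-- A pairing that is bilinear and maps jets to scalars maps all combinations to scalars. -/
lemma IsJetVec.pairing_mem {L : (SpinCurve → ℝ → E3 →L[ℝ] E3 →L[ℝ] ℝ)}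
    (hL : ∀ i j : ℕ, (fun (S : SpinCurve) x =>
      L S x (iteratedDeriv i S.val x) (iteratedDeriv j S.val x)) ∈ spinScalars)
    (hF : IsJetVec F) (hG : IsJetVec G) : (fun S x => L S x (F S x) (G S x)) ∈ spinScalars := by
  induction hF with
  | jet i =>
    induction hG with
    | jet j => exact hL i j
    | @add F G _ _ hF hG =>
      simp only [map_add]
      exact add_mem hF hG
    | @smul a F ha _ hF =>
      simp only [map_smul, smul_eq_mul]
      exact mul_mem ha hF
  | @add F H _ _ hF hH =>
    simp only [map_add, _root_.add_apply]
    exact add_mem hF hH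
  | @smul a F ha _ hF =>
    simp only [map_smul, _root_.smul_apply, smul_eq_mul]
    exact mul_mem ha hF

lemma IsJetVec.inner_mem (hF : IsJetVec F) (hG : IsJetVec G) :
    (fun S x => (inner ℝ (F S x) (G S x) : ℝ)) ∈ spinScalars :=
  hF.pairing_mem (L := fun _ _ => innerSL ℝ) inner_jet_mem hG

lemma IsJetVec.inner_cross_mem (hF : IsJetVec F) (hG : IsJetVec G) :
    (fun (S : SpinCurve) x => (inner ℝ (F S x) (cross (S.val x) (G S x)) : ℝ)) ∈ spinScalars := by
  have h := hF.pairing_mem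
    (L := fun S x => (ContinuousLinearMap.compL ℝ E3 E3 ℝ).flip (crossL (S.val x)) ∘L innerSL ℝ)
    (fun i j => by simpa using! triple_jet_mem i 0 j) hG
  simpa using! h

lemma iterate_covDeriv_isJetVec (k : ℕ) :
    IsJetVec fun S x => covDeriv^[k] tangent S.toMap x := by
  induction k with
  | zero => simpa using! IsJetVec.jet 1
  | succ k ih =>
    have : (fun (S : SpinCurve) x => covDeriv^[k + 1] tangent S.toMap x)
        = fun S x => deriv (fun x => covDeriv^[k] tangent S.toMap x) x
          + (((-1 : ℝ) • fun (S : SpinCurve) x => (inner ℝ (S.val x)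
            (deriv (fun x => covDeriv^[k] tangent S.toMap x) x) : ℝ)) S x) • S.val x := by
      funext S x
      rw [Function.iterate_succ_apply', covDeriv_apply]
      simp only [Pi.smul_apply, smul_eq_mul, neg_one_mul, neg_smul, ← sub_eq_add_neg]
      rfl
    rw [this]
    exact .add ih.deriv (.smul (Subalgebra.smul_mem _ (isJetVec_val.inner_mem ih.deriv) _)
      isJetVec_val)

lemma mapScalars_comp_toMap {a : SphereCurve → ℝ → ℝ} (ha : a ∈ mapScalars) :
    (fun S : SpinCurve => a S.toMap) ∈ spinScalars := by
  induction ha using Algebra.adjoin_induction with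
  | mem g hg =>
    obtain ⟨A, ⟨k, hA⟩, B, ⟨l, hB⟩, rfl⟩ := hg
    have hk := iterate_covDeriv_isJetVec k
    have hl := iterate_covDeriv_isJetVec l
    rcases hA with rfl | rfl <;> rcases hB with rfl | rfl
    · exact hk.inner_mem hl
    · exact hk.inner_cross_mem hl
    · convert! hl.inner_cross_mem hk using 1
      funext S x
      exact real_inner_comm _ _
    -- Lagrange's identity for (S ∧ A)·(S ∧ B); the factor S·S is kept as a generator.
    · have := sub_mem (mul_mem (inner_jet_mem 0 0) (hk.inner_mem hl))
        (mul_mem (isJetVec_val.inner_mem hl) (isJetVec_val.inner_mem hk))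
      convert! this using 1
      funext S x
      show inner ℝ (cross (S.val x) _) (cross (S.val x) _) = _
      rw [inner_cross_cross, real_inner_comm (S.val x) (covDeriv^[k] tangent S.toMap x)]
      simp [iteratedDeriv_zero]
  | algebraMap r => exact Subalgebra.algebraMap_mem spinScalars r
  | add F G _ _ hF hG => exact add_mem hF hG
  | mul F G _ _ hF hG => exact mul_mem hF hG

lemma spinDensity_mem_scalars (n : ℕ) : spinDensity n ∈ spinScalars := by
  have := mapScalars_comp_toMap (mapDensity_mem n)
  rw [mapDensity_eq] at this
  exact this

end SpinScalars

/-! ### Differential polynomials in `u` -/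

section WavePoly

lemma wave_jet_contDiff (u : Wave) (k : ℕ) : ContDiff ℝ ∞ (iteratedDeriv k u.val) := by
  induction k with
  | zero => simpa using! u.2
  | succ k ih =>
    rw [iteratedDeriv_succ]
    exact ContDiff.iterate_deriv 1 ih

lemma hasDerivAt_re {f : ℝ → ℂ} {f' : ℂ} {x : ℝ} (h : HasDerivAt f f' x) :
    HasDerivAt (fun y => (f y).re) f'.re x :=
  Complex.reCLM.hasFDerivAt.comp_hasDerivAt x h

lemma hasDerivAt_im {f : ℝ → ℂ} {f' : ℂ} {x : ℝ} (h : HasDerivAt f f' x) :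
    HasDerivAt (fun y => (f y).im) f'.im x :=
  Complex.imCLM.hasFDerivAt.comp_hasDerivAt x h

lemma hasDerivAt_of_re_im {f : ℝ → ℂ} {f' : ℂ} {x : ℝ} (h1 : HasDerivAt (fun y => (f y).re) f'.re x)
    (h2 : HasDerivAt (fun y => (f y).im) f'.im x) : HasDerivAt f f' x := by
  have := h1.ofReal_comp.add (h2.ofReal_comp.mul_const Complex.I)
  convert! this using 1
  · funext y; exact (Complex.re_add_im _).symm
  · exact (Complex.re_add_im _).symm

lemma wave_gen_contDiff : ∀ g ∈ ({F | ∃ k : ℕ, F = fun u x => (iteratedDeriv k u.val x).re} ∪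
    {F | ∃ k : ℕ, F = fun u x => (iteratedDeriv k u.val x).im} : Set (Wave → ℝ → ℝ)),
    ∀ u, ContDiff ℝ ∞ (g u) := by
  rintro _ (⟨k, rfl⟩ | ⟨k, rfl⟩) u
  · exact Complex.reCLM.contDiff.comp (wave_jet_contDiff u k)
  · exact Complex.imCLM.contDiff.comp (wave_jet_contDiff u k)

lemma wavePoly_Dx {G : Wave → ℝ → ℝ} (hG : G ∈ wavePoly) : Dx G ∈ wavePoly := by
  refine adjoin_Dx_mem wave_gen_contDiff ?_ hG
  rintro _ (⟨k, rfl⟩ | ⟨k, rfl⟩)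
  · refine Algebra.subset_adjoin (Or.inl ⟨k + 1, ?_⟩)
    funext u x
    rw [iteratedDeriv_succ]
    exact (hasDerivAt_re ((wave_jet_contDiff u k).differentiable (by simp) x).hasDerivAt).deriv
  · refine Algebra.subset_adjoin (Or.inr ⟨k + 1, ?_⟩)
    funext u x
    rw [iteratedDeriv_succ]
    exact (hasDerivAt_im ((wave_jet_contDiff u k).differentiable (by simp) x).hasDerivAt).deriv

/-- The zero wave. -/
def Wave.zero : Wave := ⟨fun _ => 0, contDiff_const⟩

/-- The values of u form a vector space, so here multiplication by a cutoff joins u to the zero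
curve. -/
lemma isDiffRing_wave : IsDiffRing wavePoly waveZero := by
  refine isDiffRing_adjoin wave_gen_contDiff fun u x => ?_
  let b : ContDiffBump x := ⟨1, 2, one_pos, one_lt_two⟩
  let u' : Wave := ⟨fun y => (b y : ℂ) * u.val y, (Complex.ofRealCLM.contDiff.comp b.contDiff).mul u.2⟩
  have h1 : u'.val =ᶠ[𝓝 x] u.val := by
    filter_upwards [b.eventuallyEq_one] with y hy
    show (b y : ℂ) * u.val y = u.val y
    rw [hy]; simp
  have h2 : u'.val =ᶠ[𝓝 (x + 3)] Wave.zero.val := by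
    have h : ∀ᶠ y in 𝓝 (x + 3), x + 2 < y := lt_mem_nhds (by linarith)
    filter_upwards [h] with y hy
    have hz : b y = 0 := by
      apply b.zero_of_le_dist
      rw [Real.dist_eq]
      exact le_trans (by show (2 : ℝ) ≤ y - x; linarith) (le_abs_self _)
    show (b y : ℂ) * u.val y = 0
    rw [hz]; simp
  refine ⟨u', ?_, Wave.zero, fun _ => rfl, x + 3, ?_⟩
  · rintro _ (⟨k, rfl⟩ | ⟨k, rfl⟩)
    · exact congrArg Complex.re (h1.iteratedDeriv_eq k)
    · exact congrArg Complex.im (h1.iteratedDeriv_eq k)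
  · rintro _ (⟨k, rfl⟩ | ⟨k, rfl⟩)
    · exact congrArg Complex.re (h2.iteratedDeriv_eq k)
    · exact congrArg Complex.im (h2.iteratedDeriv_eq k)

/-- Complex functionals whose real and imaginary parts are differential polynomials. -/
structure IsPolyWave (F : Wave → ℝ → ℂ) : Prop where
  re : (fun u x => (F u x).re) ∈ wavePoly
  im : (fun u x => (F u x).im) ∈ wavePoly

variable {F G : Wave → ℝ → ℂ}

lemma contDiff_of_re_im {W : Type*} [NormedAddCommGroup W] [NormedSpace ℝ W] {s : Set W}
    {f : W → ℂ} (h1 : ContDiffOn ℝ ∞ (fun y => (f y).re) s)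
    (h2 : ContDiffOn ℝ ∞ (fun y => (f y).im) s) : ContDiffOn ℝ ∞ f s := by
  have : f = fun y => Complex.equivRealProdCLM.symm ((f y).re, (f y).im) := by
    funext y; exact (Complex.equivRealProdCLM.symm_apply_apply (f y)).symm
  rw [this]
  exact Complex.equivRealProdCLM.symm.contDiff.comp_contDiffOn (h1.prodMk h2)

lemma IsPolyWave.contDiff (hF : IsPolyWave F) (u : Wave) : ContDiff ℝ ∞ (F u) := by
  rw [← contDiffOn_univ]
  exact contDiff_of_re_im (isDiffRing_wave.contDiff _ hF.re u).contDiffOn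
    (isDiffRing_wave.contDiff _ hF.im u).contDiffOn

lemma IsPolyWave.hasDerivAt (hF : IsPolyWave F) (u : Wave) (x : ℝ) :
    HasDerivAt (F u) (deriv (F u) x) x :=
  ((hF.contDiff u).differentiable (by simp) x).hasDerivAt

lemma isPolyWave_val : IsPolyWave fun u x => u.val x :=
  ⟨Algebra.subset_adjoin (Or.inl ⟨0, by simp⟩), Algebra.subset_adjoin (Or.inr ⟨0, by simp⟩)⟩

lemma IsPolyWave.deriv (hF : IsPolyWave F) : IsPolyWave fun u x => deriv (F u) x := by
  constructor
  · have : (fun (u : Wave) x => (_root_.deriv (F u) x).re) = Dx fun u x => (F u x).re := by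
      funext u x; exact (hasDerivAt_re (hF.hasDerivAt u x)).deriv.symm
    rw [this]; exact wavePoly_Dx hF.re
  · have : (fun (u : Wave) x => (_root_.deriv (F u) x).im) = Dx fun u x => (F u x).im := by
      funext u x; exact (hasDerivAt_im (hF.hasDerivAt u x)).deriv.symm
    rw [this]; exact wavePoly_Dx hF.im

lemma wavePoly_sum {ι : Type*} (s : Finset ι) {a : ι → Wave → ℝ → ℝ}
    (h : ∀ j ∈ s, a j ∈ wavePoly) : (fun S x => ∑ j ∈ s, a j S x) ∈ wavePoly := by
  have : (fun S x => ∑ j ∈ s, a j S x) = ∑ j ∈ s, a j := by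
    funext S x; simp
  rw [this]; exact sum_mem h

lemma wavePoly_const_mul (r : ℝ) {a : Wave → ℝ → ℝ} (h : a ∈ wavePoly) :
    (fun S x => r * a S x) ∈ wavePoly := Subalgebra.smul_mem _ h r

end WavePoly

/-! ### The generating sequence of the flows on `u` -/

section WaveSequence

/-- The pairs `W₀ = (0, 1)`, `Wₙ₊₁ = (i D_x ωₙ + u αₙ, αₙ₊₁)` for `Wₙ = (ωₙ, αₙ)`, with `αₙ₊₁`
fixed by `|W(z)|² = 1`. -/
noncomputable def waveW : ℕ → Wave → ℝ → ℂ × ℝ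
  | 0 => fun _ _ => (0, 1)
  | n + 1 => fun u x => (Complex.I * deriv (fun y => (waveW n u y).1) x + u.val x * (waveW n u x).2,
      -(1 / 2) * ∑ j : Fin n, ((waveW (j + 1) u x).2 * (waveW (n - j) u x).2
        + (waveW (j + 1) u x).1.re * (waveW (n - j) u x).1.re
        + (waveW (j + 1) u x).1.im * (waveW (n - j) u x).1.im))
termination_by n => n
decreasing_by all_goals omega

/-- The complex component of the generating sequence. -/
noncomputable def waveO (n : ℕ) (u : Wave) (x : ℝ) : ℂ := (waveW n u x).1

/-- The real component of the generating sequence. -/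
noncomputable def waveA (n : ℕ) (u : Wave) (x : ℝ) : ℝ := (waveW n u x).2

@[simp] lemma waveO_zero (u : Wave) (x : ℝ) : waveO 0 u x = 0 := by rw [waveO, waveW]
@[simp] lemma waveA_zero (u : Wave) (x : ℝ) : waveA 0 u x = 1 := by rw [waveA, waveW]

lemma waveO_succ (n : ℕ) (u : Wave) (x : ℝ) : waveO (n + 1) u x
    = Complex.I * deriv (waveO n u) x + u.val x * (waveA n u x : ℂ) := by
  rw [waveO, waveW]; rfl

lemma waveA_succ (n : ℕ) (u : Wave) (x : ℝ) : waveA (n + 1) u x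
    = -(1 / 2) * ∑ j ∈ Finset.range n, (waveA (j + 1) u x * waveA (n - j) u x
        + (waveO (j + 1) u x).re * (waveO (n - j) u x).re
        + (waveO (j + 1) u x).im * (waveO (n - j) u x).im) := by
  rw [waveA, waveW, Finset.sum_range]; rfl

lemma waveO_one (u : Wave) (x : ℝ) : waveO 1 u x = u.val x := by
  have : waveO 0 u = fun _ => 0 := funext fun y => waveO_zero u y
  rw [waveO_succ, this, deriv_const, waveA_zero]; simp

lemma wave_poly (n : ℕ) : IsPolyWave (waveO n) ∧ waveA n ∈ wavePoly := by
  induction n using Nat.strong_induction_on with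
  | _ n ih =>
    cases n with
    | zero =>
      have h1 : waveO 0 = fun _ _ => 0 := by funext u x; simp
      have h2 : waveA 0 = 1 := by funext u x; simp
      rw [h1, h2]
      exact ⟨⟨zero_mem wavePoly, zero_mem wavePoly⟩, one_mem _⟩
    | succ n =>
      obtain ⟨h1, h2⟩ := ih n (by omega)
      refine ⟨⟨?_, ?_⟩, ?_⟩
      · have : (fun u x => (waveO (n + 1) u x).re) = (-1 : ℝ) • (fun (u : Wave) x =>
            (deriv (waveO n u) x).im) + (fun (u : Wave) x => (u.val x).re) * waveA n := by
          funext u x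
          rw [waveO_succ]; simp
        rw [this]
        exact add_mem (Subalgebra.smul_mem _ h1.deriv.im _) (mul_mem isPolyWave_val.re h2)
      · have : (fun u x => (waveO (n + 1) u x).im) = (fun (u : Wave) x =>
            (deriv (waveO n u) x).re) + (fun (u : Wave) x => (u.val x).im) * waveA n := by
          funext u x
          rw [waveO_succ]; simp
        rw [this]
        exact add_mem h1.deriv.re (mul_mem isPolyWave_val.im h2)
      · rw [funext fun u => funext fun x => waveA_succ n u x]
        refine wavePoly_const_mul _ (wavePoly_sum _ fun j hj => ?_)
        have hj' := Finset.mem_range.1 hj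
        obtain ⟨a1, a2⟩ := ih (j + 1) (by omega)
        obtain ⟨b1, b2⟩ := ih (n - j) (by omega)
        exact add_mem (add_mem (mul_mem a2 b2) (mul_mem a1.re b1.re)) (mul_mem a1.im b1.im)

lemma wave_zero_curve {u : Wave} (hu : u ∈ waveZero) (n : ℕ) (x : ℝ) :
    waveO n u x = 0 ∧ waveA (n + 1) u x = 0 := by
  induction n using Nat.strong_induction_on generalizing x with
  | _ n ih =>
    have hO : waveO n u x = 0 := by
      cases n with
      | zero => exact waveO_zero u x
      | succ n =>
        have : waveO n u = fun _ => 0 := funext fun y => (ih n (by omega) y).1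
        rw [waveO_succ, this, deriv_const, hu x]; simp
    refine ⟨hO, ?_⟩
    rw [waveA_succ, Finset.sum_eq_zero, mul_zero]
    intro j hj
    have hj' := Finset.mem_range.1 hj
    have h1 : waveO (j + 1) u x = 0 := by
      rcases (show j + 1 ≤ n from hj').eq_or_lt with h | h
      · rw [h, hO]
      · exact (ih (j + 1) h x).1
    rw [(ih j hj' x).2, h1]
    simp

end WaveSequence

/-! ### Parallel frames -/

section Frames

variable {S : SpinCurve} {e₂ e₃ : ℝ → E3} {u : Wave}

/-- The vector with components `(a, -Im w, Re w)` in the orthonormal frame `(s, e, s ∧ e)`. -/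
noncomputable def frameVec (s e : E3) (a : ℝ) (w : ℂ) : E3 :=
  a • s + (-w.im) • e + w.re • cross s e

section FrameAlgebra

variable {s e : E3} (hs : inner ℝ s s = (1 : ℝ)) (he : inner ℝ e e = (1 : ℝ))
  (hse : inner ℝ s e = (0 : ℝ))
include hs he hse

lemma inner_cross_cross_frame : inner ℝ (cross s e) (cross s e) = (1 : ℝ) := by
  rw [inner_cross_cross, hs, he, hse]; norm_num

lemma inner_frameVec (a b : ℝ) (w z : ℂ) : inner ℝ (frameVec s e a w) (frameVec s e b z)
    = a * b + w.re * z.re + w.im * z.im := by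
  have hes : inner ℝ e s = (0 : ℝ) := by rw [real_inner_comm, hse]
  have h1 : inner ℝ (cross s e) s = (0 : ℝ) := by rw [real_inner_comm, inner_cross_left]
  have h2 : inner ℝ (cross s e) e = (0 : ℝ) := by rw [real_inner_comm, inner_cross_right]
  simp only [frameVec, inner_add_left, inner_add_right, real_inner_smul_left,
    real_inner_smul_right, hs, he, hse, hes, h1, h2, inner_cross_left, inner_cross_right,
    inner_cross_cross_frame hs he hse]
  ring

omit he in
lemma cross_left_cross_frame : cross s (cross s e) = -e := cross_cross_orth hs hse

-- This identity dictates the order and the signs of the components in `frameVec`: the product with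
-- s turns w into the tangent vector Re w e + Im w (s ∧ e), the form in which a covariant represents
-- a vector.
omit he in
lemma cross_frameVec (a : ℝ) (w : ℂ) :
    cross (frameVec s e a w) s = w.re • e + w.im • cross s e := by
  rw [frameVec, cross_add_left, cross_add_left, cross_smul_left, cross_smul_left, cross_smul_left,
    cross_self', cross_swap e s, cross_swap (cross s e) s, cross_left_cross_frame hs hse]
  module

end FrameAlgebra

namespace IsParallelFrame

variable (hF : IsParallelFrame S e₂ e₃ u)
include hF

lemma inner_e₂ (x : ℝ) : inner ℝ (e₂ x) (e₂ x) = (1 : ℝ) := inner_self_of_norm (hF.norm_e₂ x)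

lemma deriv_val (x : ℝ) : deriv S.val x
    = (u.val x).re • e₂ x + (u.val x).im • cross (S.val x) (e₂ x) := by
  rw [(hF.deriv_S x).deriv, hF.e₃_eq]

/-- Differentiation in the moving frame produces the components a' - Im(u w̄) and w' - i u a. The
first vanishes when a is a primitive of Im(u w̄), and the second is then the operator 𝓗 with that
primitive. -/
lemma hasDerivAt_frameVec {a : ℝ → ℝ} {w : ℝ → ℂ} {a' : ℝ} {w' : ℂ} {x : ℝ}
    (ha : HasDerivAt a a' x) (hw : HasDerivAt w w' x) :
    HasDerivAt (fun y => frameVec (S.val y) (e₂ y) (a y) (w y))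
      (frameVec (S.val x) (e₂ x) (a' + (u.val x).re * (w x).im - (u.val x).im * (w x).re)
        (w' - Complex.I * u.val x * (a x : ℂ))) x := by
  have h3 : HasDerivAt (fun y => cross (S.val y) (e₂ y)) (-(u.val x).im • S.val x) x := by
    rw [← funext hF.e₃_eq]; exact hF.deriv_e₃ x
  have h1 := hF.deriv_S x
  rw [hF.e₃_eq] at h1
  have := ((ha.smul h1).add ((hasDerivAt_im hw).neg.smul (hF.deriv_e₂ x))).add
    ((hasDerivAt_re hw).smul h3)
  refine this.congr_deriv ?_
  simp only [frameVec, Pi.neg_apply, Complex.sub_re, Complex.sub_im, Complex.mul_re,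
    Complex.mul_im, Complex.I_re, Complex.I_im, Complex.ofReal_re, Complex.ofReal_im]
  module

/-- The generating sequences of the two hierarchies agree in a parallel frame. -/
theorem spinV_eq (n : ℕ) : ∀ x, spinV n S x
    = frameVec (S.val x) (e₂ x) (waveA n u x) (waveO n u x) := by
  induction n using Nat.strong_induction_on with
  | _ n ih =>
    intro x
    have hs := spin_inner_self S x
    cases n with
    | zero => simp [frameVec]
    | succ n =>
      have hA : spinA n S x = waveA (n + 1) u x := by
        rw [spinA, waveA_succ]
        congr 1
        refine Finset.sum_congr rfl fun j hj => ?_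
        have hj' := Finset.mem_range.1 hj
        rw [ih (j + 1) (by omega), ih (n - j) (by omega),
          inner_frameVec hs (hF.inner_e₂ x) (hF.orth_e₂ x)]
      have hV := by
        have h := (hF.hasDerivAt_frameVec ((isDiffRing_wave.contDiff _ (wave_poly n).2
          u).differentiable (by simp) x).hasDerivAt ((wave_poly n).1.hasDerivAt u x)).deriv
        rwa [← funext (ih n (by omega))] at h
      have h3 : cross (S.val x) (cross (S.val x) (e₂ x)) = -e₂ x :=
        cross_left_cross_frame hs (hF.orth_e₂ x)
      rw [spinV_succ, hV, hA, waveO_succ]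
      simp only [frameVec, cross_add_right, cross_smul_right, cross_self', h3, Complex.add_re,
        Complex.add_im, Complex.sub_re, Complex.sub_im, Complex.mul_re, Complex.mul_im,
        Complex.I_re, Complex.I_im, Complex.ofReal_re, Complex.ofReal_im]
      module

lemma waveA_eq (n : ℕ) (x : ℝ) : waveA (n + 1) u x = spinA n S x := by
  rw [spinA, waveA_succ]
  congr 1
  refine Finset.sum_congr rfl fun j _ => ?_
  rw [hF.spinV_eq, hF.spinV_eq,
    inner_frameVec (spin_inner_self S x) (hF.inner_e₂ x) (hF.orth_e₂ x)]

lemma spinFlow_eq (n : ℕ) (x : ℝ) : spinFlow n S x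
    = (waveO (n + 1) u x).re • e₂ x + (waveO (n + 1) u x).im • cross (S.val x) (e₂ x) := by
  rw [SpinHierarchy.spinFlow_eq]
  show deriv (spinV n S) x = _
  rw [spinV_deriv, hF.spinV_eq, cross_frameVec (spin_inner_self S x) (hF.orth_e₂ x)]

/-- The formula for D_x aₙ read in the frame. Proving it through S avoids repeating the
compatibility induction for the sequence in u. -/
lemma deriv_waveA (n : ℕ) (x : ℝ) : deriv (waveA (n + 1) u) x
    = imPairing (waveO (n + 1)) u x := by
  rw [funext fun y => hF.waveA_eq n y]
  show deriv (spinA n S) x = _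
  have h := hF.spinFlow_eq n x
  rw [SpinHierarchy.spinFlow_eq] at h
  have h' : deriv (spinV n S) x = _ := h
  have hs := spin_inner_self S x
  have h1 : inner ℝ (cross (S.val x) (e₂ x)) (e₂ x) = (0 : ℝ) := by
    rw [real_inner_comm, inner_cross_right]
  rw [spinA_deriv, h', hF.deriv_val]
  simp only [cross_add_right, cross_smul_right, cross_left_cross_frame hs (hF.orth_e₂ x),
    inner_add_left, inner_add_right, real_inner_smul_left, real_inner_smul_right, inner_neg_left,
    inner_cross_cross_frame hs (hF.inner_e₂ x) (hF.orth_e₂ x), h1, inner_cross_right,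
    hF.inner_e₂, imPairing, Complex.mul_im, Complex.conj_re, Complex.conj_im]
  ring

end IsParallelFrame

end Frames

/-! ### Rotating vectors -/

section Rotation

variable {I : Set ℝ} {α β y z : ℝ → ℝ → E3}

/-- `y` solves the linear system `y_x = α ∧ y`, `y_t = β ∧ y`. -/
def IsRotated (I : Set ℝ) (α β y : ℝ → ℝ → E3) : Prop :=
  ∀ t ∈ I, ∀ x, HasDerivAt (y t) (cross (α t x) (y t x)) x ∧
    HasDerivAt (fun τ => y τ x) (cross (β t x) (y t x)) t

/-- The Jacobi identity identifies the commutator of the operators β ∧ and α ∧ with (β ∧ α) ∧, so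
the vector condition is the flatness required by `exists_flat_section`. -/
lemma exists_isRotated (hI : IsOpen I) (hc : I.OrdConnected) (hα : SmoothFam I α)
    (hβ : SmoothFam I β)
    (flat : ∀ t ∈ I, ∀ x, deriv (fun τ => α τ x) t - deriv (β t) x = cross (β t x) (α t x))
    {t₀ : ℝ} (ht₀ : t₀ ∈ I) (y₀ : E3) : ∃ y, SmoothFam I y ∧ y t₀ 0 = y₀ ∧ IsRotated I α β y := by
  refine exists_flat_section hI hc (hα.clm crossL) (hβ.clm crossL) (fun t ht x => ?_) ht₀ y₀
  have h1 : HasDerivAt (fun τ => crossL (α τ x)) (crossL (deriv (fun τ => α τ x) t)) t :=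
    crossL.hasFDerivAt.comp_hasDerivAt t (hα.hasDerivAt_t hI ht x)
  have h2 : HasDerivAt (fun y => crossL (β t y)) (crossL (deriv (β t) x)) x :=
    crossL.hasFDerivAt.comp_hasDerivAt x (hβ.hasDerivAt_x hI ht x)
  rw [h1.deriv, h2.deriv, ← map_sub, flat t ht x]
  ext1 v
  show crossL _ v = crossL _ (crossL _ v) - crossL _ (crossL _ v)
  simp only [crossL_apply, cross_cross_left, cross_cross_right, real_inner_comm (β t x)]
  module

lemma IsRotated.cross (hy : IsRotated I α β y) (hz : IsRotated I α β z) :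
    IsRotated I α β fun t x => cross (y t x) (z t x) := by
  have jac : ∀ a b c : E3, SpinHierarchy.cross (SpinHierarchy.cross a b) c
      + SpinHierarchy.cross b (SpinHierarchy.cross a c)
      = SpinHierarchy.cross a (SpinHierarchy.cross b c) := fun a b c => by
    simp only [cross_cross_left, cross_cross_right, real_inner_comm b a]
    module
  intro t ht x
  refine ⟨?_, ?_⟩
  · rw [← jac]; exact hasDerivAt_cross (hy t ht x).1 (hz t ht x).1
  · rw [← jac]; exact hasDerivAt_cross (hy t ht x).2 (hz t ht x).2

lemma IsRotated.sub (hy : IsRotated I α β y) (hz : IsRotated I α β z) :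
    IsRotated I α β fun t x => y t x - z t x := by
  intro t ht x
  rw [cross_sub_right, cross_sub_right]
  exact ⟨(hy t ht x).1.sub (hz t ht x).1, (hy t ht x).2.sub (hz t ht x).2⟩

lemma inner_cross_skew (a b c : E3) :
    inner ℝ b (SpinHierarchy.cross a c) + inner ℝ (SpinHierarchy.cross a b) c = (0 : ℝ) := by
  simp only [inner_E3, cross_zero_apply, cross_one_apply, cross_two_apply]
  ring

lemma IsRotated.inner_eq (hI : IsOpen I) (hc : I.OrdConnected) (hy : IsRotated I α β y)
    (hz : IsRotated I α β z) {s t : ℝ} (hs : s ∈ I) (ht : t ∈ I) (x : ℝ) :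
    inner ℝ (y t x) (z t x) = (inner ℝ (y s 0) (z s 0) : ℝ) := by
  refine eq_of_partials_zero (f := fun t x => inner ℝ (y t x) (z t x)) hI hc (fun t ht x => ?_)
    (fun t ht => ?_) hs ht x
  · exact ((hy t ht x).1.inner ℝ (hz t ht x).1).congr_deriv (inner_cross_skew _ _ _)
  · exact ((hy t ht 0).2.inner ℝ (hz t ht 0).2).congr_deriv (inner_cross_skew _ _ _)

lemma IsRotated.eq_of_eq (hI : IsOpen I) (hc : I.OrdConnected) (hy : IsRotated I α β y)
    (hz : IsRotated I α β z) {s t : ℝ} (hs : s ∈ I) (ht : t ∈ I) (h : y s 0 = z s 0) (x : ℝ) :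
    y t x = z t x := by
  have := (hy.sub hz).inner_eq hI hc (hy.sub hz) hs ht x
  rw [h, sub_self, inner_zero_left] at this
  exact sub_eq_zero.1 (inner_self_eq_zero.1 this)

end Rotation

/-! ### Existence of frames -/

section FrameExistence

lemma smoothFam_toLp {I : Set ℝ} {a b c : ℝ → ℝ → ℝ} (ha : SmoothFam I a) (hb : SmoothFam I b)
    (hc : SmoothFam I c) : SmoothFam I fun t x => (!₂[a t x, b t x, c t x] : E3) := by
  refine contDiffOn_E3.2 fun i => ?_
  fin_cases i
  exacts [ha, hb, hc]

lemma hasDerivAt_toLp {a b c : ℝ → ℝ} {a' b' c' x : ℝ} (ha : HasDerivAt a a' x)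
    (hb : HasDerivAt b b' x) (hc : HasDerivAt c c' x) :
    HasDerivAt (fun y => (!₂[a y, b y, c y] : E3)) !₂[a', b', c'] x := by
  refine hasDerivAt_E3 fun i => ?_
  fin_cases i
  exacts [ha, hb, hc]

/-- The hypotheses on u_t and a_x are the zero-curvature equation of a connection with values in
so(3). Three solutions with orthonormal initial data form a rotation matrix, and the frame consists
of its columns. -/
theorem exists_frame {I : Set ℝ} (hI : IsOpen I) (hc : I.OrdConnected) {t₀ : ℝ} (ht₀ : t₀ ∈ I)
    {u p : ℝ → ℝ → ℂ} {a : ℝ → ℝ → ℝ} (hu : SmoothFam I u) (hp : SmoothFam I p)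
    (ha : SmoothFam I a)
    (hut : ∀ t ∈ I, ∀ x, HasDerivAt (fun τ => u τ x)
      (deriv (p t) x - Complex.I * u t x * (a t x : ℂ)) t)
    (hax : ∀ t ∈ I, ∀ x, HasDerivAt (a t) (u t x * conj (p t x)).im x) :
    ∃ S e : ℝ → ℝ → E3, SmoothFam I S ∧ ∀ t ∈ I, ∀ x,
      inner ℝ (S t x) (S t x) = (1 : ℝ) ∧ inner ℝ (e t x) (e t x) = (1 : ℝ) ∧
      inner ℝ (S t x) (e t x) = (0 : ℝ) ∧
      HasDerivAt (S t) ((u t x).re • e t x + (u t x).im • cross (S t x) (e t x)) x ∧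
      HasDerivAt (e t) (-(u t x).re • S t x) x ∧
      HasDerivAt (fun y => cross (S t y) (e t y)) (-(u t x).im • S t x) x ∧
      HasDerivAt (fun τ => S τ x) ((p t x).re • e t x + (p t x).im • cross (S t x) (e t x)) t := by
  have hure := hu.clm Complex.reCLM
  have huim := hu.clm Complex.imCLM
  have hpre := hp.clm Complex.reCLM
  have hpim := hp.clm Complex.imCLM
  have h0 : SmoothFam I fun _ _ => (0 : ℝ) := contDiffOn_const
  -- α has no first component because the frame is parallel in x. The first component -a of β is the
  -- rotation of the frame about S in time.
  let α : ℝ → ℝ → E3 := fun t x => !₂[0, (u t x).im, -(u t x).re]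
  let β : ℝ → ℝ → E3 := fun t x => !₂[-a t x, (p t x).im, -(p t x).re]
  have hα : SmoothFam I α := smoothFam_toLp h0 huim (ContDiffOn.neg hure)
  have hβ : SmoothFam I β := smoothFam_toLp (ContDiffOn.neg ha) hpim (ContDiffOn.neg hpre)
  have flat : ∀ t ∈ I, ∀ x,
      deriv (fun τ => α τ x) t - deriv (β t) x = cross (β t x) (α t x) := by
    intro t ht x
    have h1 : HasDerivAt (fun τ => α τ x) _ t := hasDerivAt_toLp (hasDerivAt_const t 0)
      (hasDerivAt_im (hut t ht x)) (hasDerivAt_re (hut t ht x)).neg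
    have hpx := hp.hasDerivAt_x hI ht x
    have h2 : HasDerivAt (β t) _ x := hasDerivAt_toLp (hax t ht x).neg
      (hasDerivAt_im hpx) (hasDerivAt_re hpx).neg
    rw [h1.deriv, h2.deriv]
    refine E3_ext ?_ ?_ ?_ <;> simp [α, β] <;> ring
  choose y hys hy0 hyr using exists_isRotated hI hc hα hβ flat ht₀
  let r : Fin 3 → ℝ → ℝ → E3 := fun i => y (EuclideanSpace.single i 1)
  have hr : ∀ i, IsRotated I α β (r i) := fun i => hyr _
  have hr0 : ∀ i, r i t₀ 0 = EuclideanSpace.single i 1 := fun i => hy0 _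
  have hrs : ∀ i j, SmoothFam I fun t x => r i t x j := fun i j => (hys _).clm (coordL j)
  have hin : ∀ i j, ∀ t ∈ I, ∀ x, inner ℝ (r i t x) (r j t x) = if i = j then (1 : ℝ) else 0 := by
    intro i j t ht x
    rw [(hr i).inner_eq hI hc (hr j) ht₀ ht x, hr0, hr0]
    fin_cases i <;> fin_cases j <;> simp [inner_E3]
  have hcr : ∀ i j k, cross (EuclideanSpace.single i 1) (EuclideanSpace.single j 1)
      = (EuclideanSpace.single k 1 : E3) → ∀ t ∈ I, ∀ x, cross (r i t x) (r j t x) = r k t x := by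
    intro i j k h t ht x
    refine ((hr i).cross (hr j)).eq_of_eq hI hc (hr k) ht₀ ht ?_ x
    rw [hr0, hr0, hr0, h]
  have hcol : ∀ t ∈ I, ∀ x, ∀ i j, r 0 t x i * r 0 t x j + r 1 t x i * r 1 t x j
      + r 2 t x i * r 2 t x j = if i = j then (1 : ℝ) else 0 := by
    intro t ht x
    let M : Matrix (Fin 3) (Fin 3) ℝ := fun i j => r i t x j
    -- The flow preserves inner products of the rows; orthonormality of the columns follows because
    -- a one-sided inverse of a square matrix is two-sided.
    have h : M * M.transpose = 1 := by
      ext i j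
      rw [Matrix.mul_apply, Matrix.one_apply, ← hin i j t ht x, inner_E3, Fin.sum_univ_three]
      rfl
    have h' := mul_eq_one_comm.1 h
    intro i j
    have := congrFun (congrFun h' i) j
    rw [Matrix.mul_apply, Matrix.one_apply, Fin.sum_univ_three] at this
    exact this
  have h12 := hcr 1 2 0 (by refine E3_ext ?_ ?_ ?_ <;> simp)
  have h20 := hcr 2 0 1 (by refine E3_ext ?_ ?_ ?_ <;> simp)
  have h01 := hcr 0 1 2 (by refine E3_ext ?_ ?_ ?_ <;> simp)
  let c : Fin 3 → ℝ → ℝ → E3 := fun k t x => !₂[r 0 t x k, r 1 t x k, r 2 t x k]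
  have hc3 : ∀ t ∈ I, ∀ x, cross (c 0 t x) (c 1 t x) = c 2 t x := by
    intro t ht x
    refine E3_ext ?_ ?_ ?_
    · simpa [c, mul_comm] using! congrArg (fun v : E3 => v 2) (h12 t ht x)
    · simpa [c, mul_comm] using! congrArg (fun v : E3 => v 2) (h20 t ht x)
    · simpa [c, mul_comm] using! congrArg (fun v : E3 => v 2) (h01 t ht x)
  have hcx : ∀ k, ∀ t ∈ I, ∀ x, HasDerivAt (c k t)
      !₂[cross (α t x) (r 0 t x) k, cross (α t x) (r 1 t x) k, cross (α t x) (r 2 t x) k] x :=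
    fun k t ht x => hasDerivAt_toLp (hasDerivAt_coord (hr 0 t ht x).1 k)
      (hasDerivAt_coord (hr 1 t ht x).1 k) (hasDerivAt_coord (hr 2 t ht x).1 k)
  have hct : ∀ k, ∀ t ∈ I, ∀ x, HasDerivAt (fun τ => c k τ x)
      !₂[cross (β t x) (r 0 t x) k, cross (β t x) (r 1 t x) k, cross (β t x) (r 2 t x) k] t :=
    fun k t ht x => hasDerivAt_toLp (hasDerivAt_coord (hr 0 t ht x).2 k)
      (hasDerivAt_coord (hr 1 t ht x).2 k) (hasDerivAt_coord (hr 2 t ht x).2 k)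
  have hinc : ∀ i j, ∀ t ∈ I, ∀ x, inner ℝ (c i t x) (c j t x) = if i = j then (1 : ℝ) else 0 := by
    intro i j t ht x
    rw [← hcol t ht x i j, inner_E3]
    simp [c]
  refine ⟨c 0, c 1, smoothFam_toLp (hrs 0 0) (hrs 1 0) (hrs 2 0), fun t ht x =>
    ⟨hinc 0 0 t ht x, hinc 1 1 t ht x, hinc 0 1 t ht x, ?_, ?_, ?_, ?_⟩⟩
  · refine (hcx 0 t ht x).congr_deriv ?_
    rw [hc3 t ht x]
    refine E3_ext ?_ ?_ ?_ <;> simp [c, α] <;> ring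
  · refine (hcx 1 t ht x).congr_deriv ?_
    refine E3_ext ?_ ?_ ?_ <;> simp [c, α]
  · rw [funext (hc3 t ht)]
    refine (hcx 2 t ht x).congr_deriv ?_
    refine E3_ext ?_ ?_ ?_ <;> simp [c, α]
  · refine (hct 0 t ht x).congr_deriv ?_
    rw [hc3 t ht x]
    refine E3_ext ?_ ?_ ?_ <;> simp [c, β] <;> ring

end FrameExistence

/-! ### The recursion operator on `u` -/

section WaveRecursion

/-- The time-independent case of `exists_frame`, with p = 0 and a = 0. -/
theorem exists_parallelFrame (u : Wave) : ∃ S e₂ e₃, IsParallelFrame S e₂ e₃ u := by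
  have hu : SmoothFam univ fun _ : ℝ => u.val :=
    (u.2.comp contDiff_snd).contDiffOn
  have h0 : SmoothFam univ fun _ _ : ℝ => (0 : ℂ) := contDiffOn_const
  have h0' : SmoothFam univ fun _ _ : ℝ => (0 : ℝ) := contDiffOn_const
  obtain ⟨S, e, hS, h⟩ := exists_frame isOpen_univ ordConnected_univ (mem_univ 0) hu h0 h0'
    (fun t _ x => by simpa using! hasDerivAt_const t (u.val x))
    (fun t _ x => by simpa using! hasDerivAt_const x (0 : ℝ))
  have h' := h 0 (mem_univ 0)
  refine ⟨⟨S 0, hS.contDiff_x isOpen_univ (mem_univ 0), fun x => norm_of_inner_self (h' x).1⟩, e 0, fun x => cross (S 0 x) (e 0 x), ?_⟩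
  exact ⟨fun x => norm_of_inner_self (h' x).2.1, fun x => (h' x).2.2.1, fun x => rfl,
    fun x => (h' x).2.2.2.1, fun x => (h' x).2.2.2.2.1, fun x => (h' x).2.2.2.2.2.1⟩

lemma waveA_hasDerivAt (n : ℕ) (u : Wave) (x : ℝ) :
    HasDerivAt (waveA n u) (imPairing (waveO n) u x) x := by
  have h := ((isDiffRing_wave.contDiff _ (wave_poly n).2 u).differentiable (by simp) x).hasDerivAt
  refine h.congr_deriv ?_
  cases n with
  | zero =>
    rw [show waveA 0 u = fun _ => 1 from funext (waveA_zero u)]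
    simp [imPairing]
  | succ n =>
    obtain ⟨S, e₂, e₃, hF⟩ := exists_parallelFrame u
    exact hF.deriv_waveA n x

theorem waveA_isDxInv (n : ℕ) :
    IsDxInv wavePoly waveZero (imPairing (waveO (n + 1))) (waveA (n + 1)) :=
  ⟨(wave_poly _).2, funext fun u => funext fun x => (waveA_hasDerivAt _ u x).deriv,
    fun _ hu => funext fun x => (wave_zero_curve hu n x).2⟩

lemma opH_waveO (n : ℕ) : opH (waveO (n + 1)) = fun u x =>
    deriv (waveO (n + 1) u) x - Complex.I * u.val x * (waveA (n + 1) u x : ℂ) := by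
  funext u x
  rw [opH, waveInv, isDiffRing_wave.DxInv_eq (waveA_isDxInv n)]
  rfl

/-- The recursion for ω is i𝓗 with αₙ as the local primitive. This holds from index 1 on: α₀ = 1 is
not a normalised inverse, and its only role is to produce ω₁ = u, whence the shift. -/
theorem iHpow_eq (n : ℕ) : iHpow n = waveO (n + 1) := by
  induction n with
  | zero => funext u x; exact (waveO_one u x).symm
  | succ n ih =>
    have : iHpow (n + 1) = fun u x => Complex.I * opH (iHpow n) u x :=
      Function.iterate_succ_apply' _ _ _
    rw [this, ih, opH_waveO]
    funext u x
    rw [waveO_succ (n + 1)]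
    linear_combination (-(u.val x * (waveA (n + 1) u x : ℂ))) * Complex.I_mul_I

lemma opH_iHpow (n : ℕ) : opH (iHpow n) = opI (iHpow (n + 1)) := by
  have : iHpow (n + 1) = fun u x => Complex.I * opH (iHpow n) u x :=
    Function.iterate_succ_apply' _ _ _
  funext u x
  rw [opI, this]
  linear_combination opH (iHpow n) u x * Complex.I_mul_I

theorem hamPre_isDxInv (n : ℕ) :
    IsDxInv wavePoly waveZero (hamPre n) fun u x => -waveA (n + 2) u x := by
  refine ⟨neg_mem (wave_poly (n + 2)).2, funext fun u => funext fun x => ?_, fun u hu =>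
    funext fun x => ?_⟩
  · refine ((waveA_hasDerivAt (n + 2) u x).neg.deriv).trans ?_
    simp only [hamPre, iHpow_eq, imPairing, Complex.mul_im, Complex.conj_re, Complex.conj_im]
    ring
  · show -waveA (n + 2) u x = 0
    rw [(wave_zero_curve hu (n + 1) x).2, neg_zero]

theorem hamDensity_eq (n : ℕ) :
    hamDensity n = fun u x => -(2 / (1 + (n : ℝ))) * waveA (n + 2) u x := by
  funext u x
  rw [hamDensity, waveInv, isDiffRing_wave.DxInv_eq (hamPre_isDxInv n)]
  ring

theorem IsParallelFrame.hamDensity_eq {S : SpinCurve} {e₂ e₃ : ℝ → E3} {u : Wave}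
    (hF : IsParallelFrame S e₂ e₃ u) (n : ℕ) (x : ℝ) :
    hamDensity n u x = 2 * spinDensity n S x := by
  rw [SpinHierarchy.hamDensity_eq, spinDensity_eq]
  show -(2 / (1 + (n : ℝ))) * waveA (n + 2) u x = _
  rw [hF.waveA_eq (n + 1)]
  ring

end WaveRecursion

/-! ### Correspondence of solutions -/

section Solutions

variable {I : Set ℝ}

lemma wavePoly_smoothFam (hI : IsOpen I) {c : ℝ → Wave} (hc : SmoothFam I fun t x => (c t).val x)
    {G : Wave → ℝ → ℝ} (hG : G ∈ wavePoly) : SmoothFam I fun t x => G (c t) x := by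
  refine adjoin_contDiffOn ?_ hG
  rintro _ (⟨k, rfl⟩ | ⟨k, rfl⟩)
  · exact (hc.iteratedDeriv hI k).clm Complex.reCLM
  · exact (hc.iteratedDeriv hI k).clm Complex.imCLM

lemma IsPolyWave.smoothFam (hI : IsOpen I) {c : ℝ → Wave}
    (hc : SmoothFam I fun t x => (c t).val x) {F : Wave → ℝ → ℂ} (hF : IsPolyWave F) :
    SmoothFam I fun t x => F (c t) x :=
  contDiff_of_re_im (wavePoly_smoothFam hI hc hF.re) (wavePoly_smoothFam hI hc hF.im)

/-- The +n flow is the hypothesis of `exists_frame` with p = ωₙ₊₁ and a = αₙ₊₁. The velocity of S is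
then the vector with covariant ωₙ₊₁, which is f⁽ⁿ⁾. -/
theorem exists_spin_solution (hI : IsOpen I) (hc : I.OrdConnected) (n : ℕ) {u : ℝ → Wave}
    (hu : IsSolution Wave.val (opH (iHpow n)) I u) :
    ∃ S : ℝ → SpinCurve, IsSolution SpinCurve.val (spinFlow n) I S ∧
      ∀ t ∈ I, ∃ e₂ e₃, IsParallelFrame (S t) e₂ e₃ (u t) := by
  rcases I.eq_empty_or_nonempty with rfl | ⟨t₀, ht₀⟩
  · exact ⟨fun _ => SpinCurve.const (EuclideanSpace.single 0 1) (by simp),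
      ⟨by simp, by simp⟩, by simp⟩
  obtain ⟨hu1, hu2⟩ := hu
  rw [iHpow_eq, opH_waveO] at hu2
  obtain ⟨S, e, hS, h⟩ := exists_frame hI hc ht₀ (u := fun t x => (u t).val x) hu1
    ((wave_poly (n + 1)).1.smoothFam hI hu1) (wavePoly_smoothFam hI hu1 (wave_poly (n + 1)).2)
    hu2 fun t _ x => waveA_hasDerivAt (n + 1) (u t) x
  classical
  let Sp : ℝ → SpinCurve := fun t => if ht : t ∈ I then
    ⟨S t, hS.contDiff_x hI ht, fun x => norm_of_inner_self (h t ht x).1⟩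
    else SpinCurve.const (EuclideanSpace.single 0 1) (by simp)
  have hSp : ∀ t ∈ I, (Sp t).val = S t := fun t ht => by rw [show Sp t = _ from dif_pos ht]; rfl
  have hF : ∀ t ∈ I, IsParallelFrame (Sp t) (e t) (fun x => cross (S t x) (e t x)) (u t) := by
    intro t ht
    constructor <;> (try rw [hSp t ht]) <;> intro x
    · exact norm_of_inner_self (h t ht x).2.1
    · exact (h t ht x).2.2.1
    · rfl
    · exact (h t ht x).2.2.2.1
    · exact (h t ht x).2.2.2.2.1
    · exact (h t ht x).2.2.2.2.2.1
  refine ⟨Sp, ⟨hS.congr fun p hp => by rw [hSp p.1 hp.1], fun t ht x => ?_⟩,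
    fun t ht => ⟨_, _, hF t ht⟩⟩
  rw [(hF t ht).spinFlow_eq, hSp t ht]
  refine (h t ht x).2.2.2.2.2.2.congr_of_eventuallyEq ?_
  filter_upwards [hI.mem_nhds ht] with τ hτ
  rw [hSp τ hτ]

lemma exists_unit_orth (s : E3) : ∃ e : E3, ‖e‖ = 1 ∧ inner ℝ s e = (0 : ℝ) := by
  obtain ⟨v, hv, hsv⟩ : ∃ v : E3, v ≠ 0 ∧ inner ℝ s v = (0 : ℝ) := by
    by_cases h : s 0 = 0
    · refine ⟨EuclideanSpace.single 0 1, fun h0 => ?_, by simp [inner_E3, h]⟩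
      simpa using! congrArg (fun v : E3 => v 0) h0
    · refine ⟨!₂[-s 1, s 0, 0], fun h0 => h ?_, by simp [inner_E3]; ring⟩
      simpa using! congrArg (fun v : E3 => v 1) h0
  refine ⟨‖v‖⁻¹ • v, norm_smul_inv_norm hv, by rw [real_inner_smul_right, hsv, mul_zero]⟩

lemma eq_frame_components {s e v : E3} (hs : inner ℝ s s = (1 : ℝ)) (he : inner ℝ e e = (1 : ℝ))
    (hse : inner ℝ s e = (0 : ℝ)) (hv : inner ℝ s v = (0 : ℝ)) :
    (inner ℝ v e : ℝ) • e + (inner ℝ v (cross s e) : ℝ) • cross s e = v := by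
  set f := cross s e with hfdef
  have hff : inner ℝ f f = (1 : ℝ) := inner_cross_cross_frame hs he hse
  have hfe : inner ℝ f e = (0 : ℝ) := by rw [real_inner_comm, hfdef, inner_cross_right]
  have hfs : inner ℝ f s = (0 : ℝ) := by rw [real_inner_comm, hfdef, inner_cross_left]
  have hes : inner ℝ e s = (0 : ℝ) := by rw [real_inner_comm, hse]
  have hvs : inner ℝ v s = (0 : ℝ) := by rw [real_inner_comm, hv]
  refine sub_eq_zero.1 (eq_zero_of_cross_inner hff ?_ ?_)
  -- With this factor written as s ∧ e, the double product involves only the components along e and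
  -- s, both zero.
  · nth_rewrite 3 [hfdef]
    simp only [cross_cross_right, inner_sub_left, inner_add_left, real_inner_smul_left, he,
      hfe, hfs, hes, hvs]
    simp
  · simp only [inner_sub_right, inner_add_right, real_inner_smul_right, hff, hfe,
      real_inner_comm v f]
    simp

/-- S rotates with angular velocity V₁ in x and Vₙ₊₁ in t, and this connection is flat by
`spinV_evolution` at order one. The frame is transported by the same connection: V₁ has no component
along S, so it is parallel in x, while the component aₙ of Vₙ₊₁ along S fixes its rotation in time
so that u obeys the flow without a phase term. -/
theorem exists_wave_solution (hI : IsOpen I) (hc : I.OrdConnected) (n : ℕ) {S : ℝ → SpinCurve}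
    (hS : IsSolution SpinCurve.val (spinFlow n) I S) :
    ∃ u : ℝ → Wave, IsSolution Wave.val (opH (iHpow n)) I u ∧
      ∀ t ∈ I, ∃ e₂ e₃, IsParallelFrame (S t) e₂ e₃ (u t) := by
  rcases I.eq_empty_or_nonempty with rfl | ⟨t₀, ht₀⟩
  · exact ⟨fun _ => Wave.zero, ⟨by simp, by simp⟩, by simp⟩
  obtain ⟨hS1, hS2⟩ := hS
  have hV : ∀ k, SmoothFam I fun t x => spinV k (S t) x := fun k =>
    (isPolyVec_spinV k).smoothFam hI hS1
  have flat : ∀ t ∈ I, ∀ x, deriv (fun τ => spinV 1 (S τ) x) t - deriv (spinV (n + 1) (S t)) x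
      = cross (spinV (n + 1) (S t) x) (spinV 1 (S t) x) := by
    intro t ht x
    rw [(spinV_evolution hI hS1 ht (hS2 t ht) 1 x).deriv, spinX_succ, spinV_deriv, spinX]
    simp
  obtain ⟨e₀, he₀, hse₀⟩ := exists_unit_orth ((S t₀).val 0)
  obtain ⟨e, hes, he0, her⟩ := exists_isRotated hI hc (hV 1) (hV (n + 1)) flat ht₀ e₀
  have hSx : ∀ t x, deriv (S t).val x = cross (spinV 1 (S t) x) ((S t).val x) := fun t x => by
    have := spinV_deriv (S t) x 0
    rwa [show spinV 0 (S t) = (S t).val from funext fun _ => by simp] at this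
  have hSr : IsRotated I (fun t x => spinV 1 (S t) x) (fun t x => spinV (n + 1) (S t) x)
      fun t x => (S t).val x := by
    intro t ht x
    refine ⟨?_, ?_⟩
    · rw [← hSx]; exact spin_hasDerivAt (S t) x
    · have := hS2 t ht x
      rwa [spinFlow_apply, spinV_deriv] at this
  have hss : ∀ t x, inner ℝ ((S t).val x) ((S t).val x) = (1 : ℝ) := fun t => spin_inner_self _
  have hee : ∀ t ∈ I, ∀ x, inner ℝ (e t x) (e t x) = (1 : ℝ) := fun t ht x => by
    rw [her.inner_eq hI hc her ht₀ ht x, he0, inner_self_of_norm he₀]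
  have hse : ∀ t ∈ I, ∀ x, inner ℝ ((S t).val x) (e t x) = (0 : ℝ) := fun t ht x => by
    rw [hSr.inner_eq hI hc her ht₀ ht x, he0, hse₀]
  have her3 := hSr.cross her
  have hS1' : SmoothFam I fun t x => (S t).val x := hS1
  have hSsm := hS1'.dx hI
  let uf : ℝ → ℝ → ℂ := fun t x => ⟨inner ℝ (deriv (S t).val x) (e t x),
    inner ℝ (deriv (S t).val x) (cross ((S t).val x) (e t x))⟩
  have huf : SmoothFam I uf :=
    contDiff_of_re_im (ContDiffOn.inner ℝ hSsm hes) (ContDiffOn.inner ℝ hSsm (hS1'.cross hes))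
  classical
  let u : ℝ → Wave := fun t => if ht : t ∈ I then ⟨uf t, huf.contDiff_x hI ht⟩ else Wave.zero
  have hu : ∀ t ∈ I, (u t).val = uf t := fun t ht => by rw [show u t = _ from dif_pos ht]; rfl
  have hrot : ∀ t x, ∀ v : E3, inner ℝ ((S t).val x) v = (0 : ℝ) → cross (spinV 1 (S t) x) v
      = -(inner ℝ (deriv (S t).val x) v : ℝ) • (S t).val x := fun t x v hv => by
    rw [spinV_one, cross_cross_left, hv]
    module
  have hF : ∀ t ∈ I, IsParallelFrame (S t) (e t) (fun x => cross ((S t).val x) (e t x)) (u t) := by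
    intro t ht
    constructor <;> (try rw [hu t ht]) <;> intro x
    · exact norm_of_inner_self (hee t ht x)
    · exact hse t ht x
    · rfl
    · refine (spin_hasDerivAt (S t) x).congr_deriv ?_
      exact (eq_frame_components (hss t x) (hee t ht x) (hse t ht x) (spin_inner_deriv _ x)).symm
    · exact (her t ht x).1.congr_deriv (hrot t x _ (hse t ht x))
    · exact (her3 t ht x).1.congr_deriv (hrot t x _ (inner_cross_left _ _))
  refine ⟨u, ⟨huf.congr fun p hp => by rw [hu p.1 hp.1], fun t ht x => ?_⟩,
    fun t ht => ⟨_, _, hF t ht⟩⟩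
  rw [iHpow_eq, opH_waveO]
  have hVd := (hF t ht).hasDerivAt_frameVec (waveA_hasDerivAt (n + 1) (u t) x)
    ((wave_poly (n + 1)).1.hasDerivAt (u t) x)
  rw [← funext ((hF t ht).spinV_eq (n + 1))] at hVd
  have hVS := cross_frameVec (hss t x) (hse t ht x)
    (imPairing (waveO (n + 1)) (u t) x + ((u t).val x).re * (waveO (n + 1) (u t) x).im
      - ((u t).val x).im * (waveO (n + 1) (u t) x).re)
    (deriv (waveO (n + 1) (u t)) x - Complex.I * (u t).val x * (waveA (n + 1) (u t) x : ℂ))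
  have hd := hasDerivAt_cross hVd (spin_hasDerivAt (S t) x)
  rw [hVS] at hd
  have hSxt := (hS1'.hasDerivAt_mixed hI ht x).congr_deriv
    ((congrArg (deriv · x) (funext fun y => (hSr t ht y).2.deriv)).trans hd.deriv)
  -- S_x and the frame vectors share the rotation by Vₙ₊₁, which drops out of inner products. Only
  -- the tangential part (D_x Vₙ₊₁) ∧ S of S_xt contributes, and its covariant is D_x ω - i u α.
  have hcomp : ∀ b : ℝ → E3, HasDerivAt b (cross (spinV (n + 1) (S t) x) (b t)) t →
      HasDerivAt (fun τ => (inner ℝ (deriv (S τ).val x) (b τ) : ℝ)) (inner ℝ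
        ((deriv (waveO (n + 1) (u t)) x
          - Complex.I * (u t).val x * (waveA (n + 1) (u t) x : ℂ)).re • e t x
        + (deriv (waveO (n + 1) (u t)) x
          - Complex.I * (u t).val x * (waveA (n + 1) (u t) x : ℂ)).im
            • cross ((S t).val x) (e t x)) (b t)) t := by
    intro b hb
    refine (hSxt.inner ℝ hb).congr_deriv ?_
    rw [inner_add_left]
    linarith [inner_cross_skew (spinV (n + 1) (S t) x) (deriv (S t).val x) (b t)]
  have hf := inner_cross_cross_frame (hss t x) (hee t ht x) (hse t ht x)
  have hef : inner ℝ (e t x) (cross ((S t).val x) (e t x)) = (0 : ℝ) := inner_cross_right _ _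
  refine HasDerivAt.congr_of_eventuallyEq (f := fun τ => uf τ x) (hasDerivAt_of_re_im ?_ ?_) ?_
  · refine (hcomp (fun τ => e τ x) (her t ht x).2).congr_deriv ?_
    rw [inner_add_left, real_inner_smul_left, real_inner_smul_left, hee t ht,
      real_inner_comm, hef]
    ring
  · refine (hcomp (fun τ => cross ((S τ).val x) (e τ x)) (her3 t ht x).2).congr_deriv ?_
    rw [inner_add_left, real_inner_smul_left, real_inner_smul_left, hf, hef]
    ring
  · filter_upwards [hI.mem_nhds ht] with τ hτ
    rw [hu τ hτ]

end Solutions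

/-! ### First variation of the generating sequence -/

section Variation

open PowerSeries

/-- Z stands for ∂_z V and D for δV. In the x-derivative of V·(Z ∧ D) the common rotation by e/z + q
cancels. Only the inhomogeneous terms of the differentiated equations remain: -V ∧ e/z² in Z' and V
∧ p in D'. By the orthogonality relations they give e·D/z² and Z·p. -/
lemma variation_identity {R : Type*} [CommRing R] {z : R} {V V' Z Z' D D' q p e : Fin 3 → R}
    (hV : ∀ i, z * V' i = crossProduct V e i + z * crossProduct V q i)
    (hZ : ∀ i, V' i + z * Z' i
      = crossProduct Z e i + crossProduct V q i + z * crossProduct Z q i)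
    (hD : ∀ i, z * D' i
      = crossProduct D e i + z * (crossProduct D q i + crossProduct V p i))
    (hn : dot3 V V = 1) (hvz : dot3 V Z = 0) (hvd : dot3 V D = 0) :
    z ^ 2 * (dot3 V' (crossProduct Z D) + dot3 V (crossProduct Z' D + crossProduct Z D'))
      = dot3 e D + z ^ 2 * dot3 Z p := by
  have a0 := hV 0; have a1 := hV 1; have a2 := hV 2
  have b0 := hZ 0; have b1 := hZ 1; have b2 := hZ 2
  have c0 := hD 0; have c1 := hD 1; have c2 := hD 2
  simp only [crossProduct_zero, crossProduct_one, crossProduct_two, Pi.add_apply, dot3] at *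
  linear_combination
    (z * (Z 1 * D 2 - Z 2 * D 1) - (D 1 * V 2 - D 2 * V 1)) * a0
    + (z * (Z 2 * D 0 - Z 0 * D 2) - (D 2 * V 0 - D 0 * V 2)) * a1
    + (z * (Z 0 * D 1 - Z 1 * D 0) - (D 0 * V 1 - D 1 * V 0)) * a2
    + z * (D 1 * V 2 - D 2 * V 1) * b0 + z * (D 2 * V 0 - D 0 * V 2) * b1
    + z * (D 0 * V 1 - D 1 * V 0) * b2
    + z * (V 1 * Z 2 - V 2 * Z 1) * c0 + z * (V 2 * Z 0 - V 0 * Z 2) * c1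
    + z * (V 0 * Z 1 - V 1 * Z 0) * c2
    + (e 0 * D 0 + e 1 * D 1 + e 2 * D 2 + z ^ 2 * (Z 0 * p 0 + Z 1 * p 1 + Z 2 * p 2)) * hn
    - (e 0 * V 0 + e 1 * V 1 + e 2 * V 2) * hvd
    - z ^ 2 * (V 0 * p 0 + V 1 * p 1 + V 2 * p 2) * hvz

lemma powerSeries_two_ne_zero : (2 : ℝ⟦X⟧) ≠ 0 := fun h => by
  have := congrArg (coeff 0) h
  rw [show (2 : ℝ⟦X⟧) = C 2 from (map_ofNat C 2).symm, coeff_zero_C, map_zero] at this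
  norm_num at this

lemma HasCoeffDerivAt.derivative {F : ℝ → ℝ⟦X⟧} {F' : ℝ⟦X⟧} {x : ℝ}
    (hF : HasCoeffDerivAt F F' x) :
    HasCoeffDerivAt (fun y => d⁄dX ℝ (F y)) (d⁄dX ℝ F') x := fun n => by
  simp only [coeff_derivative]
  exact (hF (n + 1)).mul_const _

lemma HasCoeffDerivAt.congr_deriv {F : ℝ → ℝ⟦X⟧} {F' F'' : ℝ⟦X⟧} {x : ℝ}
    (hF : HasCoeffDerivAt F F' x) (h : F' = F'') : HasCoeffDerivAt F F'' x := h ▸ hF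

lemma hasCoeffDerivAt_crossProduct {F G : ℝ → Fin 3 → ℝ⟦X⟧} {F' G' : Fin 3 → ℝ⟦X⟧} {x : ℝ}
    (hF : ∀ i, HasCoeffDerivAt (fun y => F y i) (F' i) x)
    (hG : ∀ i, HasCoeffDerivAt (fun y => G y i) (G' i) x) (i : Fin 3) :
    HasCoeffDerivAt (fun y => crossProduct (F y) (G y) i)
      ((crossProduct F' (G x) + crossProduct (F x) G') i) x := by
  fin_cases i
  · refine HasCoeffDerivAt.congr_deriv (((hF 1).mul (hG 2)).sub ((hF 2).mul (hG 1))) ?_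
    simp [cross_apply]; ring
  · refine HasCoeffDerivAt.congr_deriv (((hF 2).mul (hG 0)).sub ((hF 0).mul (hG 2))) ?_
    simp [cross_apply]; ring
  · refine HasCoeffDerivAt.congr_deriv (((hF 0).mul (hG 1)).sub ((hF 1).mul (hG 0))) ?_
    simp [cross_apply]; ring

lemma hasCoeffDerivAt_dot3 {F G : ℝ → Fin 3 → ℝ⟦X⟧} {F' G' : Fin 3 → ℝ⟦X⟧} {x : ℝ}
    (hF : ∀ i, HasCoeffDerivAt (fun y => F y i) (F' i) x)
    (hG : ∀ i, HasCoeffDerivAt (fun y => G y i) (G' i) x) :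
    HasCoeffDerivAt (fun y => dot3 (F y) (G y)) (dot3 F' (G x) + dot3 (F x) G') x := by
  refine HasCoeffDerivAt.congr_deriv
    ((((hF 0).mul (hG 0)).add ((hF 1).mul (hG 1))).add ((hF 2).mul (hG 2))) ?_
  simp only [dot3]; ring

/-- The generating sequence as a sequence of vectors. -/
noncomputable def waveVec (n : ℕ) (u : Wave) (x : ℝ) : E3 :=
  !₂[waveA n u x, (waveO n u x).re, (waveO n u x).im]

lemma waveVec_zero (u : Wave) (x : ℝ) : waveVec 0 u x = EuclideanSpace.single 0 1 := by
  refine E3_ext ?_ ?_ ?_ <;> simp [waveVec]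

lemma waveVec_one (u : Wave) (x : ℝ) :
    waveVec 1 u x = !₂[0, (u.val x).re, (u.val x).im] := by
  rw [waveVec, waveO_one, waveA_succ]; simp

/-- The coefficients of z W_x = W ∧ (e + z q) with fixed e = (1, 0, 0) and q = (0, Re u, Im u): the
equation of V in the frame, where the dependence on u is explicit. -/
lemma waveVec_hasDerivAt (n : ℕ) (u : Wave) (x : ℝ) : HasDerivAt (waveVec n u)
    (cross (waveVec (n + 1) u x) (EuclideanSpace.single 0 1)
      + cross (waveVec n u x) (waveVec 1 u x)) x := by
  have hO := (wave_poly n).1.hasDerivAt u x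
  refine (hasDerivAt_toLp (waveA_hasDerivAt n u x) (hasDerivAt_re hO)
    (hasDerivAt_im hO)).congr_deriv ?_
  rw [waveVec_one]
  refine E3_ext ?_ ?_ ?_
  · simp [waveVec, imPairing]; ring
  · simp [waveVec, waveO_succ n]; ring
  · simp [waveVec, waveO_succ n]; ring

lemma smoothFam_waveVec {I : Set ℝ} (hI : IsOpen I) {c : ℝ → Wave}
    (hc : SmoothFam I fun t x => (c t).val x) (n : ℕ) :
    SmoothFam I fun t x => waveVec n (c t) x :=
  smoothFam_toLp (wavePoly_smoothFam hI hc (wave_poly n).2)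
    (wavePoly_smoothFam hI hc (wave_poly n).1.re) (wavePoly_smoothFam hI hc (wave_poly n).1.im)

/-- The generating series of the sequence. -/
noncomputable def serW (u : Wave) (x : ℝ) : Fin 3 → ℝ⟦X⟧ := vecSeries fun k => waveVec k u x

lemma serW_norm (u : Wave) (x : ℝ) : dot3 (serW u x) (serW u x) = 1 := by
  obtain ⟨S, e₂, e₃, hF⟩ := exists_parallelFrame u
  rw [← serV_norm S x]
  ext n
  rw [serW, serV, coeff_dot3, coeff_dot3]
  refine Finset.sum_congr rfl fun k _ => ?_
  rw [hF.spinV_eq, hF.spinV_eq,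
    inner_frameVec (spin_inner_self S x) (hF.inner_e₂ x) (hF.orth_e₂ x), inner_E3]
  rfl

/-- The coefficient of zⁿ⁺² in `variation_identity`: e selects the variation of αₙ₊₂, and ∂_z
supplies the factor n + 1 on Wₙ₊₁·δq. Modulo total derivatives the variation of the density is
therefore the pairing of ωₙ₊₁ with δu. -/
theorem waveVec_variation {I : Set ℝ} (hI : IsOpen I) {c : ℝ → Wave}
    (hc : SmoothFam I fun t x => (c t).val x) {t : ℝ} (ht : t ∈ I) (n : ℕ) (x : ℝ) :
    HasDerivAt (fun y => coeff n (dot3 (serW (c t) y) (crossProduct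
        (fun i => d⁄dX ℝ (serW (c t) y i))
        (vecSeries fun k => deriv (fun τ => waveVec k (c τ) y) t))))
      (deriv (fun τ => waveVec (n + 2) (c τ) x) t 0 + (n + 1) *
        inner ℝ (waveVec (n + 1) (c t) x) (deriv (fun τ => waveVec 1 (c τ) x) t)) x := by
  have hsm := smoothFam_waveVec hI hc
  set δ : ℕ → ℝ → E3 := fun k y => deriv (fun τ => waveVec k (c τ) y) t with hδ
  have hδt : ∀ k y, HasDerivAt (fun τ => waveVec k (c τ) y) (δ k y) t := fun k y =>
    (hsm k).hasDerivAt_t hI ht y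
  have hδ0 : ∀ y, δ 0 y = 0 := fun y => by simp [hδ, waveVec_zero]
  set e : E3 := EuclideanSpace.single 0 1
  let D' : ℕ → E3 := fun k => cross (δ (k + 1) x) e
    + (cross (δ k x) (waveVec 1 (c t) x) + cross (waveVec k (c t) x) (δ 1 x))
  let W' : ℕ → E3 := fun k => cross (waveVec (k + 1) (c t) x) e
    + cross (waveVec k (c t) x) (waveVec 1 (c t) x)
  have hδx : ∀ k, HasDerivAt (δ k) (D' k) x := by
    intro k
    have h1 := (hsm k).hasDerivAt_mixed hI ht x
    have h2 : HasDerivAt (fun τ => deriv (waveVec k (c τ)) x) (D' k) t := by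
      simp only [(waveVec_hasDerivAt k _ x).deriv]
      have := (hasDerivAt_cross (hδt (k + 1) x) (hasDerivAt_const t e)).add
        (hasDerivAt_cross (hδt k x) (hδt 1 x))
      simpa using! this
    rw [← h1.unique h2]
    exact ((hsm k).dt hI).hasDerivAt_x hI ht x
  have hWx : ∀ i, HasCoeffDerivAt (fun y => serW (c t) y i) (vecSeries W' i) x :=
    hasCoeffDerivAt_vecSeries fun k => waveVec_hasDerivAt k (c t) x
  have hDx : ∀ i, HasCoeffDerivAt (fun y => vecSeries (fun k => δ k y) i) (vecSeries D' i) x :=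
    hasCoeffDerivAt_vecSeries hδx
  have hWt : ∀ i, HasCoeffDerivAt (fun τ => serW (c τ) x i)
      (vecSeries (fun k => δ k x) i) t := hasCoeffDerivAt_vecSeries fun k => hδt k x
  have hV : ∀ i, X * vecSeries W' i = crossProduct (serW (c t) x) (constVec e) i
      + X * crossProduct (serW (c t) x) (constVec (waveVec 1 (c t) x)) i := by
    intro i
    ext k
    rw [map_add, serW, coeff_cross_const]
    cases k with
    | zero => rw [coeff_zero_X_mul, coeff_zero_X_mul, waveVec_zero, cross_self']; simp
    | succ k => rw [coeff_succ_X_mul, coeff_succ_X_mul, coeff_cross_const, coeff_vecSeries]; rfl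
  have hD : ∀ i, X * vecSeries D' i = crossProduct (vecSeries fun k => δ k x) (constVec e) i
      + X * (crossProduct (vecSeries fun k => δ k x) (constVec (waveVec 1 (c t) x)) i
        + crossProduct (serW (c t) x) (constVec (δ 1 x)) i) := by
    intro i
    ext k
    rw [map_add, serW, coeff_cross_const]
    cases k with
    | zero => rw [coeff_zero_X_mul, coeff_zero_X_mul, hδ0, cross_zero_left]; simp
    | succ k =>
      rw [coeff_succ_X_mul, coeff_succ_X_mul, map_add, coeff_cross_const, coeff_cross_const,
        coeff_vecSeries]
      rfl
  -- The z-derivative of `hV`; the terms without a factor z come from differentiating that factor.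
  have hZ : ∀ i, vecSeries W' i + X * d⁄dX ℝ (vecSeries W' i)
      = crossProduct (fun j => d⁄dX ℝ (serW (c t) x j)) (constVec e) i
      + crossProduct (serW (c t) x) (constVec (waveVec 1 (c t) x)) i
      + X * crossProduct (fun j => d⁄dX ℝ (serW (c t) x j))
        (constVec (waveVec 1 (c t) x)) i := by
    intro i
    have h := congrArg (d⁄dX ℝ) (hV i)
    have hc : ∀ a j, crossProduct (fun j => d⁄dX ℝ (serW (c t) x j)) (constVec a) j
        = d⁄dX ℝ (crossProduct (serW (c t) x) (constVec a) j) := by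
      intro a j
      fin_cases j <;> simp [cross_apply, constVec, Derivation.leibniz, mul_comm]
    rw [hc, hc]
    simp only [map_add, Derivation.leibniz, derivative_X, smul_eq_mul, mul_one] at h
    linear_combination h
  have hn := serW_norm (c t) x
  have hvz : dot3 (serW (c t) x) (fun j => d⁄dX ℝ (serW (c t) x j)) = 0 := by
    have h := congrArg (d⁄dX ℝ) hn
    simp only [dot3, map_add, Derivation.leibniz, smul_eq_mul, Derivation.map_one_eq_zero] at h ⊢
    have h2 : (2 : ℝ⟦X⟧) ≠ 0 := powerSeries_two_ne_zero
    refine mul_left_cancel₀ h2 ?_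
    linear_combination h
  have hvd : dot3 (serW (c t) x) (vecSeries fun k => δ k x) = 0 := by
    have h1 := hasCoeffDerivAt_dot3 hWt hWt
    have h0 : HasCoeffDerivAt (fun τ => dot3 (serW (c τ) x) (serW (c τ) x)) 0 t := fun k => by
      simp only [serW_norm]
      simpa using! hasDerivAt_const t (coeff k (1 : ℝ⟦X⟧))
    have h := h1.unique h0
    simp only [dot3] at h ⊢
    have h2 : (2 : ℝ⟦X⟧) ≠ 0 := powerSeries_two_ne_zero
    refine mul_left_cancel₀ h2 ?_
    linear_combination h
  have key := congrArg (coeff (n + 2)) (variation_identity hV hZ hD hn hvz hvd)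
  have hΦ := hasCoeffDerivAt_dot3 hWx (hasCoeffDerivAt_crossProduct
    (fun i => (hWx i).derivative) hDx) n
  refine hΦ.congr_deriv ?_
  rw [coeff_X_pow_mul, map_add (coeff (n + 2)), coeff_X_pow_mul] at key
  refine key.trans ?_
  rw [coeff_dot_const]
  simp [e, dot3, constVec, serW, coeff_derivative, inner_E3]
  ring

end Variation

/-! ### The variational derivatives -/

section VariationalDerivative

open MeasureTheory

lemma integrable_of_continuous_of_zero {f : ℝ → ℝ} (hf : Continuous f) {R : ℝ}
    (h : ∀ x, R < |x| → f x = 0) : Integrable f :=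
  hf.integrable_of_hasCompactSupport <| HasCompactSupport.intro (isCompact_Icc (a := -R) (b := R))
    fun x hx => h x <| by
      by_contra! h'
      exact hx (abs_le.1 h')

lemma hasDerivAt_integral_smoothFam {f : ℝ → ℝ → ℝ} (hf : SmoothFam univ f) {R : ℝ}
    (h : ∀ ε x, R < |x| → f ε x = 0) :
    HasDerivAt (fun ε => ∫ x, f ε x) (∫ x, deriv (fun τ => f τ x) 0) 0 := by
  have hdt := hf.dt isOpen_univ
  have hcont : Continuous fun p : ℝ × ℝ => deriv (fun τ => f τ p.2) p.1 := by
    have := hdt.continuousOn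
    rwa [univ_prod_univ, continuousOn_univ] at this
  have hx : ∀ ε, Continuous (f ε) := fun ε => (hf.contDiff_x isOpen_univ (mem_univ ε)).continuous
  obtain ⟨C, hC⟩ := ((isCompact_Icc (a := (-1 : ℝ)) (b := 1)).prod
    (isCompact_Icc (a := -R) (b := R))).exists_bound_of_continuousOn hcont.continuousOn
  refine (hasDerivAt_integral_of_dominated_loc_of_deriv_le (s := Icc (-1) 1)
    (F' := fun ε x => deriv (fun τ => f τ x) ε)
    (bound := (Icc (-R) R).indicator fun _ => C) (Icc_mem_nhds (by norm_num) (by norm_num))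
    (Eventually.of_forall fun ε => (hx ε).aestronglyMeasurable)
    (integrable_of_continuous_of_zero (hx 0) (h 0))
    (hcont.comp (continuous_const.prodMk continuous_id)).aestronglyMeasurable
    (Eventually.of_forall fun x ε hε => ?_)
    ((integrable_indicator_iff measurableSet_Icc).2 (integrableOn_const (by simp)))
    (Eventually.of_forall fun x ε _ => hf.hasDerivAt_t isOpen_univ (mem_univ ε) x)).2
  by_cases hxR : x ∈ Icc (-R) R
  · rw [indicator_of_mem hxR]
    exact hC (ε, x) ⟨hε, hxR⟩
  · rw [indicator_of_notMem hxR]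
    have : (fun τ => f τ x) = fun _ => 0 := funext fun τ => h τ x <| by
      by_contra! h'
      exact hxR (abs_le.1 h')
    simp [this]

lemma smoothFam_vary (u v : Wave) : SmoothFam univ fun ε x => (u.vary v ε).val x := by
  refine ContDiff.contDiffOn ?_
  exact (u.2.comp contDiff_snd).add
    ((Complex.ofRealCLM.contDiff.comp contDiff_fst).mul (v.2.comp contDiff_snd))

lemma wavePoly_vary_eq {u v : Wave} {x : ℝ} (hx : x ∉ tsupport v.val) (ε : ℝ)
    {G : Wave → ℝ → ℝ} (hG : G ∈ wavePoly) : G (u.vary v ε) x = G u x := by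
  have h : (u.vary v ε).val =ᶠ[𝓝 x] u.val := by
    filter_upwards [notMem_tsupport_iff_eventuallyEq.1 hx] with y hy
    show u.val y + (ε : ℂ) * v.val y = u.val y
    rw [hy]; simp
  refine adjoin_eq_of_jets_eq ?_ hG
  rintro _ (⟨k, rfl⟩ | ⟨k, rfl⟩)
  · exact congrArg Complex.re (h.iteratedDeriv_eq k)
  · exact congrArg Complex.im (h.iteratedDeriv_eq k)

/-- For compactly supported variations the total derivative in `waveVec_variation` integrates to
zero. The factor n + 1 it carries cancels the prefactor -2/(1+n) of the density. -/
theorem isVarDeriv_hamDensity (n : ℕ) : IsVarDeriv (hamDensity n) (waveO (n + 1)) := by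
  refine ⟨fun u => ((wave_poly (n + 1)).1.contDiff u).continuous, fun u v hv => ?_⟩
  obtain ⟨R, hR⟩ := hv.isCompact.isBounded.exists_norm_le
  have hout : ∀ x, R < |x| → x ∉ tsupport v.val := fun x hx hx' => (hR x hx').not_gt hx
  have hc := smoothFam_vary u v
  have hc0 : u.vary v 0 = u := Subtype.ext <| funext fun x => by simp [Wave.vary]
  have hA : ∀ k x, R < |x| → ∀ ε, waveVec k (u.vary v ε) x = waveVec k u x := by
    intro k x hx ε
    have h1 := wavePoly_vary_eq (u := u) (hout x hx) ε (wave_poly k).2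
    have h2 := wavePoly_vary_eq (u := u) (hout x hx) ε (wave_poly k).1.re
    have h3 := wavePoly_vary_eq (u := u) (hout x hx) ε (wave_poly k).1.im
    exact E3_ext h1 h2 h3
  have hsm := smoothFam_waveVec isOpen_univ hc
  let δ : ℕ → ℝ → E3 := fun k y => deriv (fun τ => waveVec k (u.vary v τ) y) 0
  have hδt : ∀ k y, HasDerivAt (fun τ => waveVec k (u.vary v τ) y) (δ k y) 0 := fun k y =>
    (hsm k).hasDerivAt_t isOpen_univ (mem_univ 0) y
  have hδ0 : ∀ k x, R < |x| → δ k x = 0 := fun k x hx => by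
    simp only [δ, hA k x hx, deriv_const]
  have hδ1 : ∀ x, δ 1 x = !₂[0, (v.val x).re, (v.val x).im] := by
    intro x
    refine (hδt 1 x).unique ?_
    simp only [waveVec_one]
    have h : HasDerivAt (fun τ : ℝ => (u.vary v τ).val x) (v.val x) 0 := by
      have := ((hasDerivAt_id (0 : ℝ)).ofReal_comp.mul_const (v.val x)).const_add (u.val x)
      exact this.congr_deriv (by simp)
    exact hasDerivAt_toLp (hasDerivAt_const _ _) (hasDerivAt_re h) (hasDerivAt_im h)
  have hδc : ∀ k i, Continuous fun x => δ k x i := fun k i =>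
    (((hsm k).dt isOpen_univ).clm (coordL i)).contDiff_x isOpen_univ (mem_univ 0) |>.continuous
  have hωc := ((wave_poly (n + 1)).1.contDiff u).continuous
  have hvc : Continuous v.val := v.2.continuous
  have hpair : Continuous fun x => (conj (waveO (n + 1) u x) * v.val x).re := by fun_prop
  have hv0 : ∀ x, R < |x| → v.val x = 0 := fun x hx => image_eq_zero_of_notMem_tsupport (hout x hx)
  set Φ : ℝ → ℝ := fun y => PowerSeries.coeff n (dot3 (serW u y) (crossProduct
      (fun i => PowerSeries.derivative ℝ (serW u y i)) (vecSeries fun k => δ k y))) with hΦdef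
  have hΦ : ∀ x, HasDerivAt Φ (δ (n + 2) x 0
      + (n + 1) * (conj (waveO (n + 1) u x) * v.val x).re) x := by
    intro x
    have h := waveVec_variation isOpen_univ hc (mem_univ 0) n x
    rw [hc0] at h
    refine h.congr_deriv ?_
    show δ (n + 2) x 0 + (n + 1) * inner ℝ _ (δ 1 x) = _
    rw [hδ1, inner_E3]
    simp [waveVec]
  have hΦ0 : ∀ x, R < |x| → Φ x = 0 := by
    intro x hx
    have : (vecSeries fun k => δ k x) = 0 := by
      funext i; ext k
      simp [hδ0 k x hx]
    simp [hΦdef, this, dot3]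
  have hint := integral_eq_zero_of_hasDerivAt_of_integrable hΦ
    (integrable_of_continuous_of_zero (R := R) ((hδc _ 0).add (continuous_const.mul hpair))
      fun x hx => by rw [hδ0 _ x hx, hv0 x hx]; simp)
    (integrable_of_continuous_of_zero (continuous_iff_continuousAt.2 fun x =>
      (hΦ x).continuousAt) hΦ0)
  have hH : hamDensity n ∈ wavePoly := by
    rw [hamDensity_eq]; exact wavePoly_const_mul _ (wave_poly _).2
  have hmain := hasDerivAt_integral_smoothFam
    (f := fun ε x => hamDensity n (u.vary v ε) x - hamDensity n u x) (R := R)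
    (ContDiffOn.sub (wavePoly_smoothFam isOpen_univ hc hH)
      (((isDiffRing_wave.contDiff _ hH u).comp contDiff_snd).contDiffOn))
    fun ε x hx => by rw [wavePoly_vary_eq (hout x hx) ε hH, sub_self]
  refine hmain.congr_deriv ?_
  -- The varied density is the desired pairing minus a multiple of the derivative of `Φ`, which has
  -- compact support.
  have hderiv : ∀ x, deriv (fun τ => hamDensity n (u.vary v τ) x - hamDensity n u x) 0
      = 2 * (conj (waveO (n + 1) u x) * v.val x).re - 2 / (1 + (n : ℝ)) * (δ (n + 2) x 0
      + (n + 1) * (conj (waveO (n + 1) u x) * v.val x).re) := by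
    intro x
    have h := ((hasDerivAt_coord (hδt (n + 2) x) 0).const_mul (-(2 / (1 + (n : ℝ))))).sub_const
      (hamDensity n u x)
    have hn : (1 + (n : ℝ)) ≠ 0 := by positivity
    rw [hamDensity_eq] at h ⊢
    refine h.deriv.trans ?_
    field_simp
    ring
  simp only [hderiv]
  rw [integral_sub, integral_const_mul (2 / (1 + (n : ℝ))), hint, mul_zero, sub_zero]
  · exact integrable_of_continuous_of_zero (R := R) (continuous_const.mul hpair)
      fun x hx => by rw [hv0 x hx]; simp
  · exact integrable_of_continuous_of_zero (R := R)
      (continuous_const.mul ((hδc _ 0).add (continuous_const.mul hpair)))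
      fun x hx => by rw [hδ0 _ x hx, hv0 x hx]; simp

/-- Real test functions detect the real part and imaginary ones the imaginary part. Continuity
upgrades equality almost everywhere to equality at every point. -/
lemma IsVarDeriv.unique {H : Wave → ℝ → ℝ} {E E' : Wave → ℝ → ℂ} (h : IsVarDeriv H E)
    (h' : IsVarDeriv H E') : E = E' := by
  have key : ∀ (u v : Wave), HasCompactSupport v.val →
      ∫ x, 2 * (conj (E u x) * v.val x).re = ∫ x, 2 * (conj (E' u x) * v.val x).re :=
    fun u v hv => (h.2 u v hv).unique (h'.2 u v hv)
  have aux : ∀ {f g : ℝ → ℝ}, Continuous f → Continuous g → (∀ φ : ℝ → ℝ, ContDiff ℝ ∞ φ →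
      HasCompactSupport φ → ∫ x, φ x • f x = ∫ x, φ x • g x) → f = g := fun hf hg hfg =>
    (hf.ae_eq_iff_eq volume hg).1
      (ae_eq_of_integral_contDiff_smul_eq hf.locallyIntegrable hg.locallyIntegrable hfg)
  funext u
  have hE := h.1 u
  have hE' := h'.1 u
  have hre : (fun x => (E u x).re) = fun x => (E' u x).re := by
    refine aux (by fun_prop) (by fun_prop) fun φ hφ hs => ?_
    have := key u ⟨fun x => (φ x : ℂ), Complex.ofRealCLM.contDiff.comp hφ⟩
      (hs.comp_left (g := fun r : ℝ => (r : ℂ)) rfl)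
    rw [integral_const_mul, integral_const_mul] at this
    simpa [Wave.val, mul_comm] using! this
  have him : (fun x => (E u x).im) = fun x => (E' u x).im := by
    refine aux (by fun_prop) (by fun_prop) fun φ hφ hs => ?_
    have := key u ⟨fun x => (φ x : ℂ) * Complex.I,
      (Complex.ofRealCLM.contDiff.comp hφ).mul contDiff_const⟩
      (hs.comp_left (g := fun r : ℝ => (r : ℂ) * Complex.I) (by simp))
    rw [integral_const_mul, integral_const_mul] at this
    simpa [Wave.val, mul_comm] using! this
  funext x
  exact Complex.ext (congrFun hre x) (congrFun him x)

theorem existsUnique_varDeriv (n : ℕ) : ∃! E, IsVarDeriv (hamDensity n) E :=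
  ⟨_, isVarDeriv_hamDensity n, fun _ h => h.unique (isVarDeriv_hamDensity n)⟩

theorem varDeriv_eq (n : ℕ) : varDeriv (hamDensity n) = iHpow n := by
  rw [varDeriv, dif_pos (existsUnique_varDeriv n), iHpow_eq]
  exact (existsUnique_varDeriv n).exists.choose_spec.unique (isVarDeriv_hamDensity n)

end VariationalDerivative

end SpinHierarchy

/-! ### The hierarchy theorem -/

theorem mainTheorem3 :
    -- The flows on `u` are well defined and bi-Hamiltonian.
    (∀ n : ℕ,
      HasDxInv wavePoly waveZero (hamPre n) ∧
      (∃! E, IsVarDeriv (hamDensity n) E) ∧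
      varDeriv (hamDensity n) = iHpow n ∧
      HasDxInv wavePoly waveZero (imPairing (varDeriv (hamDensity n))) ∧
      opH (varDeriv (hamDensity n)) = opI (varDeriv (hamDensity (n + 1)))) ∧
    -- The vector models are well defined, polynomial and `SO(3)`-invariant.
    (∀ n : ℕ,
      HasDxInv spinPoly spinConst (spinPairing (spinFlow n)) ∧
      (∀ i : Fin 3, (fun S x => spinFlow n S x i) ∈ spinPoly) ∧
      (∀ S x, inner ℝ (S.val x) (spinFlow n S x) = 0) ∧
      (∀ (A : E3 ≃ₗᵢ[ℝ] E3), LinearMap.det (A.toLinearEquiv : E3 →ₗ[ℝ] E3) = 1 →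
        ∀ S S' : SpinCurve, (∀ x, S'.val x = A (S.val x)) →
          ∀ x, spinFlow n S' x = A (spinFlow n S x))) ∧
    -- The flows of the hierarchy commute.
    (∀ m n : ℕ, FlowsCommute SpinCurve.val (spinFlow m) (spinFlow n)) ∧
    -- The right-hand sides correspond: `f⁽ⁿ⁾ = Re(ϖ̄⁽ⁿ⁾ E^⊥)` with `ϖ⁽ⁿ⁾ = δ𝔥⁽ⁿ⁾/δū`.
    (∀ (n : ℕ) (S : SpinCurve) (e₂ e₃ : ℝ → E3) (u : Wave), IsParallelFrame S e₂ e₃ u →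
      ∀ x, spinFlow n S x =
        (varDeriv (hamDensity n) u x).re • e₂ x + (varDeriv (hamDensity n) u x).im • e₃ x) ∧
    -- The solutions correspond: in a suitable parallel frame every solution of a vector model
    -- gives a solution of the flow on `u`, and every solution `u` arises in this way.
    (∀ (n : ℕ) (I : Set ℝ), IsOpen I → I.OrdConnected →
      (∀ S : ℝ → SpinCurve, IsSolution SpinCurve.val (spinFlow n) I S →
        ∃ u : ℝ → Wave, IsSolution Wave.val (waveFlow n) I u ∧
          ∀ t ∈ I, ∃ e₂ e₃, IsParallelFrame (S t) e₂ e₃ (u t)) ∧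
      (∀ u : ℝ → Wave, IsSolution Wave.val (waveFlow n) I u →
        ∃ S : ℝ → SpinCurve, IsSolution SpinCurve.val (spinFlow n) I S ∧
          ∀ t ∈ I, ∃ e₂ e₃, IsParallelFrame (S t) e₂ e₃ (u t))) ∧
    -- The Heisenberg model and the mKdV model, and the corresponding map equations.
    (∀ S x, spinFlow 1 S x = cross (S.val x) (iteratedDeriv 2 S.val x)) ∧
    (∀ S x, spinFlow 2 S x = -(iteratedDeriv 3 S.val x +
      (3 / 2 : ℝ) • deriv (fun y => ‖deriv S.val y‖ ^ 2 • S.val y) x)) ∧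
    (∀ γ x, mapFlow 1 γ x = opJ (covDeriv tangent) γ x) ∧
    (∀ γ x, mapFlow 2 γ x = -(covDeriv (covDeriv tangent) γ x +
      ((1 / 2 : ℝ) * metric tangent tangent γ x) • tangent γ x)) ∧
    -- Equivalence with the dynamical maps into the sphere.
    Function.Bijective SphereCurve.toSpin ∧
    (∀ n : ℕ,
      HasDxInv mapPoly mapConst (metric (opJ tangent) (mapFlow n)) ∧
      (∀ γ : SphereCurve, mapFlow n γ = spinFlow n γ.toSpin) ∧
      (∀ (I : Set ℝ) (γ : ℝ → SphereCurve),
        IsSolution SphereCurve.val (mapFlow n) I γ ↔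
          IsSolution SpinCurve.val (spinFlow n) I (fun t => (γ t).toSpin))) ∧
    -- The Hamiltonian densities in terms of `S` and `γ`.
    (∀ n : ℕ,
      HasDxInv spinPoly spinConst (spinPre n) ∧
      HasDxInv mapPoly mapConst (metric tangent (covDeriv (mapFlow n))) ∧
      (∀ (S : SpinCurve) (e₂ e₃ : ℝ → E3) (u : Wave), IsParallelFrame S e₂ e₃ u →
        ∀ x, hamDensity n u x = 2 * spinDensity n S x) ∧
      (∀ γ : SphereCurve, mapDensity n γ = spinDensity n γ.toSpin) ∧
      spinDensity n ∈ spinScalars ∧ mapDensity n ∈ mapScalars) ∧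
    -- All densities give constants of motion for all vector models and all map equations.
    (∀ m n : ℕ,
      IsConstantOfMotion spinPoly spinConst SpinCurve.val (spinFlow n) (spinDensity m) ∧
      IsConstantOfMotion mapPoly mapConst SphereCurve.val (mapFlow n) (mapDensity m)) := by
  refine ⟨fun n => ⟨isDiffRing_wave.hasDxInv (hamPre_isDxInv n), existsUnique_varDeriv n,
    varDeriv_eq n, ?_, ?_⟩, fun n => ⟨isDiffRing_spin.hasDxInv (spinPairing_isDxInv n),
    isPolyVec_spinFlow n, spinFlow_orth n, fun A hA S S' h x => ?_⟩, spin_flowsCommute,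
    fun n S e₂ e₃ u hF x => ?_, fun n I hI hc => ⟨fun S hS => ?_, fun u hu => ?_⟩,
    spinFlow_one, spinFlow_two, mapFlow_one, mapFlow_two, toSpin_bijective,
    fun n => ⟨isDiffRing_map.hasDxInv (mapPairing_isDxInv n),
      fun γ => congrFun (mapFlow_eq n) γ, fun I γ => map_isSolution_iff n I γ⟩,
    fun n => ⟨isDiffRing_spin.hasDxInv (spinPre_isDxInv n),
      isDiffRing_map.hasDxInv (mapPre_isDxInv n), fun S e₂ e₃ u hF x => hF.hamDensity_eq n x,
      fun γ => congrFun (mapDensity_eq n) γ, spinDensity_mem_scalars n, mapDensity_mem n⟩,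
    fun m n => ⟨spin_isConstantOfMotion m n, map_isConstantOfMotion m n⟩⟩
  · rw [varDeriv_eq, iHpow_eq]
    exact isDiffRing_wave.hasDxInv (waveA_isDxInv n)
  · rw [varDeriv_eq, varDeriv_eq, opH_iHpow]
  · rw [spinFlow_apply, spinFlow_apply]
    exact (spinV_equivariant A hA h n).2 x
  · rw [varDeriv_eq, iHpow_eq, hF.e₃_eq]
    exact hF.spinFlow_eq n x
  · rw [waveFlow, varDeriv_eq]
    exact exists_wave_solution hI hc n hS
  · rw [waveFlow, varDeriv_eq] at hu
    exact exists_spin_solution hI hc n hu
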